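/- **Setting.** Let $N\ge 0$, let $q\in\mathbb C^\times$ be not a root of unity, put $\gamma=q^{-N-1}$, and let $\mathbb V$ be a complex vector space with basis $z_0,\dots,z_N$ ($z_{-1}=z_{N+1}=0$). Write $$A_n(\alpha,\beta,\gamma,\delta)=\frac{(1-\alpha q^{n+1})(1-\alpha\beta q^{n+1})(1-\beta\delta q^{n+1})(1-\gamma q^{n+1})}{(1-\alpha\beta q^{2n+1})(1-\alpha\beta q^{2n+2})},\qquad C_n(\alpha,\beta,\gamma,\delta)=\frac{q(1-q^n)(1-\beta q^n)(\gamma-\alpha\beta q^n)(\delta-\alpha q^n)}{(1-\alpha\beta q^{2n})(1-\alpha\beta q^{2n+1})},$$ $B_n=-A_n-C_n+1+\gamma\delta q$, and $\psi(\alpha,\beta,\gamma,\delta)=q(\alpha+\gamma)(1+\beta\delta)+q(\beta+\gamma)(\alpha+\delta)$. For parameters $\alpha,\beta,\delta,\sigma$ and $\tilde\alpha\neq0$, $\tilde\delta$, $\nu_1,\dots,\nu_N\ne0$, with $\tilde\beta=\alpha\beta/\tilde\alpha$, put $$Zz_i=(q^{-i}+\alpha\beta q^{i+1}+\sigma)z_i,\qquad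 Vz_i=C_{i+1}z_{i+1}+B_iz_i+A_{i-1}z_{i-1},\qquad \tilde Vz_i=\tilde C_{i+1}\nu_{i+1}z_{i+1}+\tilde B_iz_i+\tilde A_{i-1}\nu_i^{-1}z_{i-1},$$ where $A,B,C$ are taken at $(\alpha,\beta,\gamma,\delta)$ and $\tilde A,\tilde B,\tilde C$ at $(\tilde\alpha,\tilde\beta,\gamma,\tilde\delta)$. The *Heun relations* are, for some $h_0,\dots,h_9\in\mathbb C$, $$\tilde VZ=h_0+h_1Z+h_2V+h_3VZ+h_4ZV,\qquad ZV=h_5+h_6Z+h_7\tilde V+h_8\tilde VZ+h_9Z\tilde V.\qquad(1)$$ With $h_{n,m}=h_n+qh_m$, parameters $s,\mu_2,\mu_7\in\mathbb C^\times$ are attached to $\sigma$ and $(h_i)$ by $\sigma=-1/s-qs\alpha\beta$, $h_2=-h_{4,3}/\mu_2-h_{3,4}\alpha\beta\mu_2-\sigma(h_3+h_4)$, $h_7=-h_{9,8}/\mu_7-h_{8,9}\alpha\beta\mu_7-\sigma(h_8+h_9)$, together with $h_1=h_6=0$. A pair $(X,Y)$ of endomorphisms of $\mathbb V$ is a *Leonard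 pair* if in some basis $X$ is irreducible tridiagonal (tridiagonal, no zero on the sub- and superdiagonal) and $Y$ diagonal, and in some basis $X$ is diagonal and $Y$ irreducible tridiagonal. The triple $(V,\tilde V,Z)$ is a *Leonard trio* if there are a basis $(v_n)$ in which $V$ is diagonal with distinct eigenvalues $\lambda_n$ and $Z$, $\tilde VZ$ are tridiagonal, and a basis $(\tilde v_x)$ in which $\tilde V$ is diagonal with distinct eigenvalues $\tilde\lambda_x$ and $Z$, $ZV$ are tridiagonal. It is an *irreducible Leonard trio* if there are a basis in which $V$ is diagonal, $\tilde VZ$ tridiagonal and $Z$ irreducible tridiagonal, a basis in which $\tilde V$ is diagonal, $ZV$ tridiagonal and $Z$ irreducible tridiagonal, and a basis in which $Z$ is diagonal and $V,\tilde V$ are irreducible tridiagonal. A Leonard trio is called *non-degenerate* here if its two bases can be chosen such that $$X_{n+1,n}-\tilde\lambda_xZ_{n+1,n}\ne0\quad(0\le n<N,\ 0\le x\le N),\qquad \tilde X_{x,x+1}-\lambda_n\tilde Z_{x,x+1}\neq0\quad(0\le x<N,\ 0\le n\le N),$$ where $X,Z$ are the matrices of $\tilde VZ,Z$ in $(v_n)$,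 and $\tilde X,\tilde Z$ are those of $ZV,Z$ in $(\tilde v_x)$ (the entry $(m,n)$ being the coefficient of the $m$-th basis vector in the image of the $n$-th). **Theorem.** For generic $(\alpha,\beta,\delta)$, i.e. outside the zero set of some nonzero polynomial in three variables (which may depend on $N$ and $q$), the following holds. Call $s\in\mathbb C^\times$ admissible if $s\ne q^i$ and $\alpha\beta sq^i\neq1$ for $1\le i\le N$; for such $s$ put $\sigma_s=-1/s-qs\alpha\beta$ and let $\tilde V_s$ be the operator $\tilde V$ with $$\tilde\alpha=\alpha,\qquad\tilde\delta=\frac{\alpha}{\beta\delta},\qquad \nu_i=\frac{\beta(s-q^i)(\delta-\alpha q^i)}{(1-\beta\delta q^i)(1-\alpha\beta sq^i)} .$$ 1. *(The family.)* For every admissible $s$, with $\sigma=\sigma_s$: $(V,Z)$ and $(\tilde V_s,Z)$ are Leonard pairs, $(V,\tilde V_s,Z)$ is an irreducible Leonard trio, and with $[X,Y]_q=XY-qYX$, $$\tilde V_sZ=h_0+\frac{(1-\alpha\beta s^2)(1-\alpha\beta q^2s^2)}{\beta\delta s^2(1+q)}V+\frac1{1-q^2}\Big(\frac{\alpha qs}{\delta}[Z,V]_q+\frac1{\beta\delta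 s}[V,Z]_q\Big),$$ $$ZV=h_5+\frac{\delta(1-\alpha\beta s^2)(1-\alpha\beta q^2s^2)}{\alpha s^2(1+q)}\tilde V_s+\frac1{1-q^2}\Big(\frac{\delta}{s\alpha}[Z,\tilde V_s]_q+q\beta\delta s[\tilde V_s,Z]_q\Big),$$ $$h_0=\psi(\alpha,\beta,\gamma,\tfrac{\alpha}{\beta\delta})-\frac{1+qs^2\alpha\beta}{\beta\delta s(1+q)}\psi(\alpha,\beta,\gamma,\delta),\qquad h_5=\psi(\alpha,\beta,\gamma,\delta)-\frac{\delta(1+qs^2\alpha\beta)}{\alpha s(1+q)}\psi(\alpha,\beta,\gamma,\tfrac{\alpha}{\beta\delta}).$$ These are relations of the form (1) with parameters $\mu_2=s$, $\mu_7=\frac1{\alpha\beta s}$, $h_{3,4}=\frac1{\beta\delta s}$. 2. *(Non-degeneracy.)* For all but finitely many $s\in\mathbb C$, $s$ is admissible and $(V,\tilde V_s,Z)$ with $\sigma=\sigma_s$ is non-degenerate. 3. *(Uniqueness.)* Let $N\ge4$. Let $\tilde\alpha\neq0$, $\tilde\delta$, $\sigma\in\mathbb C$ and $\nu_1,\dots,\nu_N\in\mathbb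 C^\times$ be such that $(\tilde V,Z)$ is a Leonard pair, the Heun relations (1) hold with some $(h_0,\dots,h_9)$, and $(V,\tilde V,Z)$ is a non-degenerate Leonard trio. Then there are an admissible $s$ and a scalar $c$ such that $\sigma=\sigma_s$, $\tilde V=c\,\tilde V_s$, the coefficients $h_0,\dots,h_4$ are $c$ times, $h_5,h_6$ equal to, and $h_7,h_8,h_9$ are $c^{-1}$ times those of part 1 (so that $\mu_2=s$, $\mu_7=\frac1{\alpha\beta s}$, $h_{3,4}=\frac{c}{\beta\delta s}$ are parameters for them), and either $c=1$, $\tilde\delta=\frac{\alpha}{\beta\delta}$, $\tilde\alpha\in\{\alpha,\alpha/\delta\}$, or $c=\tilde\delta=\frac{\beta\delta}{\alpha}$, $\tilde\alpha\in\{\beta,\beta\delta\}$. If $(\tilde\alpha,\tilde\delta)=(\alpha,\frac{\alpha}{\beta\delta})$, then moreover $\nu_i$ is given by the formula above for $1\le i\le N$. In other words, up to the symmetries of the parametrisation and rescaling of $\tilde V$, the only solution is $(\tilde\alpha,\tilde\delta,\mu_2,\mu_7,h_{3,4},s)=(\alpha,\frac\alpha{\beta\delta},s,\frac1{\alpha\beta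 s},\frac1{\beta\delta s},s)$. -/

import Mathlib

namespace LeonardTrio

noncomputable section

/-! ### Matrices and endomorphisms -/

/-- Every nonzero entry lies on the diagonal, the subdiagonal or the superdiagonal. -/
def IsTridiagonal {d : ℕ} (M : Matrix (Fin d) (Fin d) ℂ) : Prop :=
  ∀ i j : Fin d, i ≠ j → (i : ℕ) + 1 ≠ j → (j : ℕ) + 1 ≠ i → M i j = 0

/-- Tridiagonal, with no zero on the subdiagonal and no zero on the superdiagonal. -/
def IsIrredTridiagonal {d : ℕ} (M : Matrix (Fin d) (Fin d) ℂ) : Prop :=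
  IsTridiagonal M ∧ ∀ i j : Fin d, (i : ℕ) + 1 = j → M i j ≠ 0 ∧ M j i ≠ 0

variable {E : Type*} [AddCommGroup E] [Module ℂ E]

/-- The matrix of `X` in the basis `b`: the entry `(m, n)` is the coefficient of `b m`
in `X (b n)`. -/
abbrev mat {d : ℕ} (b : Module.Basis (Fin d) ℂ E) (X : Module.End ℂ E) :
    Matrix (Fin d) (Fin d) ℂ :=
  LinearMap.toMatrix b b X

/-- Diagonal with pairwise different diagonal entries. -/
def IsMultFreeDiag {d : ℕ} (M : Matrix (Fin d) (Fin d) ℂ) : Prop :=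
  M.IsDiag ∧ Function.Injective fun i => M i i

/-- Leonard pairs on a space of dimension `N + 1`. -/
def IsLeonardPair (N : ℕ) (X Y : Module.End ℂ E) : Prop :=
  (∃ b : Module.Basis (Fin (N + 1)) ℂ E,
      IsIrredTridiagonal (mat b X) ∧ (mat b Y).IsDiag) ∧
  (∃ b : Module.Basis (Fin (N + 1)) ℂ E,
      (mat b X).IsDiag ∧ IsIrredTridiagonal (mat b Y))

/-- Irreducible Leonard trios `(V, W, Z)` on a space of dimension `N + 1`. -/
def IsIrredLeonardTrio (N : ℕ) (V W Z : Module.End ℂ E) : Prop :=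
  (∃ b : Module.Basis (Fin (N + 1)) ℂ E,
      (mat b V).IsDiag ∧ IsTridiagonal (mat b (W * Z)) ∧ IsIrredTridiagonal (mat b Z)) ∧
  (∃ b : Module.Basis (Fin (N + 1)) ℂ E,
      (mat b W).IsDiag ∧ IsTridiagonal (mat b (Z * V)) ∧ IsIrredTridiagonal (mat b Z)) ∧
  (∃ b : Module.Basis (Fin (N + 1)) ℂ E,
      (mat b Z).IsDiag ∧ IsIrredTridiagonal (mat b V) ∧ IsIrredTridiagonal (mat b W))

/-- `v` and `w` are bases as in the definition of a Leonard trio `(V, W, Z)`: `V` is diagonal and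
multiplicity free in `v`, where `Z` and `W Z` are tridiagonal; `W` is diagonal and multiplicity
free in `w`, where `Z` and `Z V` are tridiagonal. -/
structure IsLTBases {N : ℕ} (V W Z : Module.End ℂ E)
    (v w : Module.Basis (Fin (N + 1)) ℂ E) : Prop where
  diag_V : IsMultFreeDiag (mat v V)
  tri_Z : IsTridiagonal (mat v Z)
  tri_WZ : IsTridiagonal (mat v (W * Z))
  diag_W : IsMultFreeDiag (mat w W)
  tri_Z' : IsTridiagonal (mat w Z)
  tri_ZV : IsTridiagonal (mat w (Z * V))

/-- `X_{n+1,n} - λ̃_x Z_{n+1,n} ≠ 0` for `0 ≤ n < N`, `0 ≤ x ≤ N`, where `X` and `Z` stand for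
the matrices of `W Z` and `Z` in the basis `v`, and `λ̃_x` is the eigenvalue of `W` on `w x`. -/
def Cond1 {N : ℕ} (W Z : Module.End ℂ E) (v w : Module.Basis (Fin (N + 1)) ℂ E) : Prop :=
  ∀ (n : Fin N) (x : Fin (N + 1)),
    mat v (W * Z) n.succ n.castSucc - mat w W x x * mat v Z n.succ n.castSucc ≠ 0

/-- `X̃_{x,x+1} - λ_n Z̃_{x,x+1} ≠ 0` for `0 ≤ n ≤ N`, `0 ≤ x < N`, where `X̃` and `Z̃` stand for
the matrices of `Z V` and `Z` in the basis `w`, and `λ_n` is the eigenvalue of `V` on `v n`. -/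
def Cond2 {N : ℕ} (V Z : Module.End ℂ E) (v w : Module.Basis (Fin (N + 1)) ℂ E) : Prop :=
  ∀ (n : Fin (N + 1)) (x : Fin N),
    mat w (Z * V) x.castSucc x.succ - mat v V n n * mat w Z x.castSucc x.succ ≠ 0

/-- `(V, W, Z)` is a Leonard trio satisfying both non-degeneracy conditions, for some choice
of the two bases (and of their orderings). -/
def IsNondegLeonardTrio (N : ℕ) (V W Z : Module.End ℂ E) : Prop :=
  ∃ v w : Module.Basis (Fin (N + 1)) ℂ E, IsLTBases V W Z v w ∧ Cond1 W Z v w ∧ Cond2 V Z v w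

/-- The two algebraic Heun relations, with coefficients `h 0, …, h 9`. -/
def HeunRelations (V W Z : Module.End ℂ E) (h : Fin 10 → ℂ) : Prop :=
  W * Z = h 0 • (1 : Module.End ℂ E) + h 1 • Z + h 2 • V + h 3 • (V * Z) + h 4 • (Z * V) ∧
  Z * V = h 5 • (1 : Module.End ℂ E) + h 6 • Z + h 7 • W + h 8 • (W * Z) + h 9 • (Z * W)

/-- The `q`-commutator `[X, Y]_q = X Y - q Y X`. -/
def qComm (q : ℂ) (X Y : Module.End ℂ E) : Module.End ℂ E := X * Y - q • (Y * X)

/-! ### Operators of `q`-Racah type -/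

/-- The recurrence coefficient `A_n(α, β, γ, δ)` of the `q`-Racah polynomials. -/
def racahA (q α β γ δ : ℂ) (n : ℕ) : ℂ :=
  ((1 - α * q ^ (n + 1)) * (1 - α * β * q ^ (n + 1)) * (1 - β * δ * q ^ (n + 1)) *
      (1 - γ * q ^ (n + 1))) /
    ((1 - α * β * q ^ (2 * n + 1)) * (1 - α * β * q ^ (2 * n + 2)))

/-- The recurrence coefficient `C_n(α, β, γ, δ)` of the `q`-Racah polynomials. -/
def racahC (q α β γ δ : ℂ) (n : ℕ) : ℂ :=
  (q * (1 - q ^ n) * (1 - β * q ^ n) * (γ - α * β * q ^ n) * (δ - α * q ^ n)) /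
    ((1 - α * β * q ^ (2 * n)) * (1 - α * β * q ^ (2 * n + 1)))

/-- The recurrence coefficient `B_n(α, β, γ, δ)` of the `q`-Racah polynomials. -/
def racahB (q α β γ δ : ℂ) (n : ℕ) : ℂ :=
  -racahA q α β γ δ n - racahC q α β γ δ n + 1 + γ * δ * q

/-- The value `γ = q^{-N-1}`. -/
def gam (q : ℂ) (N : ℕ) : ℂ := (q ^ (N + 1))⁻¹

/-- The operator `Z z_i = (q^{-i} + α β q^{i+1} + σ) z_i`. -/
def opZ {N : ℕ} (z : Module.Basis (Fin (N + 1)) ℂ E) (q α β σ : ℂ) : Module.End ℂ E :=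
  Matrix.toLin z z (Matrix.diagonal fun i : Fin (N + 1) =>
    (q ^ (i : ℕ))⁻¹ + α * β * q ^ ((i : ℕ) + 1) + σ)

/-- The operator
`z_i ↦ C_{i+1} ν_{i+1} z_{i+1} + B_i z_i + A_{i-1} (1 / ν_i) z_{i-1}`, where `A`, `B`, `C` are
taken at `(α, β, γ, δ)` with `γ = q^{-N-1}`, and `z_{-1} = z_{N+1} = 0`. -/
def opRacah {N : ℕ} (z : Module.Basis (Fin (N + 1)) ℂ E) (q α β δ : ℂ) (ν : ℕ → ℂ) :
    Module.End ℂ E :=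
  Matrix.toLin z z (Matrix.of fun k i : Fin (N + 1) =>
    if (k : ℕ) = i + 1 then racahC q α β (gam q N) δ k * ν k
    else if k = i then racahB q α β (gam q N) δ i
    else if (k : ℕ) + 1 = i then racahA q α β (gam q N) δ k * (1 / ν i)
    else 0)

/-- The function `ψ(α, β, γ, δ)`. -/
def psi (q α β γ δ : ℂ) : ℂ :=
  q * (α + γ) * (1 + β * δ) + q * (β + γ) * (α + δ)

/-! ### The distinguished one-parameter family -/

/-- The shift `σ = -1/s - q s α β`. -/
def sig (q α β s : ℂ) : ℂ := -1 / s - q * s * α * β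

/-- The normalisation `ν_i = β (s - q^i) (δ - α q^i) / ((1 - β δ q^i) (1 - α β s q^i))`. -/
def wilsonNu (q α β δ s : ℂ) (i : ℕ) : ℂ :=
  (β * (s - q ^ i) * (δ - α * q ^ i)) / ((1 - β * δ * q ^ i) * (1 - α * β * s * q ^ i))

/-- The operator `Ṽ` with parameters `(α, β, γ, α / (β δ))` and normalisation `wilsonNu`. -/
def opWilson {N : ℕ} (z : Module.Basis (Fin (N + 1)) ℂ E) (q α β δ s : ℂ) : Module.End ℂ E :=
  opRacah z q α β (α / (β * δ)) (wilsonNu q α β δ s)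

/-- The values of `s` for which `σ` and all `ν_i`, `1 ≤ i ≤ N`, are defined, with `ν_i`
not forced to vanish by the factor that contains `s`. -/
def IsAdmissible (N : ℕ) (q α β s : ℂ) : Prop :=
  s ≠ 0 ∧ ∀ i : ℕ, 1 ≤ i → i ≤ N → s ≠ q ^ i ∧ α * β * s * q ^ i ≠ 1

/-- The coefficient `h_0` of the family. -/
def wilsonH0 (N : ℕ) (q α β δ s : ℂ) : ℂ :=
  psi q α β (gam q N) (α / (β * δ)) -
    (1 + q * s ^ 2 * α * β) / (β * δ * s * (1 + q)) * psi q α β (gam q N) δ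

/-- The coefficient `h_5` of the family. -/
def wilsonH5 (N : ℕ) (q α β δ s : ℂ) : ℂ :=
  psi q α β (gam q N) δ -
    δ * (1 + q * s ^ 2 * α * β) / (α * s * (1 + q)) * psi q α β (gam q N) (α / (β * δ))

/-- The coefficient `h_2` of the family. -/
def wilsonH2 (q α β δ s : ℂ) : ℂ :=
  (1 - α * β * s ^ 2) * (1 - α * β * q ^ 2 * s ^ 2) / (β * δ * s ^ 2 * (1 + q))

/-- The coefficient `h_7` of the family. -/
def wilsonH7 (q α β δ s : ℂ) : ℂ :=
  δ * (1 - α * β * s ^ 2) * (1 - α * β * q ^ 2 * s ^ 2) / (α * s ^ 2 * (1 + q))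

/-- The ten Heun coefficients of the family, i.e. the relations of `WilsonHeunRelations` with
the `q`-commutators expanded. -/
def wilsonHeun (N : ℕ) (q α β δ s : ℂ) : Fin 10 → ℂ :=
  ![wilsonH0 N q α β δ s, 0, wilsonH2 q α β δ s,
    (1 / (β * δ * s) - q * (α * q * s / δ)) / (1 - q ^ 2),
    (α * q * s / δ - q * (1 / (β * δ * s))) / (1 - q ^ 2),
    wilsonH5 N q α β δ s, 0, wilsonH7 q α β δ s,
    (q * β * δ * s - q * (δ / (s * α))) / (1 - q ^ 2),
    (δ / (s * α) - q * (q * β * δ * s)) / (1 - q ^ 2)]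

/-- The explicit Heun relations of the family, written with `q`-commutators. -/
def WilsonHeunRelations (N : ℕ) (q α β δ s : ℂ) (V W Z : Module.End ℂ E) : Prop :=
  W * Z = wilsonH0 N q α β δ s • (1 : Module.End ℂ E) + wilsonH2 q α β δ s • V +
      (1 / (1 - q ^ 2)) •
        ((α * q * s / δ) • qComm q Z V + (1 / (β * δ * s)) • qComm q V Z) ∧
  Z * V = wilsonH5 N q α β δ s • (1 : Module.End ℂ E) + wilsonH7 q α β δ s • W +
      (1 / (1 - q ^ 2)) •
        ((δ / (s * α)) • qComm q Z W + (q * β * δ * s) • qComm q W Z)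

/-- `(μ₂, μ₇, h₃₄, s)` parametrise `σ` and the Heun coefficients `h`, with
`h_{n,m} = h_n + q h_m`. -/
structure IsHeunParam (q α β σ : ℂ) (h : Fin 10 → ℂ) (μ₂ μ₇ h₃₄ s : ℂ) : Prop where
  s_ne : s ≠ 0
  μ₂_ne : μ₂ ≠ 0
  μ₇_ne : μ₇ ≠ 0
  sigma_eq : σ = -1 / s - q * s * α * β
  h₃₄_eq : h₃₄ = h 3 + q * h 4
  h1_eq : h 1 = 0
  h6_eq : h 6 = 0
  h2_eq : h 2 = -(h 4 + q * h 3) / μ₂ - (h 3 + q * h 4) * α * β * μ₂ - σ * (h 3 + h 4)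
  h7_eq : h 7 = -(h 9 + q * h 8) / μ₇ - (h 8 + q * h 9) * α * β * μ₇ - σ * (h 8 + h 9)

/-- The effect of `W ↦ c W` on the Heun coefficients. -/
def scaleHeun (c : ℂ) (h : Fin 10 → ℂ) : Fin 10 → ℂ :=
  ![c * h 0, c * h 1, c * h 2, c * h 3, c * h 4, h 5, h 6, h 7 / c, h 8 / c, h 9 / c]

end

end LeonardTrio

open LeonardTrio

/-!
# Leonard trios of `q`-Racah type

Notation: `V` and `W` are the two `q`-Racah operators, `Z` is the diagonal operator with eigenvalues
`u + σ`, where `u = q^{-i} + α β q^{i+1}` runs through the grid `grid q (α β)`.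

**The family.** On the split basis `φ_k = ∑ᵢ (q^{-i}; q)_k (α β q^{i+1}; q)_k zᵢ` the operator `Z` is
lower and `V` is upper bidiagonal. Hence the spectrum of `V` is the grid for `γ δ`
(`hasEigenvalue_opRacah_iff`), and `V`, `Z` satisfy an Askey-Wilson relation (`askeyWilson_opRacah`),
which makes `Z` tridiagonal in the eigenbasis of `V`. Since `V` and `Z` have no common invariant
subspace, `Z` is irreducible there (`isIrredTridiagonal_of_isTridiagonal`), so that `(V, Z)` is a
Leonard pair. The Heun relations are compared entry by entry in the basis `z`
(`heunRelations_wilson`); off the diagonal they express the choice of `ν`, and on the diagonal they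
rest on the fact that `B_n` is a linear polynomial in `u` over `u² - α β (1 + q)²`
(`racahB_mul_grid`), whose two coefficients are exchanged by `δ ↦ α / (β δ)` (`psi_dual`,
`racahB0_dual`). They imply that `W Z` and `Z V` are tridiagonal in the eigenbases, and each
non-degeneracy condition becomes the non-vanishing of a nonzero quadratic polynomial in `s`.

**Uniqueness.** Multiplying corresponding entries of the two Heun relations gives an identity between
Laurent polynomials in `X = q^{i+1}`: the product of the two coefficients of the relations equals the
product of neighbouring eigenvalues of `Z`, whose zeros are `q s, 1 / (α β s), s, 1 / (α β q s)`
(`heun_offdiag_coefficients`; four values of `i` suffice, whence `N ≥ 4`). The zeros can be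
distributed over the two factors in four ways (`exists_heun_roots`).

* In two of them the relations collapse to `W = h₃ V` or `W Z = h₄ Z V`, and then some eigenvalue
  of `W` violates the non-degeneracy (`not_cond1_of_smul`, `not_cond1_of_mul_eq`).
* In the commutator case the off-diagonal entries determine `W` up to a solution of the equation in
  `match_parameters`. Half of its solutions rescale the numerator of the diagonal and lead back to the
  degenerate relations; the other half exchange its two coefficients and give the family.
* In the anticommutator case `h₃ = h₄`, and `W` turns out to be a `q`-Racah operator with
  parameters like `(α / q, q β, δ / q)`. The sums of neighbouring eigenvalues of `V` are then multiples
  of eigenvalues of `W`, against the non-degeneracy (`not_cond1_of_anticomm`).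

All exceptional parameters lie in the zero set of a finite product of nonzero polynomials
(`holdsGenerically_isGeneric`).
-/

namespace LeonardTrio

noncomputable section

variable {E : Type*} [AddCommGroup E] [Module ℂ E]

/-! ### Tridiagonal and diagonal operators in a basis -/

theorem repr_apply_eq_sum {d : ℕ} (b : Module.Basis (Fin d) ℂ E) (X : Module.End ℂ E) (u : E)
    (i : Fin d) : b.repr (X u) i = ∑ j, mat b X i j * b.repr u j := by
  have := congrFun (LinearMap.toMatrix_mulVec_repr b b X u) i
  simpa [Matrix.mulVec, dotProduct] using this.symm

theorem mat_apply_eq_repr {d : ℕ} (b : Module.Basis (Fin d) ℂ E) (X : Module.End ℂ E)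
    (i j : Fin d) : mat b X i j = b.repr (X (b j)) i := by
  simp [mat, LinearMap.toMatrix_apply]

theorem repr_apply_of_isDiag {d : ℕ} {b : Module.Basis (Fin d) ℂ E} {Y : Module.End ℂ E}
    (hY : (mat b Y).IsDiag) (u : E) (i : Fin d) :
    b.repr (Y u) i = mat b Y i i * b.repr u i := by
  rw [repr_apply_eq_sum, Finset.sum_eq_single i]
  · intro j _ hj
    rw [hY hj.symm, zero_mul]
  · simp

theorem apply_basis_of_isDiag {d : ℕ} {b : Module.Basis (Fin d) ℂ E} {Y : Module.End ℂ E}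
    (hY : (mat b Y).IsDiag) (i : Fin d) : Y (b i) = mat b Y i i • b i := by
  apply b.ext_elem
  intro j
  rw [repr_apply_of_isDiag hY]
  by_cases h : j = i
  · subst h; simp
  · simp [Ne.symm h]

theorem isDiag_of_apply_basis {d : ℕ} {b : Module.Basis (Fin d) ℂ E} {Y : Module.End ℂ E}
    {c : Fin d → ℂ} (h : ∀ i, Y (b i) = c i • b i) :
    (mat b Y).IsDiag ∧ ∀ i, mat b Y i i = c i := by
  constructor
  · intro i j hij
    simp [mat_apply_eq_repr, h, Ne.symm hij]
  · intro i
    simp [mat_apply_eq_repr, h]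

/-- The entries of a product with a diagonal left factor. -/
theorem mat_mul_of_isDiag_left {d : ℕ} {b : Module.Basis (Fin d) ℂ E} {X Y : Module.End ℂ E}
    (hX : (mat b X).IsDiag) (i j : Fin d) : mat b (X * Y) i j = mat b X i i * mat b Y i j := by
  rw [mat_apply_eq_repr, Module.End.mul_apply, repr_apply_of_isDiag hX, mat_apply_eq_repr b Y]

/-- The entries of a product with a diagonal right factor. -/
theorem mat_mul_of_isDiag_right {d : ℕ} {b : Module.Basis (Fin d) ℂ E} {X Y : Module.End ℂ E}
    (hY : (mat b Y).IsDiag) (i j : Fin d) : mat b (X * Y) i j = mat b X i j * mat b Y j j := by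
  rw [mat_apply_eq_repr, Module.End.mul_apply, apply_basis_of_isDiag hY, mat_apply_eq_repr b X]
  simp [mul_comm]

theorem mat_smul {d : ℕ} (b : Module.Basis (Fin d) ℂ E) (c : ℂ) (X : Module.End ℂ E)
    (i j : Fin d) : mat b (c • X) i j = c * mat b X i j := by
  simp [mat]

theorem mat_add {d : ℕ} (b : Module.Basis (Fin d) ℂ E) (X Y : Module.End ℂ E)
    (i j : Fin d) : mat b (X + Y) i j = mat b X i j + mat b Y i j := by
  simp [mat]

theorem mat_one {d : ℕ} (b : Module.Basis (Fin d) ℂ E) (i j : Fin d) :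
    mat b (1 : Module.End ℂ E) i j = if i = j then 1 else 0 := by
  simp [mat, Matrix.one_apply]

/-- An eigenvalue of an operator that is diagonal in a basis is one of its diagonal entries. -/
theorem exists_diag_eq_of_eigenvector {d : ℕ} {b : Module.Basis (Fin d) ℂ E}
    {Y : Module.End ℂ E} (hY : (mat b Y).IsDiag) {μ : ℂ} {u : E} (hu : u ≠ 0)
    (h : Y u = μ • u) : ∃ i, mat b Y i i = μ := by
  obtain ⟨i, hi⟩ : ∃ i, b.repr u i ≠ 0 := by
    by_contra! hc
    exact hu (b.ext_elem fun i => by simp [hc i])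
  refine ⟨i, ?_⟩
  have := repr_apply_of_isDiag hY u i
  rw [h] at this
  simp only [map_smul, Finsupp.smul_apply, smul_eq_mul] at this
  exact (mul_right_cancel₀ hi this).symm

/-- If a multiplicity free operator is diagonal in another basis, it is multiplicity free there. -/
theorem isMultFreeDiag_of_isDiag {d : ℕ} {b b' : Module.Basis (Fin d) ℂ E}
    {Y : Module.End ℂ E} (hY : IsMultFreeDiag (mat b Y)) (h : (mat b' Y).IsDiag) :
    IsMultFreeDiag (mat b' Y) := by
  have key : ∀ i, ∃ j, mat b' Y j j = mat b Y i i := fun i =>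
    exists_diag_eq_of_eigenvector h (b.ne_zero i) (apply_basis_of_isDiag hY.1 i)
  choose g hg using key
  have hinj : Function.Injective g := fun i j hij => hY.2 (by
    simp only [← hg]; rw [hij])
  have hbij : Function.Bijective g := (Finite.injective_iff_bijective).1 hinj
  refine ⟨h, fun x y hxy => ?_⟩
  obtain ⟨i, rfl⟩ := hbij.2 x
  obtain ⟨j, rfl⟩ := hbij.2 y
  simp only [hg] at hxy
  rw [hY.2 hxy]

/-! ### Irreducibility -/

/-- If `U` is invariant under a multiplicity free diagonal operator and contains a vector with a
nonzero `i`-th coordinate, then it contains the `i`-th basis vector: the other coordinates are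
killed one at a time. -/
theorem basis_mem_of_invariant {d : ℕ} {b : Module.Basis (Fin d) ℂ E} {Y : Module.End ℂ E}
    (hY : IsMultFreeDiag (mat b Y)) {U : Submodule ℂ E} (hU : ∀ u ∈ U, Y u ∈ U) {u : E}
    (hu : u ∈ U) {i : Fin d} (hi : b.repr u i ≠ 0) : b i ∈ U := by
  have key : ∀ T : Finset (Fin d), i ∉ T →
      ∃ w ∈ U, b.repr w i ≠ 0 ∧ ∀ j ∈ T, b.repr w j = 0 := by
    intro T
    induction T using Finset.induction_on with
    | empty => exact fun _ => ⟨u, hu, hi, by simp⟩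
    | insert j T _ ih =>
      intro hT
      rw [Finset.mem_insert, not_or] at hT
      obtain ⟨w, hw, hwi, hwT⟩ := ih hT.2
      refine ⟨Y w - mat b Y j j • w, U.sub_mem (hU w hw) (U.smul_mem _ hw), ?_, ?_⟩
      · simp only [map_sub, map_smul, Finsupp.sub_apply, Finsupp.smul_apply,
          repr_apply_of_isDiag hY.1, smul_eq_mul, ← sub_mul]
        exact mul_ne_zero (sub_ne_zero.2 fun h => hT.1 (hY.2 h)) hwi
      · intro l hl
        simp only [map_sub, map_smul, Finsupp.sub_apply, Finsupp.smul_apply,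
          repr_apply_of_isDiag hY.1, smul_eq_mul, ← sub_mul]
        rcases Finset.mem_insert.1 hl with rfl | hl
        · simp
        · rw [hwT l hl, mul_zero]
  obtain ⟨w, hw, hwi, hwT⟩ := key (Finset.univ.erase i) (by simp)
  have : w = b.repr w i • b i := by
    apply b.ext_elem
    intro j
    by_cases h : j = i
    · subst h; simp
    · rw [hwT j (by simp [h])]; simp [Ne.symm h]
  rw [this] at hw
  exact (U.smul_mem_iff hwi).1 hw

/-- An irreducible tridiagonal operator and a multiplicity free diagonal one have no common
invariant subspace; in particular their matrices in any other basis have no common zero block. -/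
theorem mem_of_common_block {d : ℕ} {b b' : Module.Basis (Fin d) ℂ E} {X Y : Module.End ℂ E}
    (hX : IsIrredTridiagonal (mat b X)) (hY : IsMultFreeDiag (mat b Y)) {S : Set (Fin d)}
    (hXS : ∀ i ∉ S, ∀ j ∈ S, mat b' X i j = 0) (hYS : ∀ i ∉ S, ∀ j ∈ S, mat b' Y i j = 0)
    {j : Fin d} (hj : j ∈ S) (i : Fin d) : i ∈ S := by
  let U : Submodule ℂ E :=
    { carrier := {u | ∀ i ∉ S, b'.repr u i = 0}
      add_mem' := fun {u w} hu hw i hi => by simp [hu i hi, hw i hi]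
      zero_mem' := fun i _ => by simp
      smul_mem' := fun c u hu i hi => by simp [hu i hi] }
  have inv : ∀ W : Module.End ℂ E, (∀ i ∉ S, ∀ j ∈ S, mat b' W i j = 0) →
      ∀ u ∈ U, W u ∈ U := by
    intro W hW u hu i hi
    rw [repr_apply_eq_sum]
    refine Finset.sum_eq_zero fun l _ => ?_
    by_cases hl : l ∈ S
    · rw [hW i hi l hl, zero_mul]
    · rw [hu l hl, mul_zero]
  have hUX := inv X hXS
  have hUY := inv Y hYS
  have hjU : b' j ∈ U := by
    intro i hi
    have : j ≠ i := fun h => hi (h ▸ hj)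
    simp [this]
  obtain ⟨l, hl⟩ : ∃ l, b.repr (b' j) l ≠ 0 := by
    by_contra! hc
    exact b'.ne_zero j (b.ext_elem fun i => by simp [hc i])
  have hlU := basis_mem_of_invariant hY hUY hjU hl
  have step : ∀ m n : Fin d, b m ∈ U → mat b X n m ≠ 0 → b n ∈ U := by
    intro m n hm hne
    refine basis_mem_of_invariant hY hUY (hUX _ hm) ?_
    rwa [← mat_apply_eq_repr]
  have up : ∀ t : ℕ, ∀ h : (l : ℕ) + t < d, b ⟨l + t, h⟩ ∈ U := by
    intro t
    induction t with
    | zero => exact fun _ => hlU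
    | succ t ih =>
      intro h
      exact step ⟨l + t, by omega⟩ _ (ih (by omega)) (hX.2 _ _ rfl).2
  have down : ∀ t : ℕ, t ≤ (l : ℕ) → b ⟨l - t, by omega⟩ ∈ U := by
    intro t
    induction t with
    | zero => exact fun _ => hlU
    | succ t ih =>
      intro h
      refine step ⟨l - t, by omega⟩ _ (ih (by omega)) (hX.2 _ _ ?_).1
      simp only; omega
  have all : ∀ m, b m ∈ U := by
    intro m
    rcases le_total (l : ℕ) m with h | h
    · have := up (m - l) (by omega)
      convert this using 2
      ext; simp only; omega
    · have := down (l - m) (by omega)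
      convert this using 2
      ext; simp only; omega
  have htop : U = ⊤ := by
    rw [eq_top_iff, ← b.span_eq, Submodule.span_le]
    rintro _ ⟨m, rfl⟩
    exact all m
  by_contra hi
  have : b' i ∈ U := htop ▸ Submodule.mem_top
  simpa using this i hi

/-- Tridiagonal matrices of a pair without common invariant subspace: if one is diagonal, then
the other is irreducible. -/
theorem isIrredTridiagonal_of_isTridiagonal {d : ℕ} {b b' : Module.Basis (Fin d) ℂ E}
    {X Y A D : Module.End ℂ E}
    (hX : IsIrredTridiagonal (mat b X)) (hY : IsMultFreeDiag (mat b Y))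
    (hA : IsTridiagonal (mat b' A)) (hD : (mat b' D).IsDiag)
    (hXY : (X = A ∧ Y = D) ∨ (X = D ∧ Y = A)) : IsIrredTridiagonal (mat b' A) := by
  -- A vanishing off-diagonal entry makes an initial or a final segment of `b'` invariant.
  have block : ∀ S : Set (Fin d), (∀ i ∉ S, ∀ j ∈ S, mat b' A i j = 0) → ∀ j ∈ S, ∀ i, i ∈ S := by
    intro S hS j hj i
    have hDS : ∀ i ∉ S, ∀ j ∈ S, mat b' D i j = 0 := fun i hi j hj =>
      hD fun h => hi (h ▸ hj)
    rcases hXY with ⟨rfl, rfl⟩ | ⟨rfl, rfl⟩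
    · exact mem_of_common_block hX hY hS hDS hj i
    · exact mem_of_common_block hX hY hDS hS hj i
  refine ⟨hA, fun i j hij => ⟨fun h0 => ?_, fun h0 => ?_⟩⟩
  · have := block {m | j ≤ m} (fun m hm n hn => ?_) j (le_refl j) i
    · simp only [Set.mem_ofPred_eq, Fin.le_def] at this; omega
    · simp only [Set.mem_ofPred_eq, Fin.le_def, not_le] at hm hn
      by_cases h : m = i ∧ n = j
      · rw [h.1, h.2, h0]
      · refine hA _ _ (fun h' => by subst h'; omega) (fun h' => h ?_) (by omega)
        constructor <;> ext <;> omega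
  · have := block {m | m ≤ i} (fun m hm n hn => ?_) i (le_refl i) j
    · simp only [Set.mem_ofPred_eq, Fin.le_def] at this; omega
    · simp only [Set.mem_ofPred_eq, Fin.le_def, not_le] at hm hn
      by_cases h : m = j ∧ n = i
      · rw [h.1, h.2, h0]
      · refine hA _ _ (fun h' => by subst h'; omega) (by omega) (fun h' => h ?_)
        constructor <;> ext <;> omega

/-- In a Leonard pair `(X, Y)`, an operator `X` that is tridiagonal in a basis in which `Y` is
diagonal and multiplicity free is irreducible there. -/
theorem IsLeonardPair.isIrredTridiagonal {N : ℕ} {X Y : Module.End ℂ E}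
    (h : IsLeonardPair N X Y) {b : Module.Basis (Fin (N + 1)) ℂ E}
    (hX : IsTridiagonal (mat b X)) (hY : IsMultFreeDiag (mat b Y)) :
    IsIrredTridiagonal (mat b X) := by
  obtain ⟨⟨c, hcX, hcY⟩, -⟩ := h
  exact isIrredTridiagonal_of_isTridiagonal hcX (isMultFreeDiag_of_isDiag hY hcY) hX hY.1
    (Or.inl ⟨rfl, rfl⟩)

/-- If `X` is diagonal with entries `c i`, and `X² A - β X A X + A X² + ρ A` is diagonal as well,
then an off-diagonal entry `(i, j)` of `A` vanishes unless
`c i ^ 2 - β * c i * c j + c j ^ 2 + ρ = 0`. -/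
theorem mat_eq_zero_of_askeyWilson {d : ℕ} {b : Module.Basis (Fin d) ℂ E}
    {X A D : Module.End ℂ E} {β ρ : ℂ} (hX : (mat b X).IsDiag) (hD : (mat b D).IsDiag)
    (hrel : X * (X * A) + (-β) • (X * (A * X)) + (A * X) * X + ρ • A = D)
    {i j : Fin d} (hij : i ≠ j)
    (hne : mat b X i i ^ 2 - β * mat b X i i * mat b X j j + mat b X j j ^ 2 + ρ ≠ 0) :
    mat b A i j = 0 := by
  have h := hD hij
  rw [← hrel] at h
  simp only [mat_add, mat_smul, mat_mul_of_isDiag_left hX, mat_mul_of_isDiag_right hX] at h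
  have : (mat b X i i ^ 2 - β * mat b X i i * mat b X j j + mat b X j j ^ 2 + ρ) *
      mat b A i j = 0 := by linear_combination h
  exact (mul_eq_zero.1 this).resolve_left hne

/-! ### The split basis of the `q`-Racah operator -/

/-- The quadratic grid `q^{-n} + c q^{n+1}`. It carries the spectrum of `Z` (up to the shift `σ`)
for `c = α β`, and that of the `q`-Racah operator for `c = γ δ`. -/
def grid (q c : ℂ) (n : ℕ) : ℂ := (q ^ n)⁻¹ + c * q ^ (n + 1)

/-- The coefficient of `z i` in `phiVec`: the product
`(q^{-i}; q)_k (c q^{i+1}; q)_k` of `q`-shifted factorials. -/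
def phiCoef (q c : ℂ) (k i : ℕ) : ℂ :=
  ∏ j ∈ Finset.range k, (1 - q ^ j / q ^ i) * (1 - c * q ^ (i + j + 1))

theorem phiCoef_zero (q c : ℂ) (i : ℕ) : phiCoef q c 0 i = 1 := by simp [phiCoef]

theorem phiCoef_succ (q c : ℂ) (k i : ℕ) : phiCoef q c (k + 1) i =
    phiCoef q c k i * ((1 - q ^ k / q ^ i) * (1 - c * q ^ (i + k + 1))) := by
  simp [phiCoef, Finset.prod_range_succ]

theorem phiCoef_succ_up {q : ℂ} (hq0 : q ≠ 0) (c : ℂ) (k i : ℕ) :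
    phiCoef q c (k + 1) (i + 1) * (1 - c * q ^ (i + 1)) =
      (1 - 1 / q ^ (i + 1)) * (1 - c * q ^ (i + k + 1)) * (1 - c * q ^ (i + k + 2)) *
        phiCoef q c k i := by
  induction k with
  | zero => simp [phiCoef_succ, phiCoef_zero]; ring
  | succ k ih =>
    rw [phiCoef_succ, mul_right_comm, ih, phiCoef_succ q c k i]
    have : q ^ (k + 1) / q ^ (i + 1) = q ^ k / q ^ i := by
      rw [pow_succ, pow_succ]; field_simp
    rw [this]
    ring_nf

theorem phiCoef_succ_down {q : ℂ} (hq0 : q ≠ 0) (c : ℂ) (k i : ℕ) :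
    (1 - 1 / q ^ (i + 1)) * phiCoef q c (k + 1) i =
      (1 - c * q ^ (i + 1)) * (1 - q ^ k / q ^ (i + 1)) * (1 - q ^ (k + 1) / q ^ (i + 1)) *
        phiCoef q c k (i + 1) := by
  induction k with
  | zero =>
    have : q ^ (0 + 1) / q ^ (i + 1) = 1 / q ^ i := by
      rw [pow_succ, pow_succ]; field_simp
    rw [this]
    simp [phiCoef_succ, phiCoef_zero]; ring
  | succ k ih =>
    rw [phiCoef_succ, ← mul_assoc, ih, phiCoef_succ q c k (i + 1)]
    have : q ^ (k + 1 + 1) / q ^ (i + 1) = q ^ (k + 1) / q ^ i := by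
      rw [pow_succ _ (k + 1), pow_succ q i]; field_simp
    rw [this]
    ring_nf

theorem phiCoef_succ_zero {q : ℂ} (c : ℂ) (k : ℕ) : phiCoef q c (k + 1) 0 = 0 := by
  refine Finset.prod_eq_zero (i := 0) (by simp) (by simp)

theorem phiCoef_eq_zero {q : ℂ} (hq0 : q ≠ 0) (c : ℂ) {k i : ℕ} (h : i < k) :
    phiCoef q c k i = 0 := by
  refine Finset.prod_eq_zero (i := i) (by simpa using h) ?_
  rw [div_self (pow_ne_zero _ hq0)]; simp

/-- The part of the `q`-Racah difference operator with coefficient `A_i`, applied to `phiCoef`. One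
of the two factors in the denominator of `A_i` cancels. -/
theorem racahA_mul_phiCoef {q α β γ δ : ℂ} (hq0 : q ≠ 0) {i : ℕ}
    (h1 : α * β * q ^ (2 * i + 1) ≠ 1) (h2 : α * β * q ^ (2 * i + 2) ≠ 1) (k : ℕ) :
    racahA q α β γ δ i * (phiCoef q (α * β) (k + 1) (i + 1) - phiCoef q (α * β) (k + 1) i) =
      (1 - α * q ^ (i + 1)) * (1 - β * δ * q ^ (i + 1)) * (1 - γ * q ^ (i + 1)) *
        (1 - α * β * q ^ (i + k + 1)) * (q ^ (k + 1) - 1) /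
          (q ^ (i + 1) * (1 - α * β * q ^ (2 * i + 1))) * phiCoef q (α * β) k i := by
  have e := phiCoef_succ_up hq0 (α * β) k i
  have e0 := phiCoef_succ q (α * β) k i
  have d1 : 1 - α * β * q ^ (2 * i + 1) ≠ 0 := sub_ne_zero.2 (Ne.symm h1)
  have d2 : 1 - α * β * q ^ (2 * i + 2) ≠ 0 := sub_ne_zero.2 (Ne.symm h2)
  have key : (1 - α * β * q ^ (i + 1)) *
      (phiCoef q (α * β) (k + 1) (i + 1) - phiCoef q (α * β) (k + 1) i) =
      (1 - α * β * q ^ (i + k + 1)) * (q ^ (k + 1) - 1) * (1 - α * β * q ^ (2 * i + 2)) /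
        q ^ (i + 1) * phiCoef q (α * β) k i := by
    rw [mul_sub, mul_comm, e, e0]
    generalize phiCoef q (α * β) k i = f
    simp only [pow_add, pow_mul, pow_one, mul_comm 2 i]
    have hx : q ^ i ≠ 0 := pow_ne_zero _ hq0
    generalize q ^ i = x at *
    generalize q ^ k = y at *
    field_simp
    ring
  have hx : q ^ (i + 1) ≠ 0 := pow_ne_zero _ hq0
  rw [racahA, div_mul_eq_mul_div, div_eq_iff (mul_ne_zero d1 d2)]
  calc _ = (1 - α * q ^ (i + 1)) * (1 - β * δ * q ^ (i + 1)) * (1 - γ * q ^ (i + 1)) *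
      ((1 - α * β * q ^ (i + 1)) *
        (phiCoef q (α * β) (k + 1) (i + 1) - phiCoef q (α * β) (k + 1) i)) := by ring
    _ = _ := by
      rw [key]
      field_simp

/-- The part of the `q`-Racah difference operator with coefficient `C_i`, applied to `phiCoef`. -/
theorem racahC_mul_phiCoef {q α β γ δ : ℂ} (hq0 : q ≠ 0) {i : ℕ}
    (h0 : α * β * q ^ (2 * i) ≠ 1) (h1 : α * β * q ^ (2 * i + 1) ≠ 1) (k : ℕ) :
    racahC q α β γ δ i * (phiCoef q (α * β) (k + 1) (i - 1) - phiCoef q (α * β) (k + 1) i) =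
      q * (1 - β * q ^ i) * (γ - α * β * q ^ i) * (δ - α * q ^ i) * (q ^ (k + 1) - 1) /
        (1 - α * β * q ^ (2 * i + 1)) * ((1 - q ^ k / q ^ i) * phiCoef q (α * β) k i) := by
  have d0 : 1 - α * β * q ^ (2 * i) ≠ 0 := sub_ne_zero.2 (Ne.symm h0)
  have d1 : 1 - α * β * q ^ (2 * i + 1) ≠ 0 := sub_ne_zero.2 (Ne.symm h1)
  cases i with
  | zero =>
    have : (1 - q ^ k / q ^ 0) * phiCoef q (α * β) k 0 = 0 := by
      cases k with
      | zero => simp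
      | succ k => rw [phiCoef_succ_zero, mul_zero]
    rw [this]
    simp [racahC]
  | succ i =>
    have e := phiCoef_succ_down hq0 (α * β) k i
    have e0 := phiCoef_succ q (α * β) k (i + 1)
    have key : (1 - q ^ (i + 1)) *
        (phiCoef q (α * β) (k + 1) i - phiCoef q (α * β) (k + 1) (i + 1)) =
        (q ^ (k + 1) - 1) * (1 - α * β * q ^ (2 * (i + 1))) *
          ((1 - q ^ k / q ^ (i + 1)) * phiCoef q (α * β) k (i + 1)) := by
      have hx : q ^ (i + 1) ≠ 0 := pow_ne_zero _ hq0
      have hf : (1 - q ^ (i + 1)) * phiCoef q (α * β) (k + 1) i =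
          -q ^ (i + 1) * ((1 - 1 / q ^ (i + 1)) * phiCoef q (α * β) (k + 1) i) := by
        field_simp
        ring
      rw [mul_sub, hf, e, e0]
      generalize phiCoef q (α * β) k (i + 1) = f
      simp only [pow_add, pow_mul, pow_one, mul_comm 2, add_mul, one_mul] at *
      have hx : q ^ i ≠ 0 := pow_ne_zero _ hq0
      generalize q ^ i = x at *
      generalize q ^ k = y at *
      field_simp
      ring
    rw [racahC, Nat.add_sub_cancel, div_mul_eq_mul_div, div_eq_iff (mul_ne_zero d0 d1)]
    calc _ = q * (1 - β * q ^ (i + 1)) * (γ - α * β * q ^ (i + 1)) * (δ - α * q ^ (i + 1)) *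
        ((1 - q ^ (i + 1)) *
          (phiCoef q (α * β) (k + 1) i - phiCoef q (α * β) (k + 1) (i + 1))) := by ring
      _ = _ := by
        rw [key]
        generalize 1 - α * β * q ^ (2 * (i + 1) + 1) = D at *
        field_simp

/-- The superdiagonal entry of the `q`-Racah operator in the split basis. -/
def splitMu (q α β γ δ : ℂ) (k : ℕ) : ℂ :=
  -(q ^ k)⁻¹ * (1 - q ^ k) * (1 - α * q ^ k) * (1 - β * δ * q ^ k) * (1 - γ * q ^ k)

/-- The `q`-Racah difference operator is upper bidiagonal on the functions `phiCoef q (α β) k`. -/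
theorem racah_phiCoef_succ {q α β γ δ : ℂ} (hq0 : q ≠ 0) {i : ℕ}
    (h0 : α * β * q ^ (2 * i) ≠ 1) (h1 : α * β * q ^ (2 * i + 1) ≠ 1)
    (h2 : α * β * q ^ (2 * i + 2) ≠ 1) (k : ℕ) :
    racahC q α β γ δ i * phiCoef q (α * β) (k + 1) (i - 1) +
      racahB q α β γ δ i * phiCoef q (α * β) (k + 1) i +
      racahA q α β γ δ i * phiCoef q (α * β) (k + 1) (i + 1) =
    grid q (γ * δ) (k + 1) * phiCoef q (α * β) (k + 1) i +
      splitMu q α β γ δ (k + 1) * phiCoef q (α * β) k i := by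
  have eA := racahA_mul_phiCoef (γ := γ) (δ := δ) hq0 h1 h2 k
  have eC := racahC_mul_phiCoef (γ := γ) (δ := δ) hq0 h0 h1 k
  have e0 := phiCoef_succ q (α * β) k i
  have d1 : 1 - α * β * q ^ (2 * i + 1) ≠ 0 := sub_ne_zero.2 (Ne.symm h1)
  have hx : q ^ i ≠ 0 := pow_ne_zero _ hq0
  have hy : q ^ k ≠ 0 := pow_ne_zero _ hq0
  have split : racahC q α β γ δ i * phiCoef q (α * β) (k + 1) (i - 1) +
      racahB q α β γ δ i * phiCoef q (α * β) (k + 1) i +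
      racahA q α β γ δ i * phiCoef q (α * β) (k + 1) (i + 1) =
      racahA q α β γ δ i * (phiCoef q (α * β) (k + 1) (i + 1) - phiCoef q (α * β) (k + 1) i) +
      racahC q α β γ δ i * (phiCoef q (α * β) (k + 1) (i - 1) - phiCoef q (α * β) (k + 1) i) +
      (1 + γ * δ * q) * phiCoef q (α * β) (k + 1) i := by
    rw [racahB]; ring
  rw [split, eA, eC, e0, grid, splitMu]
  generalize phiCoef q (α * β) k i = f
  obtain ⟨D, hD⟩ : ∃ D, D = 1 - α * β * q ^ (2 * i + 1) := ⟨_, rfl⟩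
  rw [← hD] at d1 ⊢
  simp only [pow_add, pow_mul, pow_one, mul_comm 2 i] at *
  generalize q ^ i = x at *
  generalize q ^ k = y at *
  field_simp
  rw [hD]
  ring

/-! ### The operators in coordinates -/

theorem mat_opRacah {N : ℕ} (z : Module.Basis (Fin (N + 1)) ℂ E) (q α β δ : ℂ) (ν : ℕ → ℂ)
    (k i : Fin (N + 1)) : mat z (opRacah z q α β δ ν) k i =
      if (k : ℕ) = i + 1 then racahC q α β (gam q N) δ k * ν k
      else if k = i then racahB q α β (gam q N) δ i
      else if (k : ℕ) + 1 = i then racahA q α β (gam q N) δ k * (1 / ν i)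
      else 0 := by
  simp [mat, opRacah]

theorem mat_opZ_isDiag {N : ℕ} (z : Module.Basis (Fin (N + 1)) ℂ E) (q α β σ : ℂ) :
    (mat z (opZ z q α β σ)).IsDiag := by
  simp only [mat, opZ, LinearMap.toMatrix_toLin]
  exact Matrix.isDiag_diagonal _

theorem mat_opZ_self {N : ℕ} (z : Module.Basis (Fin (N + 1)) ℂ E) (q α β σ : ℂ)
    (i : Fin (N + 1)) : mat z (opZ z q α β σ) i i = grid q (α * β) i + σ := by
  simp [mat, opZ, grid]

theorem opZ_eq_add {N : ℕ} (z : Module.Basis (Fin (N + 1)) ℂ E) (q α β σ : ℂ) :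
    opZ z q α β σ = opZ z q α β 0 + σ • 1 := by
  refine (LinearMap.toMatrix z z).injective ?_
  ext i j
  rw [← mat, ← mat, mat_add, mat_smul, mat_one]
  by_cases h : i = j
  · subst h; simp [mat_opZ_self]
  · simp [mat_opZ_isDiag z q α β σ h, mat_opZ_isDiag z q α β 0 h, h]

theorem isTridiagonal_opRacah {N : ℕ} (z : Module.Basis (Fin (N + 1)) ℂ E) (q α β δ : ℂ)
    (ν : ℕ → ℂ) : IsTridiagonal (mat z (opRacah z q α β δ ν)) := by
  intro i j h1 h2 h3
  rw [mat_opRacah, if_neg (Ne.symm h3), if_neg h1, if_neg h2]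

theorem racahC_zero (q α β γ δ : ℂ) : racahC q α β γ δ 0 = 0 := by simp [racahC]

theorem racahA_last {q : ℂ} (hq0 : q ≠ 0) (α β δ : ℂ) (N : ℕ) :
    racahA q α β (gam q N) δ N = 0 := by
  simp [racahA, gam, pow_ne_zero _ hq0]

/-- The `q`-Racah operator as a second order difference operator. The values of `f` outside
`0, …, N` are irrelevant, since `C_0 = A_N = 0`. -/
theorem repr_opRacah {N : ℕ} (z : Module.Basis (Fin (N + 1)) ℂ E) {q : ℂ} (hq0 : q ≠ 0)
    (α β δ : ℂ) (f : ℕ → ℂ) (k : Fin (N + 1)) :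
    z.repr (opRacah z q α β δ 1 (∑ i : Fin (N + 1), f i • z i)) k =
      racahC q α β (gam q N) δ k * f (k - 1) + racahB q α β (gam q N) δ k * f k +
        racahA q α β (gam q N) δ k * f (k + 1) := by
  have hf : ∀ i, z.repr (∑ i : Fin (N + 1), f i • z i) i = f i := fun i => by
    rw [Module.Basis.repr_sum_self]
  rw [repr_apply_eq_sum]
  simp only [hf, mat_opRacah]
  have : ∀ i : Fin (N + 1),
      (if (k : ℕ) = i + 1 then racahC q α β (gam q N) δ k * (1 : ℕ → ℂ) k
        else if k = i then racahB q α β (gam q N) δ i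
        else if (k : ℕ) + 1 = i then racahA q α β (gam q N) δ k * (1 / (1 : ℕ → ℂ) i) else 0) *
        f i =
      (if (k : ℕ) = i + 1 then racahC q α β (gam q N) δ k * f (k - 1) else 0) +
      (if k = i then racahB q α β (gam q N) δ k * f k else 0) +
      (if (k : ℕ) + 1 = i then racahA q α β (gam q N) δ k * f (k + 1) else 0) := by
    intro i
    by_cases h1 : (k : ℕ) = i + 1
    · have h2 : k ≠ i := fun h => by subst h; omega
      have h3 : (k : ℕ) + 1 ≠ i := by omega
      rw [if_pos h1, if_pos h1, if_neg h2, if_neg h3]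
      have : (k : ℕ) - 1 = i := by omega
      simp [this]
    · by_cases h2 : k = i
      · subst h2; simp
      · by_cases h3 : (k : ℕ) + 1 = i
        · simp [h1, h2, h3]
        · simp [h1, h2, h3]
  simp only [this, Finset.sum_add_distrib]
  congr 1
  · congr 1
    · by_cases hk : (k : ℕ) = 0
      · simp [hk, racahC_zero]
      · rw [Finset.sum_eq_single ⟨k - 1, by omega⟩]
        · rw [if_pos (by simp only; omega)]
        · intro b _ hb
          rw [if_neg fun h => hb ?_]
          ext; simp only; omega
        · simp
    · simp
  · by_cases hk : (k : ℕ) = N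
    · simp [hk, racahA_last hq0]
    · rw [Finset.sum_eq_single ⟨k + 1, by omega⟩]
      · simp
      · intro b _ hb
        rw [if_neg fun h => hb ?_]
        ext; simp only; omega
      · simp

/-- Rescaling the basis removes the normalisation `ν`. -/
theorem exists_rescaled_basis {N : ℕ} (z : Module.Basis (Fin (N + 1)) ℂ E) (q α β δ : ℂ)
    {ν : ℕ → ℂ} (hν : ∀ i, 1 ≤ i → i ≤ N → ν i ≠ 0) :
    ∃ z' : Module.Basis (Fin (N + 1)) ℂ E, opRacah z q α β δ ν = opRacah z' q α β δ 1 ∧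
      ∀ α' β' σ, opZ z q α' β' σ = opZ z' q α' β' σ := by
  let w : ℕ → ℂ := fun i => ∏ j ∈ Finset.range i, if j < N then ν (j + 1) else 1
  have hw : ∀ i, w i ≠ 0 := by
    intro i
    refine Finset.prod_ne_zero_iff.2 fun j _ => ?_
    split_ifs with h
    · exact hν _ (by omega) (by omega)
    · exact one_ne_zero
  have hw1 : ∀ i, i < N → w (i + 1) = w i * ν (i + 1) := by
    intro i hi
    simp [w, Finset.prod_range_succ, hi]
  let z' := z.unitsSMul fun i : Fin (N + 1) => Units.mk0 (w i) (hw i)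
  have hz' : ∀ i, z' i = w i • z i := fun i => by
    simp [z', Module.Basis.unitsSMul_apply, Units.smul_def]
  have hrepr : ∀ (u : E) (i : Fin (N + 1)), w i * z'.repr u i = z.repr u i := by
    intro u i
    conv_rhs => rw [← z'.sum_repr u]
    simp [hz', Finsupp.single_apply, mul_comm]
  have hmat : ∀ (X : Module.End ℂ E) (k i : Fin (N + 1)),
      w k * mat z' X k i = w i * mat z X k i := by
    intro X k i
    rw [mat_apply_eq_repr, hrepr, hz', mat_apply_eq_repr]
    simp
  refine ⟨z', ?_, fun α' β' σ => ?_⟩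
  · refine (LinearMap.toMatrix z' z').injective ?_
    ext k i
    rw [← mat, ← mat]
    apply mul_left_cancel₀ (hw k)
    rw [hmat, mat_opRacah, mat_opRacah]
    by_cases h1 : (k : ℕ) = i + 1
    · rw [if_pos h1, if_pos h1, h1, hw1 _ (by omega)]
      simp; ring
    rw [if_neg h1, if_neg h1]
    by_cases h2 : k = i
    · simp [h2]
    rw [if_neg h2, if_neg h2]
    by_cases h3 : (k : ℕ) + 1 = i
    · have hne := hν i (by omega) (by omega)
      rw [if_pos h3, if_pos h3, ← h3, hw1 _ (by omega)]
      rw [← h3] at hne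
      simp; field_simp
    rw [if_neg h3, if_neg h3]; simp
  · refine (LinearMap.toMatrix z' z').injective ?_
    ext k i
    rw [← mat, ← mat]
    apply mul_left_cancel₀ (hw k)
    rw [hmat]
    by_cases h : k = i
    · subst h; rw [mat_opZ_self, mat_opZ_self]
    · rw [mat_opZ_isDiag z q α' β' σ h, mat_opZ_isDiag z' q α' β' σ h]; simp

/-- The vectors `φ_k`, in whose span the `q`-Racah operator and `Z` are bidiagonal. -/
def phiVec {N : ℕ} (z : Module.Basis (Fin (N + 1)) ℂ E) (q c : ℂ) (k : ℕ) : E :=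
  ∑ i : Fin (N + 1), phiCoef q c k i • z i

theorem repr_phiVec {N : ℕ} (z : Module.Basis (Fin (N + 1)) ℂ E) (q c : ℂ) (k : ℕ)
    (i : Fin (N + 1)) : z.repr (phiVec z q c k) i = phiCoef q c k i := by
  rw [phiVec, Module.Basis.repr_sum_self]

theorem opZ_phiVec {N : ℕ} (z : Module.Basis (Fin (N + 1)) ℂ E) {q : ℂ} (hq0 : q ≠ 0)
    (α β : ℂ) (k : ℕ) : opZ z q α β 0 (phiVec z q (α * β) k) =
      grid q (α * β) k • phiVec z q (α * β) k - (q ^ k)⁻¹ • phiVec z q (α * β) (k + 1) := by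
  apply z.ext_elem
  intro i
  rw [repr_apply_of_isDiag (mat_opZ_isDiag z q α β 0), mat_opZ_self]
  simp only [map_sub, map_smul, Finsupp.sub_apply, Finsupp.smul_apply, repr_phiVec, smul_eq_mul,
    phiCoef_succ, grid, add_zero]
  generalize phiCoef q (α * β) k i = f
  have hx : q ^ (i : ℕ) ≠ 0 := pow_ne_zero _ hq0
  have hy : q ^ k ≠ 0 := pow_ne_zero _ hq0
  simp only [pow_add, pow_one]
  generalize q ^ (i : ℕ) = x at *
  generalize q ^ k = y at *
  field_simp
  ring

theorem opRacah_phiVec_zero {N : ℕ} (z : Module.Basis (Fin (N + 1)) ℂ E) {q : ℂ} (hq0 : q ≠ 0)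
    (α β δ : ℂ) : opRacah z q α β δ 1 (phiVec z q (α * β) 0) =
      grid q (gam q N * δ) 0 • phiVec z q (α * β) 0 := by
  apply z.ext_elem
  intro i
  rw [phiVec, repr_opRacah z hq0, map_smul, Finsupp.smul_apply, ← phiVec, repr_phiVec]
  simp only [phiCoef_zero, racahB, grid]
  simp only [pow_zero, inv_one, zero_add, pow_one, smul_eq_mul]
  ring

theorem opRacah_phiVec_succ {N : ℕ} (z : Module.Basis (Fin (N + 1)) ℂ E) {q : ℂ} (hq0 : q ≠ 0)
    {α β : ℂ} (δ : ℂ) (hc : ∀ i ≤ 2 * N + 2, α * β * q ^ i ≠ 1) (k : ℕ) :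
    opRacah z q α β δ 1 (phiVec z q (α * β) (k + 1)) =
      grid q (gam q N * δ) (k + 1) • phiVec z q (α * β) (k + 1) +
        splitMu q α β (gam q N) δ (k + 1) • phiVec z q (α * β) k := by
  apply z.ext_elem
  intro i
  rw [phiVec, repr_opRacah z hq0, ← phiVec]
  simp only [map_add, map_smul, Finsupp.add_apply, Finsupp.smul_apply, repr_phiVec, smul_eq_mul]
  exact racah_phiCoef_succ hq0 (hc (2 * i) (by omega)) (hc (2 * i + 1) (by omega))
    (hc (2 * i + 2) (by omega)) k

/-- The vectors `φ_0, …, φ_N` form a basis, by triangularity. -/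
theorem exists_phiBasis {N : ℕ} (z : Module.Basis (Fin (N + 1)) ℂ E) {q : ℂ} (hq0 : q ≠ 0)
    (hq : ∀ k : ℕ, 0 < k → q ^ k ≠ 1) {c : ℂ} (hc : ∀ i ≤ 2 * N + 2, c * q ^ i ≠ 1) :
    ∃ b : Module.Basis (Fin (N + 1)) ℂ E, ∀ k, b k = phiVec z q c k := by
  have hdet : IsUnit (z.det fun k : Fin (N + 1) => phiVec z q c k) := by
    rw [Module.Basis.det_apply, Matrix.det_of_isLowerTriangular]
    · rw [isUnit_iff_ne_zero, Finset.prod_ne_zero_iff]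
      intro i _
      rw [Module.Basis.toMatrix_apply, repr_phiVec, phiCoef, Finset.prod_ne_zero_iff]
      intro j hj
      rw [Finset.mem_range] at hj
      refine mul_ne_zero ?_ (sub_ne_zero.2 (Ne.symm (hc _ (by omega))))
      rw [sub_ne_zero, ne_comm, Ne, div_eq_one_iff_eq (pow_ne_zero _ hq0)]
      intro h
      apply hq (i - j) (by omega)
      have : q ^ (i : ℕ) = q ^ j * q ^ ((i : ℕ) - j) := by
        rw [← pow_add]; congr 1; omega
      rw [this] at h
      exact (mul_eq_left₀ (pow_ne_zero _ hq0)).1 h.symm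
    · intro i j hij
      rw [Module.Basis.toMatrix_apply, repr_phiVec]
      exact phiCoef_eq_zero hq0 c (by simpa using hij)
  obtain ⟨hli, hsp⟩ := (Module.Basis.is_basis_iff_det z).2 hdet
  exact ⟨Module.Basis.mk hli hsp.ge, fun k => by simp⟩

/-- The spectrum of the `q`-Racah operator, read off from its triangular form. -/
theorem hasEigenvalue_opRacah_iff {N : ℕ} (z : Module.Basis (Fin (N + 1)) ℂ E) {q : ℂ}
    (hq0 : q ≠ 0) (hq : ∀ k : ℕ, 0 < k → q ^ k ≠ 1) {α β : ℂ} (δ : ℂ)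
    (hc : ∀ i ≤ 2 * N + 2, α * β * q ^ i ≠ 1) {ν : ℕ → ℂ}
    (hν : ∀ i, 1 ≤ i → i ≤ N → ν i ≠ 0) (μ : ℂ) :
    (opRacah z q α β δ ν).HasEigenvalue μ ↔ ∃ k : Fin (N + 1), μ = grid q (gam q N * δ) k := by
  have := Module.Finite.of_basis z
  have := Module.Free.of_basis z
  obtain ⟨z', h', -⟩ := exists_rescaled_basis z q α β δ hν
  obtain ⟨b, hb⟩ := exists_phiBasis z' hq0 hq hc
  have hchar : (opRacah z q α β δ ν).charpoly =
      ∏ k : Fin (N + 1), (Polynomial.X - Polynomial.C (grid q (gam q N * δ) k)) := by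
    rw [h', ← LinearMap.charpoly_toMatrix _ b, Matrix.charpoly_of_isUpperTriangular]
    · refine Finset.prod_congr rfl fun k _ => ?_
      congr 2
      rw [← mat, mat_apply_eq_repr, hb]
      obtain ⟨k, hk⟩ := k
      cases k with
      | zero =>
        rw [opRacah_phiVec_zero z' hq0, ← hb ⟨0, hk⟩]; simp
      | succ k =>
        have e1 := hb ⟨k + 1, hk⟩
        have e2 := hb ⟨k, by omega⟩
        simp only at e1 e2
        simp only
        rw [opRacah_phiVec_succ z' hq0 δ hc, ← e1, ← e2]
        simp
    · intro i j hij
      have hji : j ≠ i := hij.ne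
      rw [← mat, mat_apply_eq_repr, hb]
      obtain ⟨k, hk⟩ := j
      cases k with
      | zero =>
        rw [opRacah_phiVec_zero z' hq0, ← hb ⟨0, hk⟩, map_smul, b.repr_self, Finsupp.smul_apply,
          Finsupp.single_apply, if_neg hji, smul_zero]
      | succ k =>
        have e1 := hb ⟨k + 1, hk⟩
        have e2 := hb ⟨k, by omega⟩
        simp only at e1 e2
        simp only
        have hki : (⟨k, by omega⟩ : Fin (N + 1)) ≠ i := by
          intro h
          have h2 := congrArg Fin.val h
          simp only [id_eq, Fin.lt_def] at hij h2
          omega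
        rw [opRacah_phiVec_succ z' hq0 δ hc, ← e1, ← e2]
        simp [hji, hki]
  rw [Module.End.hasEigenvalue_iff_isRoot_charpoly, hchar,
    Polynomial.IsRoot.def, Polynomial.eval_prod, Finset.prod_eq_zero_iff]
  simp [sub_eq_zero]

/-! ### The Askey-Wilson relation and Leonard pairs -/

theorem grid_sub_grid {q : ℂ} (hq0 : q ≠ 0) (c : ℂ) (m n : ℕ) :
    grid q c m - grid q c n = ((q ^ m)⁻¹ - (q ^ n)⁻¹) * (1 - c * q ^ (m + n + 1)) := by
  have h1 : q ^ m ≠ 0 := pow_ne_zero _ hq0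
  have h2 : q ^ n ≠ 0 := pow_ne_zero _ hq0
  simp only [grid, pow_add, pow_one]
  field_simp
  ring

theorem inv_pow_sub_ne_zero {q : ℂ} (hq0 : q ≠ 0) (hq : ∀ k : ℕ, 0 < k → q ^ k ≠ 1) {m n : ℕ}
    (h : m ≠ n) : (q ^ m)⁻¹ - (q ^ n)⁻¹ ≠ 0 := by
  rw [sub_ne_zero, Ne, inv_inj]
  intro he
  wlog hlt : m < n generalizing m n
  · exact this h.symm he.symm (by omega)
  have : q ^ n = q ^ m * q ^ (n - m) := by rw [← pow_add]; congr 1; omega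
  rw [this] at he
  exact hq (n - m) (by omega) ((mul_eq_left₀ (pow_ne_zero _ hq0)).1 he.symm)

theorem grid_ne_grid {q : ℂ} (hq0 : q ≠ 0) (hq : ∀ k : ℕ, 0 < k → q ^ k ≠ 1) {c : ℂ} {m n : ℕ}
    (h : m ≠ n) (hc : c * q ^ (m + n + 1) ≠ 1) : grid q c m ≠ grid q c n := by
  rw [← sub_ne_zero, grid_sub_grid hq0]
  exact mul_ne_zero (inv_pow_sub_ne_zero hq0 hq h) (sub_ne_zero.2 hc.symm)

/-- The constant term of the numerator of the diagonal coefficient `B_n`, see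
`racahB_mul_grid`; with the roles of `α β` and `γ δ` exchanged it is also a structure constant of
the Askey-Wilson relation. -/
def racahB0 (q α β γ δ : ℂ) : ℂ :=
  -(1 + q) * q * (α * β + α * β * δ + α ^ 2 * β + α * γ + α * β ^ 2 * δ + α * β * γ + β * γ * δ +
    α * β * γ * δ)

/-- The Askey-Wilson relation of the `q`-Racah operator `V` and the diagonal operator `Z`, which is
checked on the split basis. -/
theorem askeyWilson_opRacah {N : ℕ} (z : Module.Basis (Fin (N + 1)) ℂ E) {q : ℂ} (hq0 : q ≠ 0)
    (hq : ∀ k : ℕ, 0 < k → q ^ k ≠ 1) {α β : ℂ} (δ : ℂ)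
    (hc : ∀ i ≤ 2 * N + 2, α * β * q ^ i ≠ 1) {V Z : Module.End ℂ E}
    (hV : V = opRacah z q α β δ 1) (hZ : Z = opZ z q α β 0) :
    V * (V * Z) + (-(q + q⁻¹)) • (V * (Z * V)) + (Z * V) * V +
        (gam q N * δ * q * (q - q⁻¹) ^ 2) • Z =
      ((2 - (q + q⁻¹)) * psi q α β (gam q N) δ) • V +
        ((2 - (q + q⁻¹)) * racahB0 q (gam q N) δ α β) • 1 := by
  obtain ⟨b, hb⟩ := exists_phiBasis z hq0 hq hc
  have hZφ := fun k => opZ_phiVec z hq0 α β k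
  have hV0 := opRacah_phiVec_zero z hq0 α β δ
  have hV1 := opRacah_phiVec_succ z hq0 δ hc
  rw [← hV] at hV0 hV1
  rw [← hZ] at hZφ
  refine b.ext fun k => ?_
  rw [hb]
  generalize (k : ℕ) = k
  generalize gam q N = γ at *
  generalize phiVec z q (α * β) = φ at *
  match k with
  | 0 =>
    simp only [Module.End.mul_apply, LinearMap.add_apply, LinearMap.smul_apply, map_add, map_sub,
      map_smul, hZφ, hV0, hV1, smul_add, smul_sub, smul_smul, Module.End.one_apply]
    match_scalars
    all_goals
      simp only [grid, splitMu, psi, racahB0, zero_add, pow_zero, pow_succ]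
      field_simp
      ring
  | 1 =>
    simp only [Module.End.mul_apply, LinearMap.add_apply, LinearMap.smul_apply, map_add, map_sub,
      map_smul, hZφ, hV0, hV1 0, hV1 1, smul_add, smul_sub, smul_smul,
      Module.End.one_apply, zero_add]
    match_scalars
    all_goals
      simp only [grid, splitMu, psi, racahB0, zero_add, pow_zero, pow_succ]
      field_simp
      ring
  | k + 2 =>
    simp only [Module.End.mul_apply, LinearMap.add_apply, LinearMap.smul_apply, map_add, map_sub,
      map_smul, hZφ, hV1, smul_add, smul_sub, smul_smul, Module.End.one_apply]
    have hy : q ^ k ≠ 0 := pow_ne_zero _ hq0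
    match_scalars
    all_goals
      simp only [grid, splitMu, psi, racahB0, pow_succ]
      generalize q ^ k = y at *
      field_simp
      ring

/-- The inequalities under which the `q`-Racah operator with parameters `(α, β, q^{-N-1}, δ)` is
well defined, irreducible and multiplicity free, with a spectrum that is also disjoint from the two
neighbours `q + γ δ` and `q^{-N-1} + γ δ q^{N+2}` of the grid it fills. -/
structure IsRegular (N : ℕ) (q α β δ : ℂ) : Prop where
  ab : ∀ i ≤ 2 * N + 2, α * β * q ^ i ≠ 1
  a : ∀ i ≤ N, α * q ^ i ≠ 1
  b : ∀ i ≤ N, β * q ^ i ≠ 1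
  bd : ∀ i ≤ N, β * δ * q ^ i ≠ 1
  da : ∀ i ≤ N, δ ≠ α * q ^ i
  d : ∀ i ≤ 2 * N + 2, δ * q ^ i ≠ q ^ (N + 1)

section

variable {N : ℕ} {q α β δ : ℂ} (hq0 : q ≠ 0) (hq : ∀ k : ℕ, 0 < k → q ^ k ≠ 1)

theorem IsRegular.gam_mul_ne (hq0 : q ≠ 0) (h : IsRegular N q α β δ) {i : ℕ}
    (hi : i ≤ 2 * N + 2) : gam q N * δ * q ^ i ≠ 1 := by
  intro he
  refine h.d i hi ?_
  have : q ^ (N + 1) ≠ 0 := pow_ne_zero _ hq0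
  rw [gam] at he
  field_simp at he
  exact he

include hq0 hq in
theorem gam_mul_pow_ne_one {i : ℕ} (hi : i ≤ N) : gam q N * q ^ i ≠ 1 := by
  intro he
  have h1 : q ^ i ≠ 0 := pow_ne_zero _ hq0
  have : q ^ (N + 1) = q ^ i * q ^ (N + 1 - i) := by rw [← pow_add]; congr 1; omega
  rw [gam, this] at he
  field_simp at he
  exact hq (N + 1 - i) (by omega) he.symm

include hq0 hq in
theorem IsRegular.racahA_ne_zero (h : IsRegular N q α β δ) {i : ℕ} (hi : i < N) :
    racahA q α β (gam q N) δ i ≠ 0 := by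
  have e : ∀ {x : ℂ}, x ≠ 1 → 1 - x ≠ 0 := fun hx => sub_ne_zero.2 hx.symm
  refine div_ne_zero (mul_ne_zero (mul_ne_zero (mul_ne_zero ?_ ?_) ?_) ?_) (mul_ne_zero ?_ ?_)
  · exact e (h.a _ hi)
  · exact e (h.ab _ (by omega))
  · exact e (h.bd _ hi)
  · exact e (gam_mul_pow_ne_one hq0 hq hi)
  · exact e (h.ab _ (by omega))
  · exact e (h.ab _ (by omega))

include hq0 hq in
theorem IsRegular.racahC_ne_zero (h : IsRegular N q α β δ) {i : ℕ} (h1 : 1 ≤ i) (hi : i ≤ N) :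
    racahC q α β (gam q N) δ i ≠ 0 := by
  have e : ∀ {x : ℂ}, x ≠ 1 → 1 - x ≠ 0 := fun hx => sub_ne_zero.2 hx.symm
  refine div_ne_zero (mul_ne_zero (mul_ne_zero (mul_ne_zero (mul_ne_zero hq0 ?_) ?_) ?_) ?_)
    (mul_ne_zero ?_ ?_)
  · exact e (hq _ h1)
  · exact e (h.b _ hi)
  · rw [gam, sub_ne_zero]
    intro he
    refine h.ab (i + (N + 1)) (by omega) ?_
    rw [pow_add, ← mul_assoc, ← he, inv_mul_cancel₀ (pow_ne_zero _ hq0)]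
  · exact sub_ne_zero.2 (h.da _ hi)
  · exact e (h.ab _ (by omega))
  · exact e (h.ab _ (by omega))

include hq0 hq in
theorem isMultFreeDiag_opZ (z : Module.Basis (Fin (N + 1)) ℂ E)
    (h : ∀ i ≤ 2 * N + 2, α * β * q ^ i ≠ 1) (σ : ℂ) : IsMultFreeDiag (mat z (opZ z q α β σ)) := by
  refine ⟨mat_opZ_isDiag z q α β σ, fun i j hij => ?_⟩
  by_contra hne
  simp only [mat_opZ_self, add_left_inj] at hij
  exact grid_ne_grid hq0 hq (fun h => hne (Fin.ext h)) (h _ (by omega)) hij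

include hq0 hq in
theorem IsRegular.isIrredTridiagonal (h : IsRegular N q α β δ)
    (z : Module.Basis (Fin (N + 1)) ℂ E) {ν : ℕ → ℂ} (hν : ∀ i, 1 ≤ i → i ≤ N → ν i ≠ 0) :
    IsIrredTridiagonal (mat z (opRacah z q α β δ ν)) := by
  refine ⟨isTridiagonal_opRacah z q α β δ ν, fun i j hij => ⟨?_, ?_⟩⟩
  · rw [mat_opRacah, if_neg (by omega), if_neg (fun h => by subst h; omega), if_pos hij]
    exact mul_ne_zero (h.racahA_ne_zero hq0 hq (by omega))
      (one_div_ne_zero (hν _ (by omega) (by omega)))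
  · rw [mat_opRacah, if_pos hij.symm]
    exact mul_ne_zero (h.racahC_ne_zero hq0 hq (by omega) (by omega)) (hν _ (by omega) (by omega))

include hq0 hq in
/-- The eigenbasis of the `q`-Racah operator, in the order of the grid. -/
theorem IsRegular.exists_eigenbasis (h : IsRegular N q α β δ)
    (z : Module.Basis (Fin (N + 1)) ℂ E) {ν : ℕ → ℂ} (hν : ∀ i, 1 ≤ i → i ≤ N → ν i ≠ 0) :
    ∃ v : Module.Basis (Fin (N + 1)) ℂ E, IsMultFreeDiag (mat v (opRacah z q α β δ ν)) ∧
      ∀ n, mat v (opRacah z q α β δ ν) n n = grid q (gam q N * δ) n := by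
  have hinj : Function.Injective fun n : Fin (N + 1) => grid q (gam q N * δ) n := by
    intro m n hmn
    by_contra hne
    exact grid_ne_grid hq0 hq (fun h => hne (Fin.ext h)) (h.gam_mul_ne hq0 (by omega)) hmn
  have hev : ∀ n : Fin (N + 1), ∃ u,
      (opRacah z q α β δ ν).HasEigenvector (grid q (gam q N * δ) n) u := fun n =>
    ((hasEigenvalue_opRacah_iff z hq0 hq δ h.ab hν _).2 ⟨n, rfl⟩).exists_hasEigenvector
  choose u hu using hev
  have hli := Module.End.eigenvectors_linearIndependent' (opRacah z q α β δ ν) _ hinj u hu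
  have := Module.Finite.of_basis z
  have hcard : Fintype.card (Fin (N + 1)) = Module.finrank ℂ E := by
    rw [Module.finrank_eq_card_basis z]
  let v := basisOfLinearIndependentOfCardEqFinrank hli hcard
  obtain ⟨h1, h2⟩ := isDiag_of_apply_basis (b := v) (Y := opRacah z q α β δ ν)
    (c := fun n => grid q (gam q N * δ) n) fun i => by
      simp only [v, coe_basisOfLinearIndependentOfCardEqFinrank]
      exact (hu i).apply_eq_smul
  exact ⟨v, ⟨h1, fun m n hmn => hinj (by simpa only [h2] using hmn)⟩, h2⟩

/-- The Askey-Wilson quadratic form vanishes exactly at neighbours of the grid. -/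
theorem grid_askeyWilson (hq0 : q ≠ 0) (c x : ℂ) (n : ℕ) :
    x ^ 2 - (q + q⁻¹) * x * grid q c (n + 1) + grid q c (n + 1) ^ 2 + c * q * (q - q⁻¹) ^ 2 =
      (x - grid q c (n + 2)) * (x - grid q c n) := by
  have hx : q ^ n ≠ 0 := pow_ne_zero _ hq0
  simp only [grid, pow_succ]
  field_simp
  ring

theorem grid_askeyWilson_zero (hq0 : q ≠ 0) (c x : ℂ) :
    x ^ 2 - (q + q⁻¹) * x * grid q c 0 + grid q c 0 ^ 2 + c * q * (q - q⁻¹) ^ 2 =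
      (x - grid q c 1) * (x - (q + c)) := by
  simp only [grid, pow_succ]
  field_simp
  ring

include hq0 hq in
/-- Entries of `Z` in an eigenbasis of the `q`-Racah operator connect only neighbours of the
grid. -/
theorem IsRegular.mat_opZ_eq_zero (h : IsRegular N q α β δ)
    (z : Module.Basis (Fin (N + 1)) ℂ E) (σ : ℂ) {v : Module.Basis (Fin (N + 1)) ℂ E}
    (hv : (mat v (opRacah z q α β δ 1)).IsDiag) {i j : Fin (N + 1)} (hij : i ≠ j) {m n : ℕ}
    (hm : mat v (opRacah z q α β δ 1) i i = grid q (gam q N * δ) m)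
    (hn : mat v (opRacah z q α β δ 1) j j = grid q (gam q N * δ) n)
    (hmN : m ≤ N) (hnN : n ≤ N) (hmn : m ≠ n) (h1 : m + 1 ≠ n) (h2 : n + 1 ≠ m) :
    mat v (opZ z q α β σ) i j = 0 := by
  have hne1 : grid q (gam q N * δ) m ≠ grid q (gam q N * δ) (n + 1) :=
    grid_ne_grid hq0 hq (by omega) (h.gam_mul_ne hq0 (by omega))
  rw [opZ_eq_add, mat_add, mat_smul, mat_one, if_neg hij, mul_zero, add_zero]
  refine mat_eq_zero_of_askeyWilson hv ?_ (askeyWilson_opRacah z hq0 hq δ h.ab rfl rfl) hij ?_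
  · intro k l hkl
    rw [mat_add, mat_smul, mat_smul, mat_one, if_neg hkl, hv hkl]; ring
  rw [hm, hn]
  cases n with
  | zero =>
    rw [grid_askeyWilson_zero hq0]
    refine mul_ne_zero (sub_ne_zero.2 hne1) ?_
    have hx : q ^ m ≠ 0 := pow_ne_zero _ hq0
    have : grid q (gam q N * δ) m - (q + gam q N * δ) =
        ((q ^ m)⁻¹ - q) * (1 - gam q N * δ * q ^ m) := by
      rw [grid, pow_succ]; field_simp; ring
    rw [this]
    refine mul_ne_zero ?_ (sub_ne_zero.2 (h.gam_mul_ne hq0 (by omega)).symm)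
    rw [sub_ne_zero]
    intro he
    apply hq (m + 1) (by omega)
    calc q ^ (m + 1) = q ^ m * (q ^ m)⁻¹ := by rw [he, pow_succ]
      _ = 1 := mul_inv_cancel₀ hx
  | succ n =>
    rw [grid_askeyWilson hq0]
    exact mul_ne_zero (sub_ne_zero.2 hne1) (sub_ne_zero.2
      (grid_ne_grid hq0 hq (by omega) (h.gam_mul_ne hq0 (by omega))))

include hq0 hq in
/-- The eigenbasis of the `q`-Racah operator, in which `Z` is irreducible tridiagonal. -/
theorem IsRegular.exists_dual_basis (h : IsRegular N q α β δ)
    (z : Module.Basis (Fin (N + 1)) ℂ E) {ν : ℕ → ℂ} (hν : ∀ i, 1 ≤ i → i ≤ N → ν i ≠ 0)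
    (σ : ℂ) : ∃ v : Module.Basis (Fin (N + 1)) ℂ E,
      IsMultFreeDiag (mat v (opRacah z q α β δ ν)) ∧
      (∀ n, mat v (opRacah z q α β δ ν) n n = grid q (gam q N * δ) n) ∧
      IsIrredTridiagonal (mat v (opZ z q α β σ)) := by
  obtain ⟨z', hz1, hz2⟩ := exists_rescaled_basis z q α β δ hν
  rw [hz1, hz2]
  have h1 : ∀ i, 1 ≤ i → i ≤ N → (1 : ℕ → ℂ) i ≠ 0 := fun _ _ _ => one_ne_zero
  obtain ⟨v, hv, hv'⟩ := h.exists_eigenbasis hq0 hq z' h1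
  refine ⟨v, hv, hv', ?_⟩
  refine isIrredTridiagonal_of_isTridiagonal (h.isIrredTridiagonal hq0 hq z' h1)
    (isMultFreeDiag_opZ hq0 hq z' h.ab σ) ?_ hv.1 (Or.inr ⟨rfl, rfl⟩)
  intro i j hij h2 h3
  exact h.mat_opZ_eq_zero hq0 hq z' σ hv.1 hij (hv' i) (hv' j) (by omega) (by omega)
    (fun h => hij (Fin.ext h)) h2 h3

include hq0 hq in
theorem IsRegular.isLeonardPair (h : IsRegular N q α β δ)
    (z : Module.Basis (Fin (N + 1)) ℂ E) {ν : ℕ → ℂ} (hν : ∀ i, 1 ≤ i → i ≤ N → ν i ≠ 0)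
    (σ : ℂ) : IsLeonardPair N (opRacah z q α β δ ν) (opZ z q α β σ) := by
  obtain ⟨v, hv, -, hv'⟩ := h.exists_dual_basis hq0 hq z hν σ
  exact ⟨⟨z, h.isIrredTridiagonal hq0 hq z hν, mat_opZ_isDiag z q α β σ⟩, ⟨v, hv.1, hv'⟩⟩

end

/-! ### The Heun relations in coordinates -/

theorem mat_opZ {N : ℕ} (z : Module.Basis (Fin (N + 1)) ℂ E) (q α β σ : ℂ) (k i : Fin (N + 1)) :
    mat z (opZ z q α β σ) k i = if k = i then grid q (α * β) i + σ else 0 := by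
  by_cases h : k = i
  · subst h; rw [mat_opZ_self, if_pos rfl]
  · rw [mat_opZ_isDiag z q α β σ h, if_neg h]

/-- The Heun relations, entry by entry, in a basis in which `Z` is diagonal. -/
theorem heunRelations_iff {N : ℕ} (z : Module.Basis (Fin (N + 1)) ℂ E) (q α β σ : ℂ)
    (V W : Module.End ℂ E) (h : Fin 10 → ℂ) :
    HeunRelations V W (opZ z q α β σ) h ↔ ∀ k i : Fin (N + 1),
      mat z W k i * (grid q (α * β) i + σ) =
        (if k = i then h 0 + h 1 * (grid q (α * β) i + σ) else 0) +
          (h 2 + h 3 * (grid q (α * β) i + σ) + h 4 * (grid q (α * β) k + σ)) * mat z V k i ∧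
      (grid q (α * β) k + σ) * mat z V k i =
        (if k = i then h 5 + h 6 * (grid q (α * β) i + σ) else 0) +
          (h 7 + h 8 * (grid q (α * β) i + σ) + h 9 * (grid q (α * β) k + σ)) * mat z W k i := by
  have hZ := mat_opZ_isDiag z q α β σ
  have hZs := mat_opZ_self z q α β σ
  have ext : ∀ X Y : Module.End ℂ E, X = Y ↔ ∀ k i, mat z X k i = mat z Y k i := fun X Y =>
    ⟨fun h _ _ => by rw [h], fun h => (LinearMap.toMatrix z z).injective (by ext k i; exact h k i)⟩
  rw [HeunRelations, ext, ext, ← forall_and]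
  refine forall_congr' fun k => ?_
  rw [← forall_and]
  refine forall_congr' fun i => ?_
  simp only [mat_add, mat_smul, mat_one, mat_mul_of_isDiag_right hZ, mat_mul_of_isDiag_left hZ,
    mat_opZ, if_true]
  refine and_congr ?_ ?_
  · refine Eq.congr rfl ?_
    split_ifs <;> ring
  · refine Eq.congr rfl ?_
    split_ifs <;> ring

/-- The diagonal coefficient `B_n` as a function of the grid point `u = q^{-n} + α β q^{n+1}`: it is
a linear function of `u` divided by `u ^ 2 - α β (1 + q) ^ 2`. -/
theorem racahB_mul_grid {q α β γ δ : ℂ} (hq0 : q ≠ 0) {n : ℕ} (h0 : α * β * q ^ (2 * n) ≠ 1)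
    (h1 : α * β * q ^ (2 * n + 1) ≠ 1) (h2 : α * β * q ^ (2 * n + 2) ≠ 1) :
    racahB q α β γ δ n * (grid q (α * β) n ^ 2 - α * β * (1 + q) ^ 2) =
      racahB0 q α β γ δ + psi q α β γ δ * grid q (α * β) n := by
  have hx : q ^ n ≠ 0 := pow_ne_zero _ hq0
  have d0 : 1 - α * β * q ^ (2 * n) ≠ 0 := sub_ne_zero.2 h0.symm
  have d1 : 1 - α * β * q ^ (2 * n + 1) ≠ 0 := sub_ne_zero.2 h1.symm
  have d2 : 1 - α * β * q ^ (2 * n + 2) ≠ 0 := sub_ne_zero.2 h2.symm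
  obtain ⟨D0, hD0⟩ : ∃ D, D = 1 - α * β * q ^ (2 * n) := ⟨_, rfl⟩
  obtain ⟨D1, hD1⟩ : ∃ D, D = 1 - α * β * q ^ (2 * n + 1) := ⟨_, rfl⟩
  obtain ⟨D2, hD2⟩ : ∃ D, D = 1 - α * β * q ^ (2 * n + 2) := ⟨_, rfl⟩
  have key : grid q (α * β) n ^ 2 - α * β * (1 + q) ^ 2 = D0 * D2 / (q ^ n) ^ 2 := by
    rw [hD0, hD2, grid]
    simp only [pow_add, pow_mul, pow_one, mul_comm 2 n]
    generalize q ^ n = x at *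
    field_simp
    ring
  rw [key]
  simp only [racahB, racahA, racahC, racahB0, psi, grid]
  rw [← hD0] at d0 ⊢
  rw [← hD1] at d1 ⊢
  rw [← hD2] at d2 ⊢
  simp only [pow_add, pow_mul, pow_one, mul_comm 2 n] at *
  generalize q ^ n = x at *
  field_simp
  rw [hD0, hD1, hD2]
  ring

theorem grid_sq_sub_ne_zero {q c : ℂ} (hq0 : q ≠ 0) {n : ℕ} (h0 : c * q ^ (2 * n) ≠ 1)
    (h2 : c * q ^ (2 * n + 2) ≠ 1) : grid q c n ^ 2 - c * (1 + q) ^ 2 ≠ 0 := by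
  have hx : q ^ n ≠ 0 := pow_ne_zero _ hq0
  have key : grid q c n ^ 2 - c * (1 + q) ^ 2 =
      (1 - c * q ^ (2 * n)) * (1 - c * q ^ (2 * n + 2)) / (q ^ n) ^ 2 := by
    rw [grid]
    simp only [pow_add, pow_mul, pow_one, mul_comm 2 n]
    generalize q ^ n = x at *
    field_simp
    ring
  rw [key]
  exact div_ne_zero (mul_ne_zero (sub_ne_zero.2 h0.symm) (sub_ne_zero.2 h2.symm))
    (pow_ne_zero _ hx)

/-! ### The one-parameter family -/

theorem grid_add_sig {q α β s : ℂ} (hq0 : q ≠ 0) (hs : s ≠ 0) (n : ℕ) :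
    grid q (α * β) n + sig q α β s =
      (s - q ^ n) * (1 - α * β * q * s * q ^ n) / (q ^ n * s) := by
  have hx : q ^ n ≠ 0 := pow_ne_zero _ hq0
  simp only [grid, sig, pow_succ]
  field_simp
  ring

theorem racahC_mul_wilsonNu {q α β γ δ s : ℂ} {n : ℕ} (hβ : β ≠ 0) (hδ : δ ≠ 0)
    (h1 : β * δ * q ^ n ≠ 1) (h2 : α * β * s * q ^ n ≠ 1) :
    racahC q α β γ (α / (β * δ)) n * wilsonNu q α β δ s n =
      α / δ * ((s - q ^ n) / (1 - α * β * s * q ^ n)) * racahC q α β γ δ n := by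
  have d1 : 1 - β * δ * q ^ n ≠ 0 := sub_ne_zero.2 h1.symm
  have d2 : 1 - α * β * s * q ^ n ≠ 0 := sub_ne_zero.2 h2.symm
  have e : α / (β * δ) - α * q ^ n = α * (1 - β * δ * q ^ n) / (β * δ) := by field_simp
  rw [racahC, wilsonNu, e, racahC]
  generalize 1 - α * β * s * q ^ n = D2 at *
  generalize 1 - β * δ * q ^ n = D1 at *
  field_simp

theorem racahA_mul_wilsonNu {q α β γ δ s : ℂ} {n : ℕ} (hβ : β ≠ 0) (hδ : δ ≠ 0)
    (h2 : δ ≠ α * q ^ (n + 1)) (h3 : s ≠ q ^ (n + 1)) :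
    racahA q α β γ (α / (β * δ)) n * (1 / wilsonNu q α β δ s (n + 1)) =
      1 / (β * δ) * ((1 - α * β * s * q ^ (n + 1)) / (s - q ^ (n + 1))) * racahA q α β γ δ n := by
  have d2 : δ - α * q ^ (n + 1) ≠ 0 := sub_ne_zero.2 h2
  have d3 : s - q ^ (n + 1) ≠ 0 := sub_ne_zero.2 h3
  have e : 1 - β * (α / (β * δ)) * q ^ (n + 1) = (δ - α * q ^ (n + 1)) / δ := by field_simp
  rw [racahA, wilsonNu, e, racahA]
  generalize 1 - α * β * s * q ^ (n + 1) = D1 at *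
  generalize δ - α * q ^ (n + 1) = D2 at *
  generalize s - q ^ (n + 1) = D3 at *
  field_simp

/-- The factorisation of the coefficient of `V` in the first Heun relation, at neighbouring
points of the grid. -/
theorem wilson_heun_factor {q α β δ s : ℂ} (hq0 : q ≠ 0) (hq1 : 1 - q ≠ 0) (hq2 : 1 + q ≠ 0)
    (hα : α ≠ 0) (hβ : β ≠ 0) (hδ : δ ≠ 0) (hs : s ≠ 0) (N : ℕ) {x : ℂ} (hx : x ≠ 0) :
    let a := x⁻¹ + α * β * (x * q) + sig q α β s
    let b := (x * q)⁻¹ + α * β * (x * q * q) + sig q α β s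
    let h := wilsonHeun N q α β δ s
    h 2 + h 3 * a + h 4 * b = α * (s - x) * (s - q * x) / (δ * s * x) ∧
    h 2 + h 3 * b + h 4 * a =
      (1 - α * β * s * q * x) * (1 - α * β * s * q ^ 2 * x) / (β * δ * q * s * x) ∧
    h 7 + h 8 * a + h 9 * b =
      δ * (1 - α * β * s * q * x) * (1 - α * β * s * q ^ 2 * x) / (α * q * s * x) ∧
    h 7 + h 8 * b + h 9 * a = β * δ * (s - x) * (s - q * x) / (s * x) := by
  have hq3 : 1 - q ^ 2 ≠ 0 := by
    rw [show 1 - q ^ 2 = (1 - q) * (1 + q) by ring]; exact mul_ne_zero hq1 hq2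
  have e3 : (1 - q ^ 2)⁻¹ = (1 - q)⁻¹ * (1 + q)⁻¹ := by rw [← mul_inv]; congr 1; ring
  obtain ⟨p, hp⟩ : ∃ p, p = 1 + q := ⟨_, rfl⟩
  obtain ⟨r, hr⟩ : ∃ r, r = 1 - q := ⟨_, rfl⟩
  simp only [wilsonHeun, wilsonH2, wilsonH7, sig, Matrix.cons_val, div_eq_mul_inv, e3]
  rw [← hp] at hq2 ⊢
  rw [← hr] at hq1 ⊢
  refine ⟨?_, ?_, ?_, ?_⟩ <;>
  · field_simp
    rw [hp, hr]
    ring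

/-- Together with `racahB0_dual`: up to factors, the involution `δ ↦ α / (β δ)` exchanges the two
coefficients of the numerator of `B_n`, see `racahB_mul_grid`. -/
theorem psi_dual {q α β γ δ : ℂ} (hq2 : 1 + q ≠ 0) (hβ : β ≠ 0) (hδ : δ ≠ 0) :
    psi q α β γ (α / (β * δ)) = -racahB0 q α β γ δ / (β * δ * (1 + q)) := by
  simp only [psi, racahB0]
  field_simp
  ring

theorem racahB0_dual {q α β γ δ : ℂ} (hβ : β ≠ 0) (hδ : δ ≠ 0) :
    racahB0 q α β γ (α / (β * δ)) = -(1 + q) * (α / δ) * psi q α β γ δ := by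
  simp only [psi, racahB0]
  field_simp
  ring

/-- The diagonal part of the Heun relations of the family, as an identity of polynomials in the
grid variable `u`. -/
theorem wilson_heun_diag {q α β δ s : ℂ} (hq1 : 1 - q ≠ 0) (hq2 : 1 + q ≠ 0)
    (hα : α ≠ 0) (hβ : β ≠ 0) (hδ : δ ≠ 0) (hs : s ≠ 0) (N : ℕ) (u : ℂ) :
    let h := wilsonHeun N q α β δ s
    let σ := sig q α β s
    let b := racahB0 q α β (gam q N) δ + psi q α β (gam q N) δ * u
    let b' := racahB0 q α β (gam q N) (α / (β * δ)) + psi q α β (gam q N) (α / (β * δ)) * u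
    b' * (u + σ) = h 0 * (u ^ 2 - α * β * (1 + q) ^ 2) +
      (h 2 + h 3 * (u + σ) + h 4 * (u + σ)) * b ∧
    (u + σ) * b = h 5 * (u ^ 2 - α * β * (1 + q) ^ 2) +
      (h 7 + h 8 * (u + σ) + h 9 * (u + σ)) * b' := by
  have e3 : (1 - q ^ 2)⁻¹ = (1 - q)⁻¹ * (1 + q)⁻¹ := by rw [← mul_inv]; congr 1; ring
  obtain ⟨p, hp⟩ : ∃ p, p = 1 + q := ⟨_, rfl⟩
  obtain ⟨r, hr⟩ : ∃ r, r = 1 - q := ⟨_, rfl⟩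
  simp only [wilsonHeun, wilsonH0, wilsonH2, wilsonH5, wilsonH7, psi_dual hq2 hβ hδ,
    racahB0_dual hβ hδ, sig, Matrix.cons_val, e3, div_eq_mul_inv _ (1 - q ^ 2)]
  generalize psi q α β (gam q N) δ = b1
  generalize racahB0 q α β (gam q N) δ = b0
  rw [← hp] at hq2 ⊢
  rw [← hr] at hq1 ⊢
  refine ⟨?_, ?_⟩ <;>
  · field_simp
    rw [hp, hr]
    ring

theorem one_sub_ne_zero_of_pow {q : ℂ} (hq : ∀ k : ℕ, 0 < k → q ^ k ≠ 1) :
    1 - q ≠ 0 ∧ 1 + q ≠ 0 ∧ 1 - q ^ 2 ≠ 0 := by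
  have h1 : 1 - q ≠ 0 := sub_ne_zero.2 (by simpa using (hq 1 one_pos).symm)
  have h2 : 1 - q ^ 2 ≠ 0 := sub_ne_zero.2 (hq 2 two_pos).symm
  refine ⟨h1, fun h => h2 ?_, h2⟩
  linear_combination (1 - q) * h

theorem wilsonNu_ne_zero {N : ℕ} {q α β δ s : ℂ} (hβ : β ≠ 0) (h : IsRegular N q α β δ)
    (hs : IsAdmissible N q α β s) (i : ℕ) (h1 : 1 ≤ i) (hi : i ≤ N) :
    wilsonNu q α β δ s i ≠ 0 := by
  obtain ⟨h2, h3⟩ := hs.2 i h1 hi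
  exact div_ne_zero (mul_ne_zero (mul_ne_zero hβ (sub_ne_zero.2 h2)) (sub_ne_zero.2 (h.da i hi)))
    (mul_ne_zero (sub_ne_zero.2 (h.bd i hi).symm) (sub_ne_zero.2 h3.symm))

/-- The Heun relations of the family. -/
theorem heunRelations_wilson {N : ℕ} (z : Module.Basis (Fin (N + 1)) ℂ E) {q α β δ s : ℂ}
    (hq0 : q ≠ 0) (hq : ∀ k : ℕ, 0 < k → q ^ k ≠ 1) (hα : α ≠ 0) (hβ : β ≠ 0) (hδ : δ ≠ 0)
    (h : IsRegular N q α β δ) (hs : IsAdmissible N q α β s) :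
    HeunRelations (opRacah z q α β δ 1) (opWilson z q α β δ s) (opZ z q α β (sig q α β s))
      (wilsonHeun N q α β δ s) := by
  obtain ⟨hq1, hq2, -⟩ := one_sub_ne_zero_of_pow hq
  have hs0 := hs.1
  rw [heunRelations_iff]
  intro k i
  have e1 : wilsonHeun N q α β δ s 1 = 0 := rfl
  have e6 : wilsonHeun N q α β δ s 6 = 0 := rfl
  rw [opWilson, mat_opRacah, mat_opRacah]
  simp only [e1, e6, zero_mul, add_zero]
  -- the grid at neighbouring points
  have hg : ∀ n : ℕ, grid q (α * β) n = (q ^ n)⁻¹ + α * β * (q ^ n * q) := fun n => by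
    rw [grid, pow_succ]
  have hg' : ∀ n : ℕ, grid q (α * β) (n + 1) = (q ^ n * q)⁻¹ + α * β * (q ^ n * q * q) :=
    fun n => by rw [grid, pow_succ q (n + 1), pow_succ q n]
  by_cases h1 : (k : ℕ) = i + 1
  · have hki : k ≠ i := fun h => by subst h; omega
    obtain ⟨f1, -, f3, -⟩ := wilson_heun_factor hq0 hq1 hq2 hα hβ hδ hs0 N
      (pow_ne_zero (i : ℕ) hq0)
    rw [if_pos h1, if_pos h1, if_neg hki, if_neg hki, h1]
    have had := hs.2 (i + 1) (by omega) (by omega)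
    have d1 : 1 - α * β * s * q ^ ((i : ℕ) + 1) ≠ 0 := sub_ne_zero.2 had.2.symm
    rw [← hg, ← hg'] at f1 f3
    rw [racahC_mul_wilsonNu hβ hδ (h.bd _ (by omega)) had.2, f1, f3, grid_add_sig hq0 hs0,
      grid_add_sig hq0 hs0]
    have hx : q ^ (i : ℕ) ≠ 0 := pow_ne_zero _ hq0
    generalize racahC q α β (gam q N) δ (i + 1) = c
    rw [pow_succ] at *
    generalize q ^ (i : ℕ) = x at *
    obtain ⟨D, hD⟩ : ∃ D, D = 1 - α * β * s * (x * q) := ⟨_, rfl⟩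
    rw [← hD] at d1 ⊢
    have e : 1 - α * β * s * q * x = D := by rw [hD]; ring
    have e' : 1 - α * β * q * s * x = D := by rw [hD]; ring
    rw [e, e']
    constructor
    · simp; field_simp
    · simp; field_simp
  · by_cases h2 : k = i
    · subst h2
      have d0 := h.ab (2 * k) (by omega)
      have d1 := h.ab (2 * k + 1) (by omega)
      have d2 := h.ab (2 * k + 2) (by omega)
      rw [if_neg h1, if_neg h1, if_pos rfl, if_pos rfl, if_pos rfl, if_pos rfl]
      have hne := grid_sq_sub_ne_zero hq0 d0 d2
      obtain ⟨f1, f2⟩ := wilson_heun_diag hq1 hq2 hα hβ hδ hs0 N (grid q (α * β) k)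
      rw [← racahB_mul_grid hq0 d0 d1 d2, ← racahB_mul_grid hq0 d0 d1 d2] at f1 f2
      constructor
      · apply mul_right_cancel₀ hne
        linear_combination f1
      · apply mul_right_cancel₀ hne
        linear_combination f2
    · by_cases h3 : (k : ℕ) + 1 = i
      · obtain ⟨-, f2, -, f4⟩ := wilson_heun_factor hq0 hq1 hq2 hα hβ hδ hs0 N
          (pow_ne_zero (k : ℕ) hq0)
        rw [if_neg h1, if_neg h1, if_neg h2, if_neg h2, if_neg h2, if_neg h2, if_pos h3, if_pos h3,
          ← h3]
        have had := hs.2 (k + 1) (by omega) (by omega)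
        have d1 : s - q ^ ((k : ℕ) + 1) ≠ 0 := sub_ne_zero.2 had.1
        rw [← hg, ← hg'] at f2 f4
        rw [racahA_mul_wilsonNu hβ hδ (h.da _ (by omega)) had.1, f2, f4,
          grid_add_sig hq0 hs0, grid_add_sig hq0 hs0]
        have hx : q ^ (k : ℕ) ≠ 0 := pow_ne_zero _ hq0
        generalize racahA q α β (gam q N) δ k = c
        rw [pow_succ] at *
        generalize q ^ (k : ℕ) = x at *
        obtain ⟨D, hD⟩ : ∃ D, D = s - x * q := ⟨_, rfl⟩
        rw [← hD] at d1 ⊢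
        have e : s - q * x = D := by rw [hD]; ring
        rw [e]
        simp only [Pi.one_apply, zero_add]
        constructor
        · field_simp
        · field_simp
      · simp [h1, h2, h3]

theorem isHeunParam_wilson (N : ℕ) {q α β δ s : ℂ} (hq1 : 1 - q ≠ 0) (hq2 : 1 + q ≠ 0)
    (hα : α ≠ 0) (hβ : β ≠ 0) (hδ : δ ≠ 0) (hs : s ≠ 0) :
    IsHeunParam q α β (sig q α β s) (wilsonHeun N q α β δ s) s (1 / (α * β * s))
      (1 / (β * δ * s)) s := by
  have e3 : (1 - q ^ 2)⁻¹ = (1 - q)⁻¹ * (1 + q)⁻¹ := by rw [← mul_inv]; congr 1; ring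
  refine ⟨hs, hs, one_div_ne_zero (mul_ne_zero (mul_ne_zero hα hβ) hs), rfl, ?_, rfl, rfl, ?_, ?_⟩
  all_goals
    obtain ⟨p, hp⟩ : ∃ p, p = 1 + q := ⟨_, rfl⟩
    obtain ⟨r, hr⟩ : ∃ r, r = 1 - q := ⟨_, rfl⟩
    simp only [wilsonHeun, wilsonH2, wilsonH7, sig, Matrix.cons_val, e3,
      div_eq_mul_inv _ (1 - q ^ 2)]
    rw [← hp] at hq2 ⊢
    rw [← hr] at hq1 ⊢
    field_simp
    simp only [hp, hr]
    ring

/-- The two forms of the Heun relations, with and without `q`-commutators. -/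
theorem wilsonHeunRelations_of_heunRelations {N : ℕ} {q α β δ s : ℂ} {V W Z : Module.End ℂ E}
    (h : HeunRelations V W Z (wilsonHeun N q α β δ s)) : WilsonHeunRelations N q α β δ s V W Z := by
  obtain ⟨h1, h2⟩ := h
  constructor
  · rw [h1]
    simp only [wilsonHeun, Matrix.cons_val, qComm]
    module
  · rw [h2]
    simp only [wilsonHeun, Matrix.cons_val, qComm]
    module

/-- An operator given by the first Heun relation is tridiagonal wherever `V` is diagonal and `Z`
is tridiagonal. -/
theorem isTridiagonal_of_heun {d : ℕ} {b : Module.Basis (Fin d) ℂ E} {V Z X : Module.End ℂ E}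
    {c0 c1 c2 c3 c4 : ℂ} (hX : X = c0 • (1 : Module.End ℂ E) + c1 • Z + c2 • V + c3 • (V * Z) +
      c4 • (Z * V)) (hV : (mat b V).IsDiag) (hZ : IsTridiagonal (mat b Z)) :
    IsTridiagonal (mat b X) := by
  intro i j h1 h2 h3
  rw [hX]
  simp only [mat_add, mat_smul, mat_mul_of_isDiag_left hV, mat_mul_of_isDiag_right hV, mat_one,
    if_neg h1, hV h1, hZ i j h1 h2 h3]
  ring

/-- The off-diagonal entries in an eigenbasis of `V` of an operator given by the first Heun
relation. -/
theorem mat_heun_of_ne {d : ℕ} {b : Module.Basis (Fin d) ℂ E} {V Z X : Module.End ℂ E}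
    {c0 c1 c2 c3 c4 : ℂ} (hX : X = c0 • (1 : Module.End ℂ E) + c1 • Z + c2 • V + c3 • (V * Z) +
      c4 • (Z * V)) (hV : (mat b V).IsDiag) {i j : Fin d} (hij : i ≠ j) :
    mat b X i j = (c1 + c3 * mat b V i i + c4 * mat b V j j) * mat b Z i j := by
  rw [hX]
  simp only [mat_add, mat_smul, mat_mul_of_isDiag_left hV, mat_mul_of_isDiag_right hV, mat_one,
    if_neg hij, hV hij]
  ring

theorem isIrredLeonardTrio_wilson {N : ℕ} (z : Module.Basis (Fin (N + 1)) ℂ E) {q α β δ s : ℂ}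
    (hq0 : q ≠ 0) (hq : ∀ k : ℕ, 0 < k → q ^ k ≠ 1) (hα : α ≠ 0) (hβ : β ≠ 0) (hδ : δ ≠ 0)
    (h : IsRegular N q α β δ) (h' : IsRegular N q α β (α / (β * δ)))
    (hs : IsAdmissible N q α β s) :
    IsIrredLeonardTrio N (opRacah z q α β δ 1) (opWilson z q α β δ s)
      (opZ z q α β (sig q α β s)) := by
  have hν := wilsonNu_ne_zero hβ h hs
  have h1 : ∀ i, 1 ≤ i → i ≤ N → (1 : ℕ → ℂ) i ≠ 0 := fun _ _ _ => one_ne_zero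
  obtain ⟨r1, r2⟩ := heunRelations_wilson z hq0 hq hα hβ hδ h hs
  obtain ⟨v, hv, -, hv'⟩ := h.exists_dual_basis hq0 hq z h1 (sig q α β s)
  obtain ⟨w, hw, -, hw'⟩ := h'.exists_dual_basis hq0 hq z hν (sig q α β s)
  exact ⟨⟨v, hv.1, isTridiagonal_of_heun r1 hv.1 hv'.1, hv'⟩,
    ⟨w, hw.1, isTridiagonal_of_heun r2 hw.1 hw'.1, hw'⟩,
    ⟨z, mat_opZ_isDiag z q α β _, h.isIrredTridiagonal hq0 hq z h1,
      h'.isIrredTridiagonal hq0 hq z hν⟩⟩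

/-! ### Non-degeneracy of the family -/

theorem finite_setOf_quadratic {a b c : ℂ} (hc : c ≠ 0) :
    {s : ℂ | a * s ^ 2 + b * s + c = 0}.Finite := by
  let p : Polynomial ℂ :=
    Polynomial.C a * Polynomial.X ^ 2 + Polynomial.C b * Polynomial.X + Polynomial.C c
  have hp : p ≠ 0 := by
    intro h
    have := congrArg (Polynomial.eval 0) h
    simp [p, hc] at this
  refine (p.finite_setOfPred_isRoot hp).subset fun s hs => ?_
  simpa [p, Polynomial.IsRoot.def] using hs

theorem finite_not_isAdmissible (N : ℕ) (q : ℂ) {α β : ℂ} :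
    {s : ℂ | ¬ IsAdmissible N q α β s}.Finite := by
  have hlin : ∀ c : ℂ, {s : ℂ | c * s = 1}.Finite := fun c =>
    (finite_setOf_quadratic (a := 0) (b := c) (c := -1) (by norm_num)).subset fun s hs => by
      simp only [Set.mem_ofPred_eq] at hs ⊢
      rw [hs]; ring
  refine (((Set.finite_singleton (0 : ℂ)).union
    ((Finset.range (N + 1)).finite_toSet.biUnion fun i _ => Set.finite_singleton (q ^ i))).union
    ((Finset.range (N + 1)).finite_toSet.biUnion fun i _ => hlin (α * β * q ^ i))).subset ?_
  intro s hs
  simp only [Set.mem_ofPred_eq, IsAdmissible, not_and_or, not_forall, not_not] at hs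
  rcases hs with hs | ⟨i, -, hi, hs⟩
  · exact Or.inl (Or.inl hs)
  · have hiN : i ∈ ((Finset.range (N + 1) : Finset ℕ) : Set ℕ) := by
      simp only [Finset.coe_range, Set.mem_Iio]; omega
    rcases hs with hs | hs
    · exact Or.inl (Or.inr (Set.mem_biUnion hiN hs))
    · refine Or.inr (Set.mem_biUnion hiN ?_)
      simp only [Set.mem_ofPred_eq]
      rw [← hs]; ring

theorem grid_succ_sub (q c : ℂ) (hq0 : q ≠ 0) (n : ℕ) :
    grid q c (n + 1) - q * grid q c n = (q ^ (n + 1))⁻¹ * (1 - q ^ 2) := by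
  have hx : q ^ n ≠ 0 := pow_ne_zero _ hq0
  simp only [grid, pow_succ]
  field_simp
  ring

/-- Each non-degeneracy condition excludes only finitely many `s`: multiplied by `s`, it states
that a quadratic polynomial in `s` with nonzero constant term does not vanish. -/
theorem finite_wilson_degenerate {q α β δ : ℂ} (hq0 : q ≠ 0) (hq3 : 1 - q ^ 2 ≠ 0)
    (hα : α ≠ 0) (hβ : β ≠ 0) (hδ : δ ≠ 0) (N : ℕ) (c c' : ℂ) (n : ℕ) (y : ℂ) :
    {s : ℂ | s ≠ 0 ∧ wilsonHeun N q α β δ s 3 * grid q c (n + 1) +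
      wilsonHeun N q α β δ s 4 * grid q c n - y = 0}.Finite ∧
    {s : ℂ | s ≠ 0 ∧ wilsonHeun N q α β δ s 8 * grid q c' n +
      wilsonHeun N q α β δ s 9 * grid q c' (n + 1) - y = 0}.Finite := by
  have hx : (q ^ (n + 1))⁻¹ * (1 - q ^ 2) ≠ 0 :=
    mul_ne_zero (inv_ne_zero (pow_ne_zero _ hq0)) hq3
  obtain ⟨r, hr⟩ : ∃ r, r = 1 - q ^ 2 := ⟨_, rfl⟩
  constructor
  · have e := grid_succ_sub q c hq0 n
    refine (finite_setOf_quadratic (a := α * q * (grid q c n - q * grid q c (n + 1)) /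
      (δ * (1 - q ^ 2))) (b := -y)
      (c := (grid q c (n + 1) - q * grid q c n) / (β * δ * (1 - q ^ 2))) ?_).subset ?_
    · rw [e]
      exact div_ne_zero hx (mul_ne_zero (mul_ne_zero hβ hδ) hq3)
    · rintro s ⟨hs, h⟩
      simp only [Set.mem_ofPred_eq, wilsonHeun, Matrix.cons_val] at h ⊢
      rw [← hr] at h hq3 ⊢
      have h2 : s * ((1 / (β * δ * s) - q * (α * q * s / δ)) / r * grid q c (n + 1) +
        (α * q * s / δ - q * (1 / (β * δ * s))) / r * grid q c n - y) = 0 := by rw [h, mul_zero]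
      rw [← h2]
      field_simp
      ring
  · have e := grid_succ_sub q c' hq0 n
    refine (finite_setOf_quadratic (a := q * β * δ * (grid q c' n - q * grid q c' (n + 1)) /
      (1 - q ^ 2)) (b := -y)
      (c := δ * (grid q c' (n + 1) - q * grid q c' n) / (α * (1 - q ^ 2))) ?_).subset ?_
    · rw [e]
      exact div_ne_zero (mul_ne_zero hδ hx) (mul_ne_zero hα hq3)
    · rintro s ⟨hs, h⟩
      simp only [Set.mem_ofPred_eq, wilsonHeun, Matrix.cons_val] at h ⊢
      rw [← hr] at h hq3 ⊢
      have h2 : s * ((q * β * δ * s - q * (δ / (s * α))) / r * grid q c' n +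
        (δ / (s * α) - q * (q * β * δ * s)) / r * grid q c' (n + 1) - y) = 0 := by
        rw [h, mul_zero]
      rw [← h2]
      field_simp
      ring

theorem exists_finite_nondeg {N : ℕ} (z : Module.Basis (Fin (N + 1)) ℂ E) {q α β δ : ℂ}
    (hq0 : q ≠ 0) (hq : ∀ k : ℕ, 0 < k → q ^ k ≠ 1) (hα : α ≠ 0) (hβ : β ≠ 0) (hδ : δ ≠ 0)
    (h : IsRegular N q α β δ) (h' : IsRegular N q α β (α / (β * δ))) :
    ∃ F : Set ℂ, F.Finite ∧ ∀ s : ℂ, s ∉ F → IsAdmissible N q α β s ∧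
      IsNondegLeonardTrio N (opRacah z q α β δ 1) (opWilson z q α β δ s)
        (opZ z q α β (sig q α β s)) := by
  obtain ⟨-, -, hq3⟩ := one_sub_ne_zero_of_pow hq
  let c := gam q N * δ
  let c' := gam q N * (α / (β * δ))
  have hfin := fun n y => finite_wilson_degenerate hq0 hq3 hα hβ hδ N c c' n y
  refine ⟨{s | ¬ IsAdmissible N q α β s} ∪
    ((⋃ n : Fin N, ⋃ x : Fin (N + 1), {s : ℂ | s ≠ 0 ∧
      wilsonHeun N q α β δ s 3 * grid q c (n + 1) + wilsonHeun N q α β δ s 4 * grid q c n -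
        grid q c' x = 0}) ∪
    (⋃ n : Fin (N + 1), ⋃ x : Fin N, {s : ℂ | s ≠ 0 ∧
      wilsonHeun N q α β δ s 8 * grid q c' x + wilsonHeun N q α β δ s 9 * grid q c' (x + 1) -
        grid q c n = 0})), ?_, ?_⟩
  · exact (finite_not_isAdmissible N q).union
      ((Set.finite_iUnion fun n : Fin N => Set.finite_iUnion fun x => (hfin n _).1).union
        (Set.finite_iUnion fun n => Set.finite_iUnion fun x : Fin N => (hfin x _).2))
  intro s hs
  simp only [Set.mem_union, Set.mem_iUnion, Set.mem_ofPred_eq, not_or, not_not, not_exists,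
    not_and] at hs
  obtain ⟨had, hc1, hc2⟩ := hs
  refine ⟨had, ?_⟩
  have hν := wilsonNu_ne_zero hβ h had
  have h1 : ∀ i, 1 ≤ i → i ≤ N → (1 : ℕ → ℂ) i ≠ 0 := fun _ _ _ => one_ne_zero
  obtain ⟨r1, r2⟩ := heunRelations_wilson z hq0 hq hα hβ hδ h had
  obtain ⟨v, hv, hvd, hvZ⟩ := h.exists_dual_basis hq0 hq z h1 (sig q α β s)
  obtain ⟨w, hw, hwd, hwZ⟩ := h'.exists_dual_basis hq0 hq z hν (sig q α β s)
  refine ⟨v, w, ⟨hv, hvZ.1, isTridiagonal_of_heun r1 hv.1 hvZ.1, hw, hwZ.1,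
    isTridiagonal_of_heun r2 hw.1 hwZ.1⟩, ?_, ?_⟩
  · intro n x
    have hne : n.succ ≠ n.castSucc := n.castSucc_lt_succ.ne'
    rw [mat_heun_of_ne r1 hv.1 hne, opWilson, hwd, hvd, hvd, ← sub_mul]
    refine mul_ne_zero ?_ (hvZ.2 n.castSucc n.succ (by simp)).2
    have := hc1 n x had.1
    intro h0
    apply this
    rw [← h0]
    simp [wilsonHeun, c, c']
  · intro n x
    have hne : x.castSucc ≠ x.succ := x.castSucc_lt_succ.ne
    rw [mat_heun_of_ne r2 hw.1 hne, opWilson, hwd, hwd, hvd, ← sub_mul]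
    refine mul_ne_zero ?_ (hwZ.2 x.castSucc x.succ (by simp)).1
    have := hc2 n x had.1
    intro h0
    apply this
    rw [← h0]
    simp [wilsonHeun, c, c']

/-! ### Polynomial identities from interpolation -/

/-- A cubic polynomial with four different zeros vanishes. -/
theorem cubic_interpolation {c0 c1 c2 c3 : ℂ} {y : ℕ → ℂ}
    (hy : ∀ i < 4, ∀ j < 4, i ≠ j → y i ≠ y j)
    (h : ∀ i < 4, c0 + c1 * y i + c2 * y i ^ 2 + c3 * y i ^ 3 = 0) :
    c0 = 0 ∧ c1 = 0 ∧ c2 = 0 ∧ c3 = 0 := by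
  have d01 := sub_ne_zero.2 (hy 0 (by omega) 1 (by omega) (by omega))
  have d02 := sub_ne_zero.2 (hy 0 (by omega) 2 (by omega) (by omega))
  have d03 := sub_ne_zero.2 (hy 0 (by omega) 3 (by omega) (by omega))
  have d12 := sub_ne_zero.2 (hy 1 (by omega) 2 (by omega) (by omega))
  have d13 := sub_ne_zero.2 (hy 1 (by omega) 3 (by omega) (by omega))
  have d23 := sub_ne_zero.2 (hy 2 (by omega) 3 (by omega) (by omega))
  have h0 := h 0 (by omega)
  have h1 := h 1 (by omega)
  have h2 := h 2 (by omega)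
  have h3 := h 3 (by omega)
  generalize y 0 = a at *
  generalize y 1 = b at *
  generalize y 2 = c at *
  generalize y 3 = d at *
  -- divided differences
  have e01 : c1 + c2 * (a + b) + c3 * (a ^ 2 + a * b + b ^ 2) = 0 := by
    apply mul_left_cancel₀ d01; linear_combination h0 - h1
  have e02 : c1 + c2 * (a + c) + c3 * (a ^ 2 + a * c + c ^ 2) = 0 := by
    apply mul_left_cancel₀ d02; linear_combination h0 - h2
  have e03 : c1 + c2 * (a + d) + c3 * (a ^ 2 + a * d + d ^ 2) = 0 := by
    apply mul_left_cancel₀ d03; linear_combination h0 - h3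
  have f12 : c2 + c3 * (a + b + c) = 0 := by
    apply mul_left_cancel₀ d12; linear_combination e01 - e02
  have f13 : c2 + c3 * (a + b + d) = 0 := by
    apply mul_left_cancel₀ d13; linear_combination e01 - e03
  have g : c3 = 0 := by
    apply mul_left_cancel₀ d23; linear_combination f12 - f13
  have g2 : c2 = 0 := by linear_combination f12 - (a + b + c) * g
  have g1 : c1 = 0 := by linear_combination e01 - (a + b) * g2 - (a ^ 2 + a * b + b ^ 2) * g
  exact ⟨by linear_combination h0 - a * g1 - a ^ 2 * g2 - a ^ 3 * g, g1, g2, g⟩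

/-- If the product of two quadratic polynomials has the zeros `a, b, c, d`, then the zeros of the
first factor are two of them. -/
theorem exists_roots_of_mul_eq {l0 l1 l2 m0 m1 m2 e a b c d : ℂ} (he : e ≠ 0)
    (h : ∀ x : ℂ, x ≠ 0 → (l0 + l1 * x + l2 * x ^ 2) * (m0 + m1 * x + m2 * x ^ 2) =
      e * ((x - a) * (x - b) * (x - c) * (x - d))) :
    l2 ≠ 0 ∧ ∃ x y, l1 = -l2 * (x + y) ∧ l0 = l2 * (x * y) ∧
      (({x, y} : Multiset ℂ) = {a, b} ∨ ({x, y} : Multiset ℂ) = {a, c} ∨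
      ({x, y} : Multiset ℂ) = {a, d} ∨ ({x, y} : Multiset ℂ) = {b, c} ∨
      ({x, y} : Multiset ℂ) = {b, d} ∨ ({x, y} : Multiset ℂ) = {c, d}) := by
  open Polynomial in
  let P : ℂ → ℂ → ℂ → ℂ[X] := fun u v w => C u + C v * X + C w * X ^ 2
  have hpoly : P l0 l1 l2 * P m0 m1 m2 =
      C e * ((X - C a) * (X - C b) * (X - C c) * (X - C d)) := by
    refine eq_of_infinite_eval_eq _ _ ((Set.finite_singleton (0 : ℂ)).infinite_compl.mono ?_)
    intro x hx
    have := h x (by simpa using hx)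
    simpa [P] using this
  have hlead : l2 * m2 = e := by
    have h4 := congrArg (fun p => coeff p 4) hpoly
    have e1 : P l0 l1 l2 * P m0 m1 m2 = C (l0 * m0) + C (l0 * m1 + l1 * m0) * X +
        C (l0 * m2 + l1 * m1 + l2 * m0) * X ^ 2 + C (l1 * m2 + l2 * m1) * X ^ 3 +
        C (l2 * m2) * X ^ 4 := by
      simp only [P, map_mul, map_add]; ring
    have e2 : C e * ((X - C a) * (X - C b) * (X - C c) * (X - C d)) =
        C (e * (a * b * c * d)) - C (e * (a * b * c + a * b * d + a * c * d + b * c * d)) * X +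
        C (e * (a * b + a * c + a * d + b * c + b * d + c * d)) * X ^ 2 -
        C (e * (a + b + c + d)) * X ^ 3 + C e * X ^ 4 := by
      simp only [map_mul, map_add]; ring
    rw [e1, e2] at h4
    simpa only [coeff_add, coeff_sub, coeff_C_mul, coeff_X, coeff_X_pow, coeff_C,
      OfNat.ofNat_ne_zero, OfNat.one_ne_ofNat, if_true, if_false, mul_zero, zero_add, add_zero,
      sub_zero, mul_one, Nat.reduceEqDiff] using h4
  have hl2 : l2 ≠ 0 := fun h0 => he (by rw [← hlead, h0, zero_mul])
  have hm2 : m2 ≠ 0 := fun h0 => he (by rw [← hlead, h0, mul_zero])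
  have split : ∀ {u v w : ℂ}, w ≠ 0 → ∃ x y, v = -w * (x + y) ∧ u = w * (x * y) ∧
      (P u v w).roots = {x, y} := by
    intro u v w hw
    obtain ⟨t, ht⟩ := IsAlgClosed.exists_pow_nat_eq (v ^ 2 - 4 * u * w) (n := 2) (by omega)
    have h1 : v = -w * ((-v + t) / (2 * w) + (-v - t) / (2 * w)) := by field_simp; ring
    have h2 : u = w * ((-v + t) / (2 * w) * ((-v - t) / (2 * w))) := by
      field_simp; linear_combination ht
    refine ⟨_, _, h1, h2, ?_⟩
    have : P u v w = C w * ((X - C ((-v + t) / (2 * w))) * (X - C ((-v - t) / (2 * w)))) := by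
      generalize (-v + t) / (2 * w) = x at *
      generalize (-v - t) / (2 * w) = y at *
      simp only [P, h1, h2, map_mul, map_add, map_neg]; ring
    rw [this, roots_C_mul _ hw, roots_mul (mul_ne_zero (X_sub_C_ne_zero _) (X_sub_C_ne_zero _)),
      roots_X_sub_C, roots_X_sub_C]
    rfl
  obtain ⟨x, y, hx, hy, hr⟩ := split (u := l0) (v := l1) hl2
  obtain ⟨x', y', -, -, hr'⟩ := split (u := m0) (v := m1) hm2
  refine ⟨hl2, x, y, hx, hy, ?_⟩
  have hne : C e * ((X - C a) * (X - C b) * (X - C c) * (X - C d)) ≠ 0 := by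
    simp [he, X_sub_C_ne_zero]
  have hroots := congrArg roots hpoly
  rw [roots_mul (hpoly ▸ hne), hr, hr', roots_C_mul _ he, roots_mul, roots_mul, roots_mul,
    roots_X_sub_C, roots_X_sub_C, roots_X_sub_C, roots_X_sub_C] at hroots
  rotate_left
  · exact mul_ne_zero (X_sub_C_ne_zero _) (X_sub_C_ne_zero _)
  · exact mul_ne_zero (mul_ne_zero (X_sub_C_ne_zero _) (X_sub_C_ne_zero _)) (X_sub_C_ne_zero _)
  · exact mul_ne_zero (mul_ne_zero (mul_ne_zero (X_sub_C_ne_zero _) (X_sub_C_ne_zero _))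
      (X_sub_C_ne_zero _)) (X_sub_C_ne_zero _)
  have hroots' : x ::ₘ y ::ₘ {x', y'} = a ::ₘ b ::ₘ c ::ₘ {d} := by
    simpa only [Multiset.insert_eq_cons, Multiset.cons_add, Multiset.singleton_add] using hroots
  have comm : ∀ u v : ℂ, ({u, v} : Multiset ℂ) = {v, u} := fun u v => Multiset.pair_comm u v
  have pick : ∀ {t u v w : ℂ}, x = t → x ::ₘ y ::ₘ {x', y'} = t ::ₘ u ::ₘ v ::ₘ {w} →
      ({x, y} : Multiset ℂ) = {t, u} ∨ ({x, y} : Multiset ℂ) = {t, v} ∨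
        ({x, y} : Multiset ℂ) = {t, w} := by
    intro t u v w hxt heq
    subst hxt
    rw [Multiset.cons_inj_right] at heq
    have : y ∈ u ::ₘ v ::ₘ ({w} : Multiset ℂ) := heq ▸ Multiset.mem_cons_self _ _
    simp only [Multiset.mem_cons, Multiset.mem_singleton] at this
    rcases this with rfl | rfl | rfl <;> simp
  have hmem : x ∈ a ::ₘ b ::ₘ c ::ₘ ({d} : Multiset ℂ) := hroots' ▸ Multiset.mem_cons_self _ _
  simp only [Multiset.mem_cons, Multiset.mem_singleton] at hmem
  rcases hmem with hx | hx | hx | hx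
  · rcases pick hx hroots' with h | h | h <;> simp [h]
  · have := pick (t := b) (u := a) (v := c) (w := d) hx (by
      rw [hroots', Multiset.cons_swap])
    rw [comm b a] at this
    rcases this with h | h | h <;> simp [h]
  · have := pick (t := c) (u := a) (v := b) (w := d) hx (by
      rw [hroots', Multiset.cons_swap b c, Multiset.cons_swap a c])
    rw [comm c a, comm c b] at this
    rcases this with h | h | h <;> simp [h]
  · have := pick (t := d) (u := a) (v := b) (w := c) hx (by
      rw [hroots', show ({d} : Multiset ℂ) = d ::ₘ 0 from rfl, Multiset.cons_swap c d,
        Multiset.cons_swap b d, Multiset.cons_swap a d]; rfl)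
    rw [comm d a, comm d b, comm d c] at this
    rcases this with h | h | h <;> simp [h]

/-! ### Matching of parameters -/

/-- The product of opposite off-diagonal entries of the `q`-Racah operator, as a function of
`Y = X⁻¹ + α β X` with `X = q^{i+1}`. The first factor depends on `α` and `β` only through
`α β`. -/
theorem racahC_mul_racahA {q α β γ δ : ℂ} (hq0 : q ≠ 0) (i : ℕ) :
    racahC q α β γ δ (i + 1) * racahA q α β γ δ i =
      q * (1 - q ^ (i + 1)) * (γ - α * β * q ^ (i + 1)) * (1 - α * β * q ^ (i + 1)) *
        (1 - γ * q ^ (i + 1)) * (q ^ (i + 1)) ^ 2 /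
        ((1 - α * β * q ^ (2 * (i + 1))) * (1 - α * β * q ^ (2 * (i + 1) + 1)) *
          ((1 - α * β * q ^ (2 * i + 1)) * (1 - α * β * q ^ (2 * i + 2)))) *
        ((((q ^ (i + 1))⁻¹ + α * β * q ^ (i + 1)) - (α + β)) *
          (δ * ((q ^ (i + 1))⁻¹ + α * β * q ^ (i + 1)) - (α + β * δ ^ 2))) := by
  have hx : q ^ (i + 1) ≠ 0 := pow_ne_zero _ hq0
  have e1 : (q ^ (i + 1))⁻¹ + α * β * q ^ (i + 1) - (α + β) =
      (1 - α * q ^ (i + 1)) * (1 - β * q ^ (i + 1)) / q ^ (i + 1) := by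
    field_simp; ring
  have e2 : δ * ((q ^ (i + 1))⁻¹ + α * β * q ^ (i + 1)) - (α + β * δ ^ 2) =
      (1 - β * δ * q ^ (i + 1)) * (δ - α * q ^ (i + 1)) / q ^ (i + 1) := by
    field_simp; ring
  rw [e1, e2, racahC, racahA, div_mul_div_comm, div_mul_eq_mul_div]
  congr 1
  field_simp

/-- The two coefficients of the numerator of `B_n` are generically independent of their images
under the involution of `psi_dual`. -/
theorem racahB0_sq_sub (q α β γ δ : ℂ) :
    racahB0 q α β γ δ ^ 2 - α * β * (1 + q) ^ 2 * psi q α β γ δ ^ 2 =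
      (1 + q) ^ 2 * q ^ 2 * ((β - α) * (α - β * δ ^ 2) * (1 - α * β) * (α * β - γ ^ 2)) := by
  simp only [racahB0, psi]
  ring

/-- The solutions `(α', β', δ')` of the equation
`(Y - (α' + β')) (δ' Y - (α' + β' δ'²)) = ρ (Y - (α + β)) (δ Y - (α + β δ²))` with
`α' β' = α β`. There are eight; for four of them the pair of coefficients of the numerator of `B_n`
is rescaled, for the other four its entries are also exchanged. -/
theorem match_parameters {q α β γ δ α' β' δ' ρ : ℂ} (hq2 : 1 + q ≠ 0) (hα : α ≠ 0) (hβ : β ≠ 0)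
    (hδ : δ ≠ 0) (hρ : ρ ≠ 0) (hab : α' * β' = α * β) (e2 : δ' = ρ * δ)
    (e1 : δ' * (α' + β') + (α' + β' * δ' ^ 2) = ρ * (δ * (α + β) + (α + β * δ ^ 2)))
    (e0 : (α' + β') * (α' + β' * δ' ^ 2) = ρ * ((α + β) * (α + β * δ ^ 2))) :
    (∃ τ, τ ≠ 0 ∧ ((τ = 1 ∧ δ' = δ) ∨ (τ = 1 / δ ∧ δ' = 1 / δ)) ∧
      psi q α' β' γ δ' = τ * psi q α β γ δ ∧ racahB0 q α' β' γ δ' = τ * racahB0 q α β γ δ) ∨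
    (∃ η, η ≠ 0 ∧ ((η = 1 / (β * δ) ∧ δ' = α / (β * δ) ∧ (α' = α ∨ α' = α / δ)) ∨
        (η = 1 / α ∧ δ' = β * δ / α ∧ (α' = β ∨ α' = β * δ))) ∧
      psi q α' β' γ δ' = -η * racahB0 q α β γ δ / (1 + q) ∧
      racahB0 q α' β' γ δ' = -(1 + q) * (α * β) * η * psi q α β γ δ) := by
  have hβδ : β * δ ≠ 0 := mul_ne_zero hβ hδ
  have hroot : (α' + β' - (α + β)) * (δ * (α' + β') - (α + β * δ ^ 2)) = 0 := by
    apply mul_left_cancel₀ hρ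
    linear_combination (-(α' + β') ^ 2) * e2 + (α' + β') * e1 - e0
  -- the two values of `δ'` that are compatible with a given choice of `(α', β')`
  have comp : α + β = α' + β' ∨ δ * (α' + β') = α + β * δ ^ 2 := by
    rcases mul_eq_zero.1 hroot with h | h
    · left; linear_combination -h
    · right; linear_combination h
  rcases comp with h | h
  · have h1 : δ * (α' + β' * δ' ^ 2) = δ' * (α + β * δ ^ 2) := by
      linear_combination δ * e1 - (α + β * δ ^ 2) * e2 - δ * (α + β) * e2 + δ * δ' * h
    have h2 : (α' - α) * (α' - β) = 0 := by linear_combination -hab - α' * h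
    rcases mul_eq_zero.1 h2 with h3 | h3
    · obtain rfl : α' = α := by linear_combination h3
      obtain rfl : β' = β := by linear_combination -h
      have h4 : (δ' - δ) * (β' * δ * δ' - α') = 0 := by linear_combination h1
      rcases mul_eq_zero.1 h4 with h5 | h5
      · obtain rfl : δ' = δ := by linear_combination h5
        exact Or.inl ⟨1, one_ne_zero, Or.inl ⟨rfl, rfl⟩, by ring, by ring⟩
      · obtain rfl : δ' = α' / (β' * δ) := by field_simp; linear_combination h5
        refine Or.inr ⟨1 / (β' * δ), one_div_ne_zero hβδ, Or.inl ⟨rfl, rfl, Or.inl rfl⟩, ?_, ?_⟩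
        · simp only [psi, racahB0]; field_simp; ring
        · simp only [psi, racahB0]; field_simp; ring
    · obtain rfl : α' = β := by linear_combination h3
      obtain rfl : β' = α := by linear_combination -h
      have h4 : (δ * δ' - 1) * (β' * δ' - α' * δ) = 0 := by linear_combination h1
      rcases mul_eq_zero.1 h4 with h5 | h5
      · obtain rfl : δ' = 1 / δ := by field_simp; linear_combination h5
        refine Or.inl ⟨1 / δ, one_div_ne_zero hδ, Or.inr ⟨rfl, rfl⟩, ?_, ?_⟩
        · simp only [psi]; field_simp; ring
        · simp only [racahB0]; field_simp; ring
      · obtain rfl : δ' = α' * δ / β' := by field_simp; linear_combination h5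
        refine Or.inr ⟨1 / β', one_div_ne_zero hα, Or.inr ⟨rfl, rfl, Or.inl rfl⟩, ?_, ?_⟩
        · simp only [psi, racahB0]; field_simp; ring
        · simp only [psi, racahB0]; field_simp; ring
  · have h1 : δ' * (α + β) = α' + β' * δ' ^ 2 := by
      apply mul_left_cancel₀ hδ
      linear_combination -δ * e1 + δ' * h + δ * (α + β) * e2 + (α + β * δ ^ 2) * e2
    have h2 : (δ * α' - α) * (α' - β * δ) = 0 := by linear_combination -δ * hab + α' * h
    rcases mul_eq_zero.1 h2 with h3 | h3
    · obtain rfl : α' = α / δ := by field_simp; linear_combination h3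
      obtain rfl : β' = β * δ := by
        field_simp at hab
        linear_combination hab
      have h4 : (δ * δ' - 1) * (β * δ * δ' - α) = 0 := by
        field_simp at h1
        linear_combination -h1
      rcases mul_eq_zero.1 h4 with h5 | h5
      · obtain rfl : δ' = 1 / δ := by field_simp; linear_combination h5
        refine Or.inl ⟨1 / δ, one_div_ne_zero hδ, Or.inr ⟨rfl, rfl⟩, ?_, ?_⟩
        · simp only [psi]; field_simp; ring
        · simp only [racahB0]; field_simp; ring
      · obtain rfl : δ' = α / (β * δ) := by field_simp; linear_combination h5
        refine Or.inr ⟨1 / (β * δ), one_div_ne_zero hβδ, Or.inl ⟨rfl, rfl, Or.inr rfl⟩, ?_, ?_⟩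
        · simp only [psi, racahB0]; field_simp; ring
        · simp only [psi, racahB0]; field_simp; ring
    · obtain rfl : α' = β * δ := by linear_combination h3
      obtain rfl : β' = α / δ := by
        apply mul_left_cancel₀ hβδ
        rw [hab]
        field_simp
      have h4 : (δ' - δ) * (α * δ' - β * δ) = 0 := by
        field_simp at h1
        linear_combination -h1
      rcases mul_eq_zero.1 h4 with h5 | h5
      · obtain rfl : δ' = δ := by linear_combination h5
        refine Or.inl ⟨1, one_ne_zero, Or.inl ⟨rfl, rfl⟩, ?_, ?_⟩
        · simp only [psi]; field_simp; ring
        · simp only [racahB0]; field_simp; ring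
      · obtain rfl : δ' = β * δ / α := by field_simp; linear_combination h5
        refine Or.inr ⟨1 / α, one_div_ne_zero hα, Or.inr ⟨rfl, rfl, Or.inr rfl⟩, ?_, ?_⟩
        · simp only [psi, racahB0]; field_simp; ring
        · simp only [psi, racahB0]; field_simp; ring

/-! ### The factorisation of the Heun coefficients -/

theorem inv_pow_add_ne {q c : ℂ} (hq0 : q ≠ 0) (hq : ∀ k : ℕ, 0 < k → q ^ k ≠ 1) {i j : ℕ}
    (hij : i ≠ j) (hc : c * q ^ (i + j + 2) ≠ 1) :
    (q ^ (i + 1))⁻¹ + c * q ^ (i + 1) ≠ (q ^ (j + 1))⁻¹ + c * q ^ (j + 1) := by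
  have e : ∀ n : ℕ, (q ^ (n + 1))⁻¹ + c * q ^ (n + 1) = grid q (c / q) (n + 1) := fun n => by
    rw [grid, pow_succ q (n + 1)]; field_simp
  rw [e, e]
  refine grid_ne_grid hq0 hq (by omega) ?_
  have : c / q * q ^ (i + 1 + (j + 1) + 1) = c * q ^ (i + j + 2) := by
    rw [show i + 1 + (j + 1) + 1 = i + j + 2 + 1 by ring, pow_succ]; field_simp
  rwa [this]

/-- The polynomial identity behind the off-diagonal part of the Heun relations. For neighbouring
eigenvalues `a, b` of `Z` one has `(h₂ + h₃ a + h₄ b) (h₇ + h₈ a + h₉ b) = a b`, and the same with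
`a` and `b` exchanged. In terms of `X = q^{i+1}` the first equation says that the product
of the Laurent polynomials `l₀ X⁻¹ + T + l₂ X` and `m₀ X⁻¹ + T' + m₂ X` is
`(q X⁻¹ + σ + c X) (X⁻¹ + σ + c q X)`; the conclusion compares coefficients. The sum and the
difference of the two equations are polynomials in `X⁻¹ + c X` of degree at most two, so that four
values of `i` suffice. -/
theorem heun_offdiag_coefficients {q c σ h2 h3 h4 h7 h8 h9 : ℂ} (hq0 : q ≠ 0)
    (hq : ∀ k : ℕ, 0 < k → q ^ k ≠ 1) (hc : ∀ i ≤ 10, c * q ^ i ≠ 1)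
    (h : ∀ i < 4, (h2 + h3 * (grid q c i + σ) + h4 * (grid q c (i + 1) + σ)) *
        (h7 + h8 * (grid q c i + σ) + h9 * (grid q c (i + 1) + σ)) =
          (grid q c i + σ) * (grid q c (i + 1) + σ) ∧
      (h2 + h3 * (grid q c (i + 1) + σ) + h4 * (grid q c i + σ)) *
        (h7 + h8 * (grid q c (i + 1) + σ) + h9 * (grid q c i + σ)) =
          (grid q c i + σ) * (grid q c (i + 1) + σ)) :
    (q * h3 + h4) * (q * h8 + h9) = q ∧
    (q * h3 + h4) * (h7 + (h8 + h9) * σ) + (h2 + (h3 + h4) * σ) * (q * h8 + h9) = σ * (1 + q) ∧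
    (q * h3 + h4) * (c * (h8 + q * h9)) + (h2 + (h3 + h4) * σ) * (h7 + (h8 + h9) * σ) +
      c * (h3 + q * h4) * (q * h8 + h9) = c * q ^ 2 + c + σ ^ 2 ∧
    c * (h3 + q * h4) * (h7 + (h8 + h9) * σ) + (h2 + (h3 + h4) * σ) * (c * (h8 + q * h9)) =
      c * σ * (1 + q) ∧
    c * (h3 + q * h4) * (c * (h8 + q * h9)) = c ^ 2 * q := by
  obtain ⟨hq1, hq2, -⟩ := one_sub_ne_zero_of_pow hq
  let Y : ℕ → ℂ := fun i => (q ^ (i + 1))⁻¹ + c * q ^ (i + 1)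
  have hY : ∀ i < 4, ∀ j < 4, i ≠ j → Y i ≠ Y j := fun i hi j hj hij =>
    inv_pow_add_ne hq0 hq hij (hc _ (by omega))
  have hsum : ∀ i, grid q c i + grid q c (i + 1) = (1 + q) * Y i := by
    intro i
    have hx : q ^ i ≠ 0 := pow_ne_zero _ hq0
    simp only [grid, Y, pow_succ]; field_simp; ring
  have hprod : ∀ i, grid q c i * grid q c (i + 1) = q * Y i ^ 2 + c * (1 - q) ^ 2 := by
    intro i
    have hx : q ^ i ≠ 0 := pow_ne_zero _ hq0
    simp only [grid, Y, pow_succ]; field_simp; ring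
  have hne : ∀ i < 4, grid q c i - grid q c (i + 1) ≠ 0 := fun i hi =>
    sub_ne_zero.2 (grid_ne_grid hq0 hq (by omega) (hc _ (by omega)))
  -- the difference of the two equations
  have hdiff := cubic_interpolation (c0 := h2 * (h8 - h9) + h7 * (h3 - h4) +
    (h3 * h8 - h4 * h9) * (2 * σ)) (c1 := (h3 * h8 - h4 * h9) * (1 + q)) (c2 := 0) (c3 := 0) hY
    (fun i hi => by
      apply mul_left_cancel₀ (hne i hi)
      linear_combination (h i hi).1 - (h i hi).2 -
        (grid q c i - grid q c (i + 1)) * (h3 * h8 - h4 * h9) * hsum i)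
  have g1 : h3 * h8 - h4 * h9 = 0 := (mul_eq_zero.1 hdiff.2.1).resolve_right hq2
  have g2 : h2 * (h8 - h9) + h7 * (h3 - h4) = 0 := by
    linear_combination hdiff.1 - 2 * σ * g1
  -- the sum of the two equations
  obtain ⟨e0, e1, e2, -⟩ := cubic_interpolation
    (c0 := 2 * h2 * h7 + 2 * σ * (h2 * (h8 + h9) + h7 * (h3 + h4)) +
      (h3 * h8 + h4 * h9) * (4 * σ ^ 2 - 2 * (σ ^ 2 + c * (1 - q) ^ 2)) +
      2 * (h3 * h9 + h4 * h8 - 1) * (σ ^ 2 + c * (1 - q) ^ 2))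
    (c1 := (h2 * (h8 + h9) + h7 * (h3 + h4)) * (1 + q) + (h3 * h8 + h4 * h9) * (2 * σ * (1 + q)) +
      2 * (h3 * h9 + h4 * h8 - 1) * (1 + q) * σ)
    (c2 := (h3 * h8 + h4 * h9) * (1 + q ^ 2) + 2 * (h3 * h9 + h4 * h8 - 1) * q) (c3 := 0) hY
    (fun i hi => by
      have s1 := hsum i
      have s2 := hprod i
      have s3 := (h i hi).1
      have s4 := (h i hi).2
      generalize Y i = y at *
      generalize grid q c i = a at *
      generalize grid q c (i + 1) = b at *
      obtain rfl : b = (1 + q) * y - a := by linear_combination s1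
      linear_combination s3 + s4 +
        (2 * (h3 * h8 + h4 * h9) - 2 * (h3 * h9 + h4 * h8 - 1)) * s2)
  refine ⟨?_, ?_, ?_, ?_, ?_⟩
  · linear_combination e2 / 2 + (q ^ 2 - 1) / 2 * g1
  · linear_combination e1 / 2 + (q - 1) / 2 * g2 + σ * (q - 1) * g1
  · linear_combination e0 / 2 + c * e2
  · linear_combination c * (e1 / 2 - (q - 1) / 2 * g2 - σ * (q - 1) * g1)
  · linear_combination c ^ 2 * (e2 / 2 - (q ^ 2 - 1) / 2 * g1)

/-- The four ways in which the zeros `q s, 1 / (c s), s, 1 / (c q s)` of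
`(q X⁻¹ + σ + c X) (X⁻¹ + σ + c q X)` can be distributed over two quadratic factors, up to the
symmetry `s ↦ 1 / (c q s)`. -/
theorem exists_heun_roots {q c σ l0 T l2 m0 T' m2 : ℂ} (hq0 : q ≠ 0) (hc : c ≠ 0)
    (k0 : l0 * m0 = q) (k1 : l0 * T' + T * m0 = σ * (1 + q))
    (k2 : l0 * m2 + T * T' + l2 * m0 = c * q ^ 2 + c + σ ^ 2)
    (k3 : l2 * T' + T * m2 = c * σ * (1 + q)) (k4 : l2 * m2 = c ^ 2 * q) :
    l2 ≠ 0 ∧ ∃ s, s ≠ 0 ∧ σ = -1 / s - q * s * c ∧ ∃ x y, T = -l2 * (x + y) ∧ l0 = l2 * (x * y) ∧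
      ((x = q * s ∧ y = 1 / (c * s)) ∨ (x = s ∧ y = 1 / (c * q * s)) ∨ (x = s ∧ y = q * s) ∨
        (x = q * s ∧ y = 1 / (c * q * s))) := by
  obtain ⟨s, hs, hσ⟩ : ∃ s, s ≠ 0 ∧ σ = -1 / s - q * s * c := by
    obtain ⟨t, ht⟩ := IsAlgClosed.exists_pow_nat_eq (σ ^ 2 - 4 * (q * c)) (n := 2) (by omega)
    have hqc : q * c ≠ 0 := mul_ne_zero hq0 hc
    have hroot :
        q * c * ((-σ + t) / (2 * (q * c))) ^ 2 + σ * ((-σ + t) / (2 * (q * c))) + 1 = 0 := by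
      field_simp
      linear_combination ht
    generalize (-σ + t) / (2 * (q * c)) = s at hroot
    have hs : s ≠ 0 := by
      rintro rfl
      simp at hroot
    refine ⟨s, hs, ?_⟩
    field_simp
    linear_combination hroot
  have hid : ∀ X : ℂ, X ≠ 0 → (l0 + T * X + l2 * X ^ 2) * (m0 + T' * X + m2 * X ^ 2) =
      c ^ 2 * q * ((X - q * s) * (X - 1 / (c * s)) * (X - s) * (X - 1 / (c * q * s))) := by
    intro X _
    have : (q + σ * X + c * X ^ 2) * (1 + σ * X + c * q * X ^ 2) =
        c ^ 2 * q * ((X - q * s) * (X - 1 / (c * s)) * (X - s) * (X - 1 / (c * q * s))) := by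
      rw [hσ]; field_simp; ring
    rw [← this]
    linear_combination k0 + X * k1 + X ^ 2 * k2 + X ^ 3 * k3 + X ^ 4 * k4
  obtain ⟨hl2, x, y, hT, hl0, hxy⟩ := exists_roots_of_mul_eq
    (mul_ne_zero (pow_ne_zero 2 hc) hq0) hid
  refine ⟨hl2, ?_⟩
  -- the cases are stated for unordered pairs
  have pair : ∀ {x y u v : ℂ}, T = -l2 * (x + y) → l0 = l2 * (x * y) →
      ({x, y} : Multiset ℂ) = {u, v} → T = -l2 * (u + v) ∧ l0 = l2 * (u * v) := by
    intro x y u v h1 h2 h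
    have hs := congrArg Multiset.sum h
    have hp := congrArg Multiset.prod h
    simp only [Multiset.insert_eq_cons, Multiset.sum_cons, Multiset.sum_singleton,
      Multiset.prod_cons, Multiset.prod_singleton] at hs hp
    exact ⟨by rw [h1, hs], by rw [h2, hp]⟩
  have hs' : 1 / (c * q * s) ≠ 0 := one_div_ne_zero (mul_ne_zero (mul_ne_zero hc hq0) hs)
  have hσ' : σ = -1 / (1 / (c * q * s)) - q * (1 / (c * q * s)) * c := by
    rw [hσ]; field_simp; ring
  have e1 : 1 / (c * s) = q * (1 / (c * q * s)) := by field_simp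
  have e2 : s = 1 / (c * q * (1 / (c * q * s))) := by field_simp
  rcases hxy with h | h | h | h | h | h
  · obtain ⟨h1, h2⟩ := pair hT hl0 h
    exact ⟨s, hs, hσ, _, _, h1, h2, Or.inl ⟨rfl, rfl⟩⟩
  · obtain ⟨h1, h2⟩ := pair hT hl0 (h.trans (Multiset.pair_comm _ _))
    exact ⟨s, hs, hσ, _, _, h1, h2, Or.inr (Or.inr (Or.inl ⟨rfl, rfl⟩))⟩
  · obtain ⟨h1, h2⟩ := pair hT hl0 h
    exact ⟨s, hs, hσ, _, _, h1, h2, Or.inr (Or.inr (Or.inr ⟨rfl, rfl⟩))⟩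
  · obtain ⟨h1, h2⟩ := pair hT hl0 h
    exact ⟨_, hs', hσ', _, _, h1, h2, Or.inr (Or.inr (Or.inr ⟨e1, e2⟩))⟩
  · obtain ⟨h1, h2⟩ := pair hT hl0 (h.trans (Multiset.pair_comm _ _))
    exact ⟨_, hs', hσ', _, _, h1, h2, Or.inr (Or.inr (Or.inl ⟨rfl, e1⟩))⟩
  · obtain ⟨h1, h2⟩ := pair hT hl0 h
    exact ⟨s, hs, hσ, _, _, h1, h2, Or.inr (Or.inl ⟨rfl, rfl⟩)⟩

/-- The polynomial identities behind the diagonal part of the first Heun relation. -/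
theorem heun_diag_coefficients {q c κ σ h0 h1 h2 w b0 b1 b0' b1' : ℂ} (hq0 : q ≠ 0)
    (hq : ∀ k : ℕ, 0 < k → q ^ k ≠ 1) (hc : ∀ i ≤ 10, c * q ^ i ≠ 1)
    (h : ∀ i < 4, (b0' + b1' * grid q c i) * (grid q c i + σ) =
      (h0 + h1 * (grid q c i + σ)) * (grid q c i ^ 2 - κ) +
        (h2 + w * (grid q c i + σ)) * (b0 + b1 * grid q c i)) :
    h1 = 0 ∧ b1' = h0 + w * b1 ∧ b0' + σ * b1' = (h2 + w * σ) * b1 + w * b0 ∧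
      σ * b0' = -κ * h0 + (h2 + w * σ) * b0 := by
  obtain ⟨e0, e1, e2, e3⟩ := cubic_interpolation (y := grid q c)
    (c0 := b0' * σ + (h0 + h1 * σ) * κ - (h2 + w * σ) * b0)
    (c1 := b0' + b1' * σ + h1 * κ - w * b0 - (h2 + w * σ) * b1)
    (c2 := b1' - (h0 + h1 * σ) - w * b1) (c3 := -h1)
    (fun i hi j hj hij => grid_ne_grid hq0 hq hij (hc _ (by omega)))
    (fun i hi => by linear_combination h i hi)
  have h1 : h1 = 0 := by linear_combination -e3
  subst h1
  exact ⟨rfl, by linear_combination e2, by linear_combination e1, by linear_combination e0⟩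

/-! ### The cases of the Heun relations -/

/-- The Heun relations for two tridiagonal matrices, in scalar form. The subdiagonals of the two
matrices are `Vd`, `Wd`, the superdiagonals are `Vu`, `Wu` and have no zeros; the diagonal
entries at the grid point `u` are `(b0 + b1 u) / (u² - c (1 + q)²)` and
`(b0' + b1' u) / (u² - c (1 + q)²)`, and `Z` is diagonal with entries `u + σ`. -/
structure HeunEqs (N : ℕ) (q c σ : ℂ) (Vd Vu Wd Wu : ℕ → ℂ) (b0 b1 b0' b1' : ℂ)
    (h : Fin 10 → ℂ) : Prop where
  vd : ∀ i < N, Vd i ≠ 0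
  vu : ∀ i < N, Vu i ≠ 0
  wd : ∀ i < N, Wd i ≠ 0
  wu : ∀ i < N, Wu i ≠ 0
  down : ∀ i < N, Wd i * (grid q c i + σ) =
    (h 2 + h 3 * (grid q c i + σ) + h 4 * (grid q c (i + 1) + σ)) * Vd i
  down' : ∀ i < N, (grid q c (i + 1) + σ) * Vd i =
    (h 7 + h 8 * (grid q c i + σ) + h 9 * (grid q c (i + 1) + σ)) * Wd i
  up : ∀ i < N, Wu i * (grid q c (i + 1) + σ) =
    (h 2 + h 3 * (grid q c (i + 1) + σ) + h 4 * (grid q c i + σ)) * Vu i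
  up' : ∀ i < N, (grid q c i + σ) * Vu i =
    (h 7 + h 8 * (grid q c (i + 1) + σ) + h 9 * (grid q c i + σ)) * Wu i
  diag : ∀ i ≤ N, (b0' + b1' * grid q c i) * (grid q c i + σ) =
    (h 0 + h 1 * (grid q c i + σ)) * (grid q c i ^ 2 - c * (1 + q) ^ 2) +
      (h 2 + (h 3 + h 4) * (grid q c i + σ)) * (b0 + b1 * grid q c i)
  diag' : ∀ i ≤ N, (b0 + b1 * grid q c i) * (grid q c i + σ) =
    (h 5 + h 6 * (grid q c i + σ)) * (grid q c i ^ 2 - c * (1 + q) ^ 2) +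
      (h 7 + (h 8 + h 9) * (grid q c i + σ)) * (b0' + b1' * grid q c i)

/-- The Heun coefficients in the case in which the coefficients of `V` in the two relations vanish
at `X = s` and `X = q s`, and at `1 / (c s)` and `1 / (c q s)`, as for the one-parameter family. -/
structure IsCommCase (q c σ s l : ℂ) (h : Fin 10 → ℂ) : Prop where
  s_ne : s ≠ 0
  l_ne : l ≠ 0
  sigma_eq : σ = -1 / s - q * s * c
  h34 : c * (h 3 + q * h 4) = l
  h43 : q * h 3 + h 4 = l * q * s ^ 2
  h2 : h 2 + (h 3 + h 4) * σ = -l * s * (1 + q)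
  h98 : q * h 8 + h 9 = 1 / (l * s ^ 2)
  h89 : h 8 + q * h 9 = c * q / l
  h7 : h 7 + (h 8 + h 9) * σ = -c * (1 + q) / (l * s)

/-- The Heun coefficients in the case in which the coefficients of `V` in the two relations vanish
at `X = q s` and `X = 1 / (c q s)`, and at `s` and `1 / (c s)`. The relations then involve
anticommutators. -/
structure IsAnticommCase (q c σ s l : ℂ) (h : Fin 10 → ℂ) : Prop where
  s_ne : s ≠ 0
  l_ne : l ≠ 0
  sigma_eq : σ = -1 / s - q * s * c
  generic : c * q * s ^ 2 ≠ 1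
  h34 : c * (h 3 + q * h 4) = l
  h43 : q * h 3 + h 4 = l / c
  h2 : h 2 + (h 3 + h 4) * σ = -l * (q * s + 1 / (c * q * s))
  h98 : q * h 8 + h 9 = c * q / l
  h89 : h 8 + q * h 9 = c * q / l
  h7 : h 7 + (h 8 + h 9) * σ = -c * q * (c * s + 1 / s) / l

section

variable {N : ℕ} {q c σ : ℂ} {Vd Vu Wd Wu : ℕ → ℂ} {b0 b1 b0' b1' : ℂ} {h : Fin 10 → ℂ}

/-- The consequences of the diagonal equations; the second relation only determines `h 5`, `h 6`
once the other coefficients are known. -/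
theorem HeunEqs.diag_coefficients (H : HeunEqs N q c σ Vd Vu Wd Wu b0 b1 b0' b1' h) (hN : 4 ≤ N)
    (hq0 : q ≠ 0) (hq : ∀ k : ℕ, 0 < k → q ^ k ≠ 1) (hc : ∀ i ≤ 10, c * q ^ i ≠ 1) :
    (h 1 = 0 ∧ b1' = h 0 + (h 3 + h 4) * b1 ∧
      b0' + σ * b1' = (h 2 + (h 3 + h 4) * σ) * b1 + (h 3 + h 4) * b0 ∧
      σ * b0' = -(c * (1 + q) ^ 2) * h 0 + (h 2 + (h 3 + h 4) * σ) * b0) ∧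
    h 6 = 0 ∧ b1 = h 5 + (h 8 + h 9) * b1' := by
  refine ⟨heun_diag_coefficients hq0 hq hc fun i hi => H.diag i (by omega), ?_⟩
  obtain ⟨e1, e2, -⟩ := heun_diag_coefficients hq0 hq hc fun i hi => H.diag' i (by omega)
  exact ⟨e1, e2⟩

/-- Case distinction for the Heun coefficients, according to `exists_heun_roots`. In the first two
cases the relations turn out to be `W Z = h₃ V Z` and `W Z = h₄ Z V`. The values of `s` for which
one of the other distributions of the zeros coincides with that of the commutator case are assigned
to the latter. -/
theorem HeunEqs.exists_cases (H : HeunEqs N q c σ Vd Vu Wd Wu b0 b1 b0' b1' h) (hN : 4 ≤ N)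
    (hq0 : q ≠ 0) (hq : ∀ k : ℕ, 0 < k → q ^ k ≠ 1) (hc0 : c ≠ 0)
    (hc : ∀ i ≤ 10, c * q ^ i ≠ 1) :
    (h 2 = 0 ∧ h 4 = 0 ∧ h 7 = 0 ∧ h 8 = 0 ∧ h 3 * h 9 = 1 ∧ σ ^ 2 ≠ c * (1 + q) ^ 2) ∨
    (h 2 = 0 ∧ h 3 = 0 ∧ σ ^ 2 ≠ c * (1 + q) ^ 2) ∨
    (∃ s l, IsCommCase q c σ s l h) ∨ ∃ s l, IsAnticommCase q c σ s l h := by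
  obtain ⟨hq1, hq2, hq3⟩ := one_sub_ne_zero_of_pow hq
  obtain ⟨k0, k1, k2, k3, k4⟩ := heun_offdiag_coefficients (σ := σ) hq0 hq hc
    (h2 := h 2) (h3 := h 3) (h4 := h 4) (h7 := h 7) (h8 := h 8) (h9 := h 9) fun i hi => by
      have hi' : i < N := by omega
      constructor
      · apply mul_right_cancel₀ (mul_ne_zero (H.vd i hi') (H.wd i hi'))
        linear_combination -(h 7 + h 8 * (grid q c i + σ) + h 9 * (grid q c (i + 1) + σ)) * Wd i *
          H.down i hi' - Wd i * (grid q c i + σ) * H.down' i hi'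
      · apply mul_right_cancel₀ (mul_ne_zero (H.vu i hi') (H.wu i hi'))
        linear_combination -(h 7 + h 8 * (grid q c (i + 1) + σ) + h 9 * (grid q c i + σ)) * Wu i *
          H.up i hi' - Wu i * (grid q c (i + 1) + σ) * H.up' i hi'
  obtain ⟨hl, s, hs, hσ, x, y, hT, hl0, hxy⟩ := exists_heun_roots hq0 hc0 k0 k1 k2 k3 k4
  clear k2 H
  obtain ⟨l, hl'⟩ : ∃ l, c * (h 3 + q * h 4) = l := ⟨_, rfl⟩
  rw [hl'] at hl hT hl0 k3 k4
  have hm2 : h 8 + q * h 9 = c * q / l := by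
    rw [eq_div_iff hl]
    apply mul_left_cancel₀ hc0
    linear_combination k4
  -- the third case, for any parametrisation of `σ`
  have third : ∀ t, t ≠ 0 → σ = -1 / t - q * t * c → x + y = t + q * t → x * y = t * (q * t) →
      IsCommCase q c σ t l h := by
    intro t ht hσt e1 e2
    rw [e1] at hT
    rw [e2] at hl0
    refine ⟨ht, hl, hσt, hl', by rw [hl0]; ring, by rw [hT]; ring, ?_, hm2, ?_⟩
    · rw [hl0] at k0
      rw [eq_div_iff (mul_ne_zero hl (pow_ne_zero 2 ht))]
      apply mul_left_cancel₀ hq0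
      linear_combination k0
    · rw [hm2, hT] at k3
      apply mul_left_cancel₀ hl
      rw [hσt] at k3 ⊢
      field_simp at k3 ⊢
      linear_combination k3
  -- the values of `s` for which the first two cases are contained in the third one
  have hfac : σ ^ 2 = c * (1 + q) ^ 2 → c * s ^ 2 = 1 ∨ c * q ^ 2 * s ^ 2 = 1 := by
    intro hκ
    have : σ ^ 2 - c * (1 + q) ^ 2 = (1 - c * s ^ 2) * (1 - c * q ^ 2 * s ^ 2) / s ^ 2 := by
      rw [hσ]; field_simp; ring
    rw [hκ, sub_self] at this
    rcases mul_eq_zero.1 ((div_eq_zero_iff.1 this.symm).resolve_right (pow_ne_zero 2 hs)) with h | h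
    · left; linear_combination -h
    · right; linear_combination -h
  rcases hxy with ⟨hx, hy⟩ | ⟨hx, hy⟩ | ⟨hx, hy⟩ | ⟨hx, hy⟩
  · by_cases hκ : σ ^ 2 = c * (1 + q) ^ 2
    · refine Or.inr (Or.inr (Or.inl ?_))
      rcases hfac hκ with hf | hf
      · have e : 1 / (c * s) = s := by field_simp; linear_combination -hf
        exact ⟨s, l, third s hs hσ (by rw [hx, hy, e]; ring) (by rw [hx, hy, e]; ring)⟩
      · have e : 1 / (c * s) = q * (q * s) := by field_simp; linear_combination -hf
        refine ⟨q * s, l, third (q * s) (mul_ne_zero hq0 hs) ?_ (by rw [hx, hy, e])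
          (by rw [hx, hy, e])⟩
        rw [hσ]; field_simp; linear_combination (q - 1) * hf
    · left
      rw [hx, hy] at hl0 hT
      have e0 : q * h 3 + h 4 = l * q / c := by rw [hl0]; field_simp
      have e4 : h 4 = 0 := by
        apply mul_left_cancel₀ (mul_ne_zero hc0 hq3)
        field_simp at e0
        linear_combination e0 - q * hl'
      have e3 : l = c * h 3 := by linear_combination -hl' + c * q * e4
      have em : q * h 8 + h 9 = c / l := by
        rw [e0] at k0
        field_simp at k0
        field_simp
        linear_combination k0
      have e8 : h 8 = 0 := by
        apply mul_left_cancel₀ hq3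
        linear_combination hm2 - q * em
      have h3ne : h 3 ≠ 0 := fun h0 => hl (by rw [e3, h0, mul_zero])
      have e9 : h 3 * h 9 = 1 := by
        rw [e3, e8] at em
        field_simp at em
        linear_combination em
      rw [e4, e8] at k1
      rw [e4] at hT
      have e2 : h 2 = 0 := by
        have e : -l * (q * s + 1 / (c * s)) = h 3 * σ := by rw [hσ, e3]; field_simp; ring
        rw [e] at hT
        linear_combination hT
      rw [e2] at k1
      refine ⟨e2, e4, ?_, e8, e9, hκ⟩
      apply mul_left_cancel₀ (mul_ne_zero hq0 h3ne)
      linear_combination k1 - σ * (1 + q) * e9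
  · by_cases hκ : σ ^ 2 = c * (1 + q) ^ 2
    · refine Or.inr (Or.inr (Or.inl ?_))
      rcases hfac hκ with hf | hf
      · have e : 1 / (c * q * s) = s / q := by field_simp; linear_combination -hf
        refine ⟨s / q, l, third (s / q) (div_ne_zero hs hq0) ?_ ?_ ?_⟩
        · rw [hσ]; field_simp; linear_combination (1 - q) * hf
        · rw [hx, hy, e]; field_simp; ring
        · rw [hx, hy, e]; field_simp
      · have e : 1 / (c * q * s) = q * s := by field_simp; linear_combination -hf
        exact ⟨s, l, third s hs hσ (by rw [hx, hy, e]) (by rw [hx, hy, e])⟩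
    · right; left
      rw [hx, hy] at hl0 hT
      have e0 : q * h 3 + h 4 = l / (c * q) := by rw [hl0]; field_simp
      have e3 : h 3 = 0 := by
        apply mul_left_cancel₀ (mul_ne_zero hc0 hq3)
        field_simp at e0
        linear_combination hl' - e0
      refine ⟨?_, e3, hκ⟩
      have e4 : l = c * q * h 4 := by linear_combination -hl' + c * e3
      have e : -l * (s + 1 / (c * q * s)) = h 4 * σ := by rw [hσ, e4]; field_simp; ring
      rw [e, e3] at hT
      linear_combination hT
  · exact Or.inr (Or.inr (Or.inl ⟨s, l, third s hs hσ (by rw [hx, hy]) (by rw [hx, hy])⟩))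
  · refine Or.inr (Or.inr ?_)
    by_cases hcs : c * q * s ^ 2 = 1
    · have e : 1 / (c * q * s) = s := by field_simp; linear_combination -hcs
      exact Or.inl ⟨s, l, third s hs hσ (by rw [hx, hy, e]; ring) (by rw [hx, hy, e]; ring)⟩
    rw [hx, hy] at hl0 hT
    have e0 : q * h 3 + h 4 = l / c := by rw [hl0]; field_simp
    have em : q * h 8 + h 9 = c * q / l := by
      rw [e0] at k0
      field_simp at k0
      field_simp
      linear_combination k0
    refine Or.inr ⟨s, l, hs, hl, hσ, hcs, hl', e0, hT, em, hm2, ?_⟩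
    rw [hm2, hT] at k3
    apply mul_left_cancel₀ hl
    rw [hσ] at k3 ⊢
    field_simp at k3 ⊢
    linear_combination k3

end

section

variable {N : ℕ} {q α β δ α' β' δ' σ : ℂ} {ν : ℕ → ℂ} {h : Fin 10 → ℂ}

/-- The scalar form of the Heun relations for the two `q`-Racah operators. -/
def RacahHeunEqs (N : ℕ) (q α β δ α' β' δ' σ : ℂ) (ν : ℕ → ℂ) (h : Fin 10 → ℂ) : Prop :=
  HeunEqs N q (α * β) σ (fun i => racahC q α β (gam q N) δ (i + 1))
      (fun i => racahA q α β (gam q N) δ i)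
      (fun i => racahC q α' β' (gam q N) δ' (i + 1) * ν (i + 1))
      (fun i => racahA q α' β' (gam q N) δ' i * (1 / ν (i + 1)))
      (racahB0 q α β (gam q N) δ) (psi q α β (gam q N) δ)
      (racahB0 q α' β' (gam q N) δ') (psi q α' β' (gam q N) δ') h

theorem heunEqs_of_heunRelations (z : Module.Basis (Fin (N + 1)) ℂ E) (hq0 : q ≠ 0)
    (hq : ∀ k : ℕ, 0 < k → q ^ k ≠ 1) (hR : IsRegular N q α β δ) (hab : α' * β' = α * β)
    (hLP : IsLeonardPair N (opRacah z q α' β' δ' ν) (opZ z q α β σ))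
    (hH : HeunRelations (opRacah z q α β δ 1) (opRacah z q α' β' δ' ν) (opZ z q α β σ) h) :
    RacahHeunEqs N q α β δ α' β' δ' σ ν h := by
  have hirr := hLP.isIrredTridiagonal (isTridiagonal_opRacah z q α' β' δ' ν)
    (isMultFreeDiag_opZ hq0 hq z hR.ab σ)
  have hrel := (heunRelations_iff z q α β σ _ _ h).1 hH
  have low : ∀ i, ∀ hi : i < N, ∀ a b d : ℂ, ∀ μ : ℕ → ℂ,
      mat z (opRacah z q a b d μ) ⟨i + 1, by omega⟩ ⟨i, by omega⟩ =
        racahC q a b (gam q N) d (i + 1) * μ (i + 1) := by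
    intro i hi a b d μ
    rw [mat_opRacah, if_pos rfl]
  have upp : ∀ i, ∀ hi : i < N, ∀ a b d : ℂ, ∀ μ : ℕ → ℂ,
      mat z (opRacah z q a b d μ) ⟨i, by omega⟩ ⟨i + 1, by omega⟩ =
        racahA q a b (gam q N) d i * (1 / μ (i + 1)) := by
    intro i hi a b d μ
    rw [mat_opRacah, if_neg (by simp only; omega),
      if_neg (fun h => by simp only [Fin.mk.injEq] at h; omega), if_pos rfl]
  have dia : ∀ i, ∀ hi : i ≤ N, ∀ a b d : ℂ, ∀ μ : ℕ → ℂ,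
      mat z (opRacah z q a b d μ) ⟨i, by omega⟩ ⟨i, by omega⟩ = racahB q a b (gam q N) d i := by
    intro i hi a b d μ
    rw [mat_opRacah, if_neg (by simp only; omega), if_pos rfl]
  have ne1 : ∀ i, ∀ hi : i < N, (⟨i + 1, by omega⟩ : Fin (N + 1)) ≠ ⟨i, by omega⟩ := by
    intro i hi h; simp only [Fin.mk.injEq] at h; omega
  have relDown : ∀ i, ∀ hi : i < N, _ := fun i hi => hrel ⟨i + 1, by omega⟩ ⟨i, by omega⟩
  have relUp : ∀ i, ∀ hi : i < N, _ := fun i hi => hrel ⟨i, by omega⟩ ⟨i + 1, by omega⟩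
  have relDiag : ∀ i, ∀ hi : i ≤ N, _ := fun i hi => hrel ⟨i, by omega⟩ ⟨i, by omega⟩
  unfold RacahHeunEqs
  refine ⟨fun i hi => hR.racahC_ne_zero hq0 hq (by omega) (by omega),
    fun i hi => hR.racahA_ne_zero hq0 hq hi, fun i hi => ?_, fun i hi => ?_, fun i hi => ?_,
    fun i hi => ?_, fun i hi => ?_, fun i hi => ?_, fun i hi => ?_, fun i hi => ?_⟩
  · have := (hirr.2 ⟨i, by omega⟩ ⟨i + 1, by omega⟩ rfl).2
    rwa [low i hi] at this
  · have := (hirr.2 ⟨i, by omega⟩ ⟨i + 1, by omega⟩ rfl).1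
    rwa [upp i hi] at this
  · have := (relDown i hi).1
    rw [low i hi, low i hi, if_neg (ne1 i hi)] at this
    simpa using this
  · have := (relDown i hi).2
    rw [low i hi, low i hi, if_neg (ne1 i hi)] at this
    simpa using this
  · have := (relUp i hi).1
    rw [upp i hi, upp i hi, if_neg (ne1 i hi).symm] at this
    simpa using this
  · have := (relUp i hi).2
    rw [upp i hi, upp i hi, if_neg (ne1 i hi).symm] at this
    simpa using this
  · have h1 := (relDiag i hi).1
    rw [dia i hi, dia i hi, if_pos rfl] at h1
    simp only at h1
    have e := racahB_mul_grid (γ := gam q N) (δ := δ) hq0 (hR.ab (2 * i) (by omega))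
      (hR.ab (2 * i + 1) (by omega)) (hR.ab (2 * i + 2) (by omega))
    have e' := racahB_mul_grid (α := α') (β := β') (γ := gam q N) (δ := δ') hq0
      (by rw [hab]; exact hR.ab (2 * i) (by omega))
      (by rw [hab]; exact hR.ab (2 * i + 1) (by omega))
      (by rw [hab]; exact hR.ab (2 * i + 2) (by omega))
    rw [hab] at e'
    rw [← e, ← e']
    linear_combination (grid q (α * β) i ^ 2 - α * β * (1 + q) ^ 2) * h1
  · have h1 := (relDiag i hi).2
    rw [dia i hi, dia i hi, if_pos rfl] at h1
    simp only at h1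
    have e := racahB_mul_grid (γ := gam q N) (δ := δ) hq0 (hR.ab (2 * i) (by omega))
      (hR.ab (2 * i + 1) (by omega)) (hR.ab (2 * i + 2) (by omega))
    have e' := racahB_mul_grid (α := α') (β := β') (γ := gam q N) (δ := δ') hq0
      (by rw [hab]; exact hR.ab (2 * i) (by omega))
      (by rw [hab]; exact hR.ab (2 * i + 1) (by omega))
      (by rw [hab]; exact hR.ab (2 * i + 2) (by omega))
    rw [hab] at e'
    rw [← e, ← e']
    linear_combination (grid q (α * β) i ^ 2 - α * β * (1 + q) ^ 2) * h1

/-- Two `q`-Racah operators with the same product `α β` are proportional as soon as the off-diagonal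
entries and the numerators of the diagonal entries are. -/
theorem opRacah_eq_smul (z : Module.Basis (Fin (N + 1)) ℂ E) (hq0 : q ≠ 0)
    (hc : ∀ i ≤ 2 * N + 2, α * β * q ^ i ≠ 1) (hab : α' * β' = α * β) {μ : ℕ → ℂ} {c : ℂ}
    (hd : ∀ i < N, racahC q α' β' (gam q N) δ' (i + 1) * ν (i + 1) =
      c * (racahC q α β (gam q N) δ (i + 1) * μ (i + 1)))
    (hu : ∀ i < N, racahA q α' β' (gam q N) δ' i * (1 / ν (i + 1)) =
      c * (racahA q α β (gam q N) δ i * (1 / μ (i + 1))))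
    (h0 : racahB0 q α' β' (gam q N) δ' = c * racahB0 q α β (gam q N) δ)
    (h1 : psi q α' β' (gam q N) δ' = c * psi q α β (gam q N) δ) :
    opRacah z q α' β' δ' ν = c • opRacah z q α β δ μ := by
  refine (LinearMap.toMatrix z z).injective ?_
  ext k i
  rw [← mat, ← mat, mat_smul, mat_opRacah, mat_opRacah]
  split_ifs with g1 g2 g3
  · have := hd i (by omega)
    rwa [← g1] at this
  · have hi : (i : ℕ) ≤ N := by omega
    have a0 := hc (2 * i) (by omega)
    have a1 := hc (2 * i + 1) (by omega)
    have a2 := hc (2 * i + 2) (by omega)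
    have e := racahB_mul_grid (γ := gam q N) (δ := δ) hq0 a0 a1 a2
    rw [← hab] at a0 a1 a2
    have e' := racahB_mul_grid (γ := gam q N) (δ := δ') hq0 a0 a1 a2
    rw [hab] at e' a0 a2
    apply mul_right_cancel₀ (grid_sq_sub_ne_zero hq0 a0 a2)
    rw [e', mul_assoc, e, h0, h1]
    ring
  · have := hu k (by omega)
    rwa [g3] at this
  · ring

end

/-! ### The commutator case -/

section

variable {N : ℕ} {q c σ s l : ℂ} {Vd Vu Wd Wu : ℕ → ℂ} {b0 b1 b0' b1' : ℂ} {h : Fin 10 → ℂ}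

/-- Neighbouring entries of `Z` in terms of `X = q^{i+1}`. -/
theorem grid_add_eq (hq0 : q ≠ 0) (hs : s ≠ 0) (hσ : σ = -1 / s - q * s * c) (i : ℕ) :
    grid q c i + σ = (q * s - q ^ (i + 1)) * (1 - c * s * q ^ (i + 1)) / (s * q ^ (i + 1)) ∧
    grid q c (i + 1) + σ =
      (s - q ^ (i + 1)) * (1 - c * q * s * q ^ (i + 1)) / (s * q ^ (i + 1)) := by
  have hx : q ^ i ≠ 0 := pow_ne_zero _ hq0
  simp only [grid, hσ, pow_succ]
  constructor <;>
  · field_simp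
    ring

/-- The coefficients of the Heun relations at neighbouring grid points, in terms of
`X = q^{i+1}`. -/
theorem heun_coef_eq (hq0 : q ≠ 0) (i : ℕ) (k2 k3 k4 : ℂ) :
    k2 + k3 * (grid q c i + σ) + k4 * (grid q c (i + 1) + σ) =
      (q * k3 + k4) / q ^ (i + 1) + (k2 + (k3 + k4) * σ) + c * (k3 + q * k4) * q ^ (i + 1) ∧
    k2 + k3 * (grid q c (i + 1) + σ) + k4 * (grid q c i + σ) =
      (k3 + q * k4) / q ^ (i + 1) + (k2 + (k3 + k4) * σ) + c * (q * k3 + k4) * q ^ (i + 1) := by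
  have hx : q ^ i ≠ 0 := pow_ne_zero _ hq0
  simp only [grid, pow_succ]
  constructor <;>
  · field_simp
    ring

/-- In the commutator case both relations say the same about the off-diagonal entries, except at the
zeros of `Z`; together they determine `W` off the diagonal, and force `s` to be admissible. -/
theorem HeunEqs.offdiag_of_isCommCase (H : HeunEqs N q c σ Vd Vu Wd Wu b0 b1 b0' b1' h)
    (K : IsCommCase q c σ s l h) (hq0 : q ≠ 0) (hq : ∀ k : ℕ, 0 < k → q ^ k ≠ 1) (hc0 : c ≠ 0)
    (hc : ∀ i ≤ 2 * N + 2, c * q ^ i ≠ 1) {i : ℕ} (hi : i < N) :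
    s ≠ q ^ (i + 1) ∧ c * s * q ^ (i + 1) ≠ 1 ∧
    Wd i * (1 - c * s * q ^ (i + 1)) = l * s * (s - q ^ (i + 1)) * Vd i ∧
    c * Wu i * (s - q ^ (i + 1)) = l * s * (1 - c * s * q ^ (i + 1)) * Vu i := by
  obtain ⟨hq1, -, -⟩ := one_sub_ne_zero_of_pow hq
  have hs := K.s_ne
  have hl := K.l_ne
  have hx : q ^ (i + 1) ≠ 0 := pow_ne_zero _ hq0
  have hcx : c * (q ^ (i + 1)) ^ 2 ≠ 1 := by
    rw [← pow_mul]; exact hc _ (by omega)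
  obtain ⟨za, zb⟩ := grid_add_eq (c := c) hq0 hs K.sigma_eq i
  have hd := H.down i hi
  have hd' := H.down' i hi
  have hu := H.up i hi
  have hu' := H.up' i hi
  rw [(heun_coef_eq hq0 i (h 2) (h 3) (h 4)).1, K.h34, K.h43, K.h2, za] at hd
  rw [(heun_coef_eq hq0 i (h 7) (h 8) (h 9)).1, K.h89, K.h98, K.h7, zb] at hd'
  rw [(heun_coef_eq hq0 i (h 2) (h 3) (h 4)).2, K.h43, K.h2, zb,
    show h 3 + q * h 4 = l / c by rw [← K.h34]; field_simp] at hu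
  rw [(heun_coef_eq hq0 i (h 7) (h 8) (h 9)).2, K.h89, K.h98, K.h7, za] at hu'
  have wd := H.wd i hi
  have vd := H.vd i hi
  generalize q ^ (i + 1) = x at *
  generalize Wd i = A at *
  generalize Vd i = B at *
  generalize Wu i = A' at *
  generalize Vu i = B' at *
  have r1 : (q * s - x) * (A * (1 - c * s * x) - l * s * (s - x) * B) = 0 := by
    field_simp at hd
    linear_combination hd
  have r2 : (1 - c * q * s * x) * (A * (1 - c * s * x) - l * s * (s - x) * B) = 0 := by
    field_simp at hd'
    linear_combination -hd'
  have r3 : (1 - c * q * s * x) * (c * A' * (s - x) - l * s * (1 - c * s * x) * B') = 0 := by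
    field_simp at hu
    linear_combination hu
  have r4 : (q * s - x) * (c * A' * (s - x) - l * s * (1 - c * s * x) * B') = 0 := by
    field_simp at hu'
    linear_combination -hu'
  -- the two cofactors have no common zero, since `c X² ≠ 1`
  have both : ∀ y : ℂ, (q * s - x) * y = 0 → (1 - c * q * s * x) * y = 0 → y = 0 := by
    intro y h1 h2
    by_contra hy
    have e1 := (mul_eq_zero.1 h1).resolve_right hy
    have e2 := (mul_eq_zero.1 h2).resolve_right hy
    exact hcx (by linear_combination -c * x * e1 - e2)
  have g1 : A * (1 - c * s * x) = l * s * (s - x) * B := sub_eq_zero.1 (both _ r1 r2)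
  have g2 : c * A' * (s - x) = l * s * (1 - c * s * x) * B' := sub_eq_zero.1 (both _ r4 r3)
  refine ⟨fun hsx => ?_, fun hsx => ?_, g1, g2⟩
  · rw [← hsx, sub_self, mul_zero, zero_mul] at g1
    have := (mul_eq_zero.1 g1).resolve_left wd
    exact hcx (by rw [← hsx]; linear_combination -this)
  · rw [hsx, sub_self, mul_zero] at g1
    have := (mul_eq_zero.1 ((mul_eq_zero.1 g1.symm).resolve_right vd)).resolve_left
      (mul_ne_zero hl hs)
    exact hcx (by linear_combination hsx - c * x * this)

/-- If the numerator of the diagonal of `W` is `τ` times that of `V`, then the commutator case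
degenerates to one of the first two cases. -/
theorem IsCommCase.even_case (K : IsCommCase q c σ s l h)
    (hq : ∀ k : ℕ, 0 < k → q ^ k ≠ 1) (hc0 : c ≠ 0) {τ : ℂ}
    (d1 : τ * b1 = h 0 + (h 3 + h 4) * b1)
    (d2 : τ * b0 + σ * (τ * b1) = (h 2 + (h 3 + h 4) * σ) * b1 + (h 3 + h 4) * b0)
    (d3 : σ * (τ * b0) = -(c * (1 + q) ^ 2) * h 0 + (h 2 + (h 3 + h 4) * σ) * b0)
    (hb : b0 ^ 2 ≠ c * (1 + q) ^ 2 * b1 ^ 2) :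
    h 0 = 0 ∧ h 2 = 0 ∧ ((h 4 = 0 ∧ h 3 = τ ∧ c * s ^ 2 = 1 ∧ l = c * τ) ∨ h 3 = 0) := by
  obtain ⟨hq1, hq2, hq3⟩ := one_sub_ne_zero_of_pow hq
  have hs := K.s_ne
  have hl := K.l_ne
  have hw : τ = h 3 + h 4 := by
    have : (τ - (h 3 + h 4)) * (b0 ^ 2 - c * (1 + q) ^ 2 * b1 ^ 2) = 0 := by
      linear_combination b0 * d2 - b1 * d3 - c * (1 + q) ^ 2 * b1 * d1
    exact sub_eq_zero.1 ((mul_eq_zero.1 this).resolve_right (sub_ne_zero.2 hb))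
  have h0 : h 0 = 0 := by linear_combination -d1 + b1 * hw
  have h2 : h 2 = 0 := by
    have e1 : h 2 * b1 = 0 := by linear_combination -d2 + (b0 + σ * b1) * hw
    have e2 : h 2 * b0 = 0 := by linear_combination -d3 + σ * b0 * hw + c * (1 + q) ^ 2 * h0
    by_contra hne
    apply hb
    rw [(mul_eq_zero.1 e1).resolve_left hne, (mul_eq_zero.1 e2).resolve_left hne]
    ring
  refine ⟨h0, h2, ?_⟩
  have hfac : (1 - c * s ^ 2) * (1 - c * q ^ 2 * s ^ 2) = 0 := by
    have e1 := K.h2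
    rw [h2, K.sigma_eq] at e1
    have e2 := K.h34
    have e3 := K.h43
    field_simp at e1
    apply mul_left_cancel₀ hl
    linear_combination -c * (1 + q) * e1 - (1 + q * c * s ^ 2) * (e2 + c * e3)
  rcases mul_eq_zero.1 hfac with hf | hf
  · left
    have e4 : h 4 = 0 := by
      apply mul_left_cancel₀ (mul_ne_zero hc0 hq3)
      linear_combination c * K.h43 - q * K.h34 - l * q * hf
    exact ⟨e4, by linear_combination -hw - e4, by linear_combination -hf,
      by linear_combination -K.h34 - c * hw + (q * c - c) * e4⟩
  · right
    apply mul_left_cancel₀ (mul_ne_zero hc0 hq3)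
    linear_combination K.h34 - c * q * K.h43 + l * hf

/-- If the numerators of the diagonals of `V` and `W` are exchanged, up to factors with parameter
`η`, then the diagonal equations determine the remaining parameter `l` of the commutator case. -/
theorem IsCommCase.odd_case (K : IsCommCase q c σ s l h) (hq2 : 1 + q ≠ 0) {η : ℂ}
    (e1 : b1' = -η * b0 / (1 + q)) (e0 : b0' = -(1 + q) * c * η * b1)
    (d1 : b1' = h 0 + (h 3 + h 4) * b1)
    (d2 : b0' + σ * b1' = (h 2 + (h 3 + h 4) * σ) * b1 + (h 3 + h 4) * b0)
    (d3 : σ * b0' = -(c * (1 + q) ^ 2) * h 0 + (h 2 + (h 3 + h 4) * σ) * b0)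
    (hb : b0 ^ 2 ≠ c * (1 + q) ^ 2 * b1 ^ 2) :
    l = c * η / s := by
  have hs := K.s_ne
  obtain ⟨w, hw⟩ : ∃ w, w = h 3 + h 4 := ⟨_, rfl⟩
  obtain ⟨T, hT⟩ : ∃ T, T = h 2 + w * σ := ⟨_, rfl⟩
  rw [← hw] at d1
  rw [← hw, ← hT] at d2 d3
  have r1 : (w + σ * η / (1 + q)) * b0 = -(T + (1 + q) * c * η) * b1 := by
    rw [e0, e1] at d2
    field_simp at d2 ⊢
    linear_combination -d2
  have r2 : (T + (1 + q) * c * η) * b0 = -(c * (1 + q) ^ 2) * (w + σ * η / (1 + q)) * b1 := by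
    have : h 0 = -η * b0 / (1 + q) - w * b1 := by rw [← e1, d1]; ring
    rw [e0, this] at d3
    field_simp at d3 ⊢
    linear_combination -d3
  have hTe : T + (1 + q) * c * η = 0 := by
    have : (T + (1 + q) * c * η) * (b0 ^ 2 - c * (1 + q) ^ 2 * b1 ^ 2) = 0 := by
      linear_combination b0 * r2 - c * (1 + q) ^ 2 * b1 * r1
    exact (mul_eq_zero.1 this).resolve_right (sub_ne_zero.2 hb)
  have hK := K.h2
  rw [← hw, ← hT] at hK
  rw [hK] at hTe
  rw [eq_div_iff hs]
  apply mul_left_cancel₀ hq2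
  linear_combination -hTe

end

/-- The inequalities that are assumed of generic parameters. -/
structure IsGeneric (N : ℕ) (q α β δ : ℂ) : Prop where
  a_ne : α ≠ 0
  b_ne : β ≠ 0
  d_ne : δ ≠ 0
  regular : IsRegular N q α β δ
  regular' : IsRegular N q α β (α / (β * δ))
  ab : α ≠ β
  a_qb : α ≠ q ^ 2 * β
  b_qa : β ≠ q ^ 2 * α
  bdd_a : β * δ ^ 2 ≠ α
  bdd_qa : β * δ ^ 2 ≠ q ^ 2 * α
  qbdd_a : q ^ 2 * β * δ ^ 2 ≠ α
  bd_a : α ≠ β * δ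

section

variable {N : ℕ} {q α β δ : ℂ}

theorem mul_ne_gam_sq (hq0 : q ≠ 0) (hR : IsRegular N q α β δ) : α * β ≠ gam q N ^ 2 := by
  intro h
  apply hR.ab (2 * N + 2) le_rfl
  have : q ^ (N + 1) ≠ 0 := pow_ne_zero _ hq0
  rw [h, gam, show 2 * N + 2 = (N + 1) * 2 by ring, pow_mul]
  field_simp

/-- The numerator of the diagonal coefficient is not an eigenvector of the exchange of its two
coefficients. -/
theorem racahB0_sq_ne {γ : ℂ} (hq0 : q ≠ 0) (hq2 : 1 + q ≠ 0) (h1 : α ≠ β) (h2 : β * δ ^ 2 ≠ α)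
    (h3 : α * β ≠ 1) (h4 : α * β ≠ γ ^ 2) :
    racahB0 q α β γ δ ^ 2 ≠ α * β * (1 + q) ^ 2 * psi q α β γ δ ^ 2 := by
  rw [← sub_ne_zero, racahB0_sq_sub]
  exact mul_ne_zero (mul_ne_zero (pow_ne_zero 2 hq2) (pow_ne_zero 2 hq0))
    (mul_ne_zero (mul_ne_zero (mul_ne_zero (sub_ne_zero.2 h1.symm) (sub_ne_zero.2 h2.symm))
      (sub_ne_zero.2 h3.symm)) (sub_ne_zero.2 h4))

/-- The quadratic polynomial in `Y` that carries the dependence of the product of opposite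
off-diagonal entries on the parameters, see `racahC_mul_racahA`. -/
def offdiagPoly (α β δ Y : ℂ) : ℂ := (Y - (α + β)) * (δ * Y - (α + β * δ ^ 2))

theorem exists_offdiag_factor {α' β' γ δ' : ℂ} (hq0 : q ≠ 0) (hab : α' * β' = α * β) (i : ℕ)
    (hne : racahC q α β γ δ (i + 1) * racahA q α β γ δ i ≠ 0) :
    ∃ K, K ≠ 0 ∧
      racahC q α β γ δ (i + 1) * racahA q α β γ δ i =
        K * offdiagPoly α β δ ((q ^ (i + 1))⁻¹ + α * β * q ^ (i + 1)) ∧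
      racahC q α' β' γ δ' (i + 1) * racahA q α' β' γ δ' i =
        K * offdiagPoly α' β' δ' ((q ^ (i + 1))⁻¹ + α * β * q ^ (i + 1)) := by
  have h1 := racahC_mul_racahA (α := α) (β := β) (γ := γ) (δ := δ) hq0 i
  have h2 := racahC_mul_racahA (α := α') (β := β') (γ := γ) (δ := δ') hq0 i
  rw [hab] at h2
  rw [h1] at hne
  exact ⟨_, left_ne_zero_of_mul hne, h1, h2⟩

/-- If the products of opposite off-diagonal entries are proportional, so are the polynomials. -/
theorem offdiagPoly_coefficients {α' β' γ δ' ρ : ℂ} (hq0 : q ≠ 0)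
    (hq : ∀ k : ℕ, 0 < k → q ^ k ≠ 1) (hc : ∀ i ≤ 10, α * β * q ^ i ≠ 1)
    (hab : α' * β' = α * β)
    (hne : ∀ i < 4, racahC q α β γ δ (i + 1) * racahA q α β γ δ i ≠ 0)
    (h : ∀ i < 4, racahC q α' β' γ δ' (i + 1) * racahA q α' β' γ δ' i =
      ρ * (racahC q α β γ δ (i + 1) * racahA q α β γ δ i)) :
    δ' = ρ * δ ∧
    δ' * (α' + β') + (α' + β' * δ' ^ 2) = ρ * (δ * (α + β) + (α + β * δ ^ 2)) ∧
    (α' + β') * (α' + β' * δ' ^ 2) = ρ * ((α + β) * (α + β * δ ^ 2)) := by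
  obtain ⟨e0, e1, e2, -⟩ := cubic_interpolation (c3 := 0)
    (y := fun i => (q ^ (i + 1))⁻¹ + α * β * q ^ (i + 1))
    (c0 := (α' + β') * (α' + β' * δ' ^ 2) - ρ * ((α + β) * (α + β * δ ^ 2)))
    (c1 := -(δ' * (α' + β') + (α' + β' * δ' ^ 2)) + ρ * (δ * (α + β) + (α + β * δ ^ 2)))
    (c2 := δ' - ρ * δ)
    (fun i hi j hj hij => inv_pow_add_ne hq0 hq hij (hc _ (by omega)))
    (fun i hi => by
      obtain ⟨K, hK, e, e'⟩ := exists_offdiag_factor (δ' := δ') hq0 hab i (hne i hi)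
      have := h i hi
      rw [e, e', offdiagPoly, offdiagPoly] at this
      apply mul_left_cancel₀ hK
      linear_combination this)
  exact ⟨by linear_combination e2, by linear_combination -e1, by linear_combination e0⟩

end

section

variable {N : ℕ} {q α β δ α' β' δ' σ s l : ℂ} {ν : ℕ → ℂ} {h : Fin 10 → ℂ}

/-- In the commutator case the Heun relations reduce to `W Z = h₃ V Z` with `W = h₃ V`, or to
`W Z = h₄ Z V`, or the parameters are those of the one-parameter family. -/
theorem RacahHeunEqs.of_isCommCase (H : RacahHeunEqs N q α β δ α' β' δ' σ ν h)
    (K : IsCommCase q (α * β) σ s l h) (hN : 4 ≤ N) (hq0 : q ≠ 0)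
    (hq : ∀ k : ℕ, 0 < k → q ^ k ≠ 1) (hG : IsGeneric N q α β δ) (hab : α' * β' = α * β)
    (hν : ∀ i, 1 ≤ i → i ≤ N → ν i ≠ 0) :
    (h 0 = 0 ∧ h 1 = 0 ∧ h 2 = 0 ∧ h 4 = 0 ∧
      (∀ i < N, racahC q α' β' (gam q N) δ' (i + 1) * ν (i + 1) =
        h 3 * racahC q α β (gam q N) δ (i + 1)) ∧
      (∀ i < N, racahA q α' β' (gam q N) δ' i * (1 / ν (i + 1)) =
        h 3 * racahA q α β (gam q N) δ i) ∧
      racahB0 q α' β' (gam q N) δ' = h 3 * racahB0 q α β (gam q N) δ ∧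
      psi q α' β' (gam q N) δ' = h 3 * psi q α β (gam q N) δ) ∨
    (h 0 = 0 ∧ h 1 = 0 ∧ h 2 = 0 ∧ h 3 = 0) ∨
    ∃ η, η ≠ 0 ∧ ((η = 1 / (β * δ) ∧ δ' = α / (β * δ) ∧ (α' = α ∨ α' = α / δ)) ∨
        (η = 1 / α ∧ δ' = β * δ / α ∧ (α' = β ∨ α' = β * δ))) ∧
      psi q α' β' (gam q N) δ' = -η * racahB0 q α β (gam q N) δ / (1 + q) ∧
      racahB0 q α' β' (gam q N) δ' = -(1 + q) * (α * β) * η * psi q α β (gam q N) δ ∧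
      l = α * β * η / s := by
  obtain ⟨hq1, hq2, -⟩ := one_sub_ne_zero_of_pow hq
  have hR := hG.regular
  have hc10 : ∀ i ≤ 10, α * β * q ^ i ≠ 1 := fun i hi => hR.ab i (by omega)
  have hc0 : α * β ≠ 0 := mul_ne_zero hG.a_ne hG.b_ne
  have hs := K.s_ne
  have hl := K.l_ne
  have hoff := fun i hi => H.offdiag_of_isCommCase K hq0 hq hc0 hR.ab (i := i) hi
  obtain ⟨⟨h1, d1, d2, d3⟩, -⟩ := H.diag_coefficients hN hq0 hq hc10
  have hb := racahB0_sq_ne (γ := gam q N) hq0 hq2 hG.ab hG.bdd_a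
    (by simpa using hR.ab 0 (by omega)) (mul_ne_gam_sq hq0 hR)
  obtain ⟨e2, e1, e0⟩ := offdiagPoly_coefficients (ρ := l ^ 2 * s ^ 2 / (α * β)) hq0 hq hc10 hab
    (fun i hi => mul_ne_zero (H.vd i (by omega)) (H.vu i (by omega))) fun i hi => by
      obtain ⟨g1, g2, g3, g4⟩ := hoff i (by omega)
      have hνi := hν (i + 1) (by omega) (by omega)
      rw [← sub_ne_zero] at g1
      have g2 := sub_ne_zero.2 g2.symm
      rw [div_mul_eq_mul_div, eq_div_iff hc0]
      apply mul_right_cancel₀ (mul_ne_zero g2 g1)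
      have e : racahC q α' β' (gam q N) δ' (i + 1) * racahA q α' β' (gam q N) δ' i =
          (racahC q α' β' (gam q N) δ' (i + 1) * ν (i + 1)) *
            (racahA q α' β' (gam q N) δ' i * (1 / ν (i + 1))) := by field_simp
      rw [e]
      linear_combination (racahA q α' β' (gam q N) δ' i * (1 / ν (i + 1))) *
        (α * β) * (s - q ^ (i + 1)) * g3 + l * s * (s - q ^ (i + 1)) *
          racahC q α β (gam q N) δ (i + 1) * g4
  rcases match_parameters (γ := gam q N) hq2 hG.a_ne hG.b_ne hG.d_ne
    (div_ne_zero (mul_ne_zero (pow_ne_zero 2 hl) (pow_ne_zero 2 hs)) hc0) hab e2 e1 e0 with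
    ⟨τ, -, -, t1, t0⟩ | ⟨η, hη, hcase, t1, t0⟩
  · rw [t1] at d1 d2
    rw [t0] at d2 d3
    obtain ⟨h0, h2, h34⟩ := K.even_case hq hc0 d1 d2 d3 hb
    rcases h34 with ⟨h4, h3, hcs, hlτ⟩ | h3
    · subst h3
      refine Or.inl ⟨h0, h1, h2, h4, fun i hi => ?_, fun i hi => ?_, t0, t1⟩
      · obtain ⟨g1, -, g3, -⟩ := hoff i hi
        have g1 := sub_ne_zero.2 g1
        apply mul_right_cancel₀ g1
        have hcs' : α * β * s * s = 1 := by linear_combination hcs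
        have := congrArg (fun y => s * y) g3
        rw [hlτ] at this
        linear_combination this + (racahC q α' β' (gam q N) δ' (i + 1) * ν (i + 1) *
          q ^ (i + 1) + h 3 * s * racahC q α β (gam q N) δ (i + 1) -
            h 3 * q ^ (i + 1) * racahC q α β (gam q N) δ (i + 1)) * hcs'
      · obtain ⟨g1, -, -, g4⟩ := hoff i hi
        have g1 := sub_ne_zero.2 g1
        apply mul_right_cancel₀ (mul_ne_zero g1 hc0)
        have hcs' : α * β * s * s = 1 := by linear_combination hcs
        rw [hlτ] at g4
        linear_combination g4 - h 3 * racahA q α β (gam q N) δ i * (α * β) * q ^ (i + 1) * hcs'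
    · exact Or.inr (Or.inl ⟨h0, h1, h2, h3⟩)
  · exact Or.inr (Or.inr ⟨η, hη, hcase, t1, t0,
      K.odd_case hq2 t1 t0 d1 d2 d3 hb⟩)

end

/-! ### The anticommutator case -/

section

variable {N : ℕ} {q c σ s l : ℂ} {Vd Vu Wd Wu : ℕ → ℂ} {b0 b1 b0' b1' : ℂ} {h : Fin 10 → ℂ}

/-- The off-diagonal entries of `W` in the anticommutator case, see
`HeunEqs.offdiag_of_isCommCase`. -/
theorem HeunEqs.offdiag_of_isAnticommCase (H : HeunEqs N q c σ Vd Vu Wd Wu b0 b1 b0' b1' h)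
    (K : IsAnticommCase q c σ s l h) (hq0 : q ≠ 0) (hq : ∀ k : ℕ, 0 < k → q ^ k ≠ 1) (hc0 : c ≠ 0)
    {i : ℕ} (hi : i < N) :
    Wd i * (1 - c * s * q ^ (i + 1)) = l / (c * q) * (1 - c * q * s * q ^ (i + 1)) * Vd i ∧
    Wu i * (s - q ^ (i + 1)) = l / (c * q) * (q * s - q ^ (i + 1)) * Vu i := by
  obtain ⟨hq1, -, -⟩ := one_sub_ne_zero_of_pow hq
  have hs := K.s_ne
  have hl := K.l_ne
  have hx : q ^ (i + 1) ≠ 0 := pow_ne_zero _ hq0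
  obtain ⟨za, zb⟩ := grid_add_eq (c := c) hq0 hs K.sigma_eq i
  have hd := H.down i hi
  have hd' := H.down' i hi
  have hu := H.up i hi
  have hu' := H.up' i hi
  have e34 : h 3 + q * h 4 = l / c := by rw [← K.h34]; field_simp
  rw [(heun_coef_eq hq0 i (h 2) (h 3) (h 4)).1, K.h34, K.h43, K.h2, za] at hd
  rw [(heun_coef_eq hq0 i (h 7) (h 8) (h 9)).1, K.h89, K.h98, K.h7, zb] at hd'
  rw [(heun_coef_eq hq0 i (h 2) (h 3) (h 4)).2, K.h43, K.h2, zb, e34] at hu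
  rw [(heun_coef_eq hq0 i (h 7) (h 8) (h 9)).2, K.h89, K.h98, K.h7, za] at hu'
  generalize q ^ (i + 1) = x at *
  generalize Wd i = A at *
  generalize Vd i = B at *
  generalize Wu i = A' at *
  generalize Vu i = B' at *
  have r1 : (q * s - x) * (A * (1 - c * s * x) - l / (c * q) * (1 - c * q * s * x) * B) = 0 := by
    field_simp at hd ⊢
    linear_combination hd
  have r2 : (s - x) * (A * (1 - c * s * x) - l / (c * q) * (1 - c * q * s * x) * B) = 0 := by
    field_simp at hd' ⊢
    linear_combination -hd'
  have r3 : (1 - c * q * s * x) * (A' * (s - x) - l / (c * q) * (q * s - x) * B') = 0 := by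
    field_simp at hu ⊢
    linear_combination hu
  have r4 : (1 - c * s * x) * (A' * (s - x) - l / (c * q) * (q * s - x) * B') = 0 := by
    field_simp at hu' ⊢
    linear_combination -hu'
  constructor
  · apply sub_eq_zero.1
    apply mul_left_cancel₀ (mul_ne_zero hq1 hs)
    linear_combination r2 - r1
  · apply sub_eq_zero.1
    apply mul_left_cancel₀ hq1
    linear_combination r3 - q * r4

end

section

variable {N : ℕ} {q α β γ δ α' β' δ' g s : ℂ}

/-- The anticommutator case for `s = 1 / α`: the operator `W` has, up to the factor `g`, the
parameters `(α / q, q β, δ / q)`. -/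
theorem anticomm_parameters (hq0 : q ≠ 0) (hq2 : 1 + q ≠ 0) (hα : α ≠ 0) (hβ : β ≠ 0)
    (hδ : δ ≠ 0) (hg : g ≠ 0) (n1 : α ≠ β) (n2 : α ≠ q ^ 2 * β) (n3 : β * δ ^ 2 ≠ α)
    (n4 : α * β ≠ 1) (n5 : α * β ≠ γ ^ 2) (hab : α' * β' = α * β) (hs : s * α = 1)
    (hid : ∀ Y, offdiagPoly α' β' δ' Y * (s * Y - (1 + α * β * s ^ 2)) =
      (g / q) ^ 2 * offdiagPoly α β δ Y * (q * s * Y - (1 + α * β * q ^ 2 * s ^ 2)))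
    (d1 : -(α + q * β) * racahB0 q α' β' γ δ' + α * β * (1 + q) ^ 2 * psi q α' β' γ δ' =
      -g * (q * β + α / q) * racahB0 q α β γ δ +
        α * β * (1 + q) ^ 2 * (2 * g / (1 + q)) * psi q α β γ δ)
    (d2 : racahB0 q α' β' γ δ' - (α + q * β) * psi q α' β' γ δ' =
      -g * (q * β + α / q) * psi q α β γ δ + 2 * g / (1 + q) * racahB0 q α β γ δ) :
    (g = 1 ∧ δ' = δ / q) ∨ (g = q / δ ∧ δ' = q / δ) := by
  -- the common zero `Y = α + β` is cancelled
  have hid' : ∀ Y, Y ≠ α + β → offdiagPoly α' β' δ' Y =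
      g ^ 2 * offdiagPoly (α / q) (q * β) (δ / q) Y := by
    intro Y hY
    apply mul_right_cancel₀ (sub_ne_zero.2 hY)
    have e : ∀ Y, offdiagPoly (α / q) (q * β) (δ / q) Y =
        (q * Y - (α + q ^ 2 * β)) * (δ * Y - (α + β * δ ^ 2)) / q ^ 2 := by
      intro Y; simp only [offdiagPoly]; field_simp
    have h := congrArg (fun x => α * x) (hid Y)
    rw [e]
    simp only [offdiagPoly] at h ⊢
    have h1 : α * (s * Y - (1 + α * β * s ^ 2)) = Y - (α + β) := by
      linear_combination (Y - β - β * s * α) * hs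
    have h2 : α * (q * s * Y - (1 + α * β * q ^ 2 * s ^ 2)) = q * Y - (α + q ^ 2 * β) := by
      linear_combination (q * Y - q ^ 2 * β - q ^ 2 * β * s * α) * hs
    rw [div_pow] at h
    linear_combination h - (Y - (α' + β')) * (δ' * Y - (α' + β' * δ' ^ 2)) * h1 +
      g ^ 2 / q ^ 2 * ((Y - (α + β)) * (δ * Y - (α + β * δ ^ 2))) * h2
  have hab' : α / q * (q * β) = α * β := by field_simp
  have hρ : g ^ 2 ≠ 0 := pow_ne_zero 2 hg
  obtain ⟨f0, f1, f2, -⟩ := cubic_interpolation (c3 := 0)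
    (y := fun i => α + β + (i + 1 : ℕ))
    (c0 := (α' + β') * (α' + β' * δ' ^ 2) -
      g ^ 2 * ((α / q + q * β) * (α / q + q * β * (δ / q) ^ 2)))
    (c1 := -(δ' * (α' + β') + (α' + β' * δ' ^ 2)) +
      g ^ 2 * (δ / q * (α / q + q * β) + (α / q + q * β * (δ / q) ^ 2)))
    (c2 := δ' - g ^ 2 * (δ / q))
    (fun i hi j hj hij h => hij (by
      have := add_left_cancel h
      have := Nat.cast_injective this
      omega))
    (fun i hi => by
      have hne : α + β + ((i + 1 : ℕ) : ℂ) ≠ α + β := by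
        rw [Ne, add_eq_left]; exact_mod_cast Nat.succ_ne_zero i
      have h := hid' _ hne
      simp only [offdiagPoly] at h
      linear_combination h)
  -- the diagonal of `W` is that of the operator with parameters `(α / q, q β, δ / q)`
  have k1 : -(α + q * β) * racahB0 q (α / q) (q * β) γ (δ / q) +
      α * β * (1 + q) ^ 2 * psi q (α / q) (q * β) γ (δ / q) =
      -(q * β + α / q) * racahB0 q α β γ δ +
        α * β * (1 + q) ^ 2 * (2 / (1 + q)) * psi q α β γ δ := by
    simp only [racahB0, psi]; field_simp; ring
  have k2 : racahB0 q (α / q) (q * β) γ (δ / q) - (α + q * β) * psi q (α / q) (q * β) γ (δ / q) =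
      -(q * β + α / q) * psi q α β γ δ + 2 / (1 + q) * racahB0 q α β γ δ := by
    simp only [racahB0, psi]; field_simp; ring
  have hdet : (α - β) * (α - q ^ 2 * β) ≠ 0 := mul_ne_zero (sub_ne_zero.2 n1) (sub_ne_zero.2 n2)
  have p1 : psi q α' β' γ δ' = g * psi q (α / q) (q * β) γ (δ / q) := by
    apply mul_left_cancel₀ hdet
    linear_combination -(α + q * β) * d2 - d1 + g * (α + q * β) * k2 + g * k1
  have p0 : racahB0 q α' β' γ δ' = g * racahB0 q (α / q) (q * β) γ (δ / q) := by
    linear_combination d2 - g * k2 + (α + q * β) * p1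
  have hb := racahB0_sq_ne (α := α / q) (β := q * β) (δ := δ / q) (γ := γ) hq0 hq2
    (by rw [Ne, div_eq_iff hq0]; intro h; exact n2 (by rw [h]; ring))
    (by
      intro h; apply n3; field_simp at h; exact h)
    (by rwa [hab']) (by rwa [hab'])
  rw [hab'] at hb
  obtain ⟨b1, hb1⟩ : ∃ b, b = psi q (α / q) (q * β) γ (δ / q) := ⟨_, rfl⟩
  obtain ⟨b0, hb0⟩ : ∃ b, b = racahB0 q (α / q) (q * β) γ (δ / q) := ⟨_, rfl⟩
  rw [← hb0, ← hb1] at hb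
  rcases match_parameters (γ := γ) (α := α / q) (β := q * β) (δ := δ / q) (α' := α') (β' := β')
    (δ' := δ') (ρ := g ^ 2) hq2 (div_ne_zero hα hq0) (mul_ne_zero hq0 hβ) (div_ne_zero hδ hq0) hρ
    (by rw [hab', hab])
    (by linear_combination f2) (by linear_combination -f1) (by linear_combination f0) with
    ⟨τ, -, hτ, t1, t0⟩ | ⟨η, hη, -, t1, t0⟩
  · rw [p1, ← hb1] at t1
    rw [p0, ← hb0] at t0
    have hgτ : g = τ := by
      by_contra hne
      apply hb
      have h1 : (g - τ) * b1 = 0 := by linear_combination t1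
      have h0 : (g - τ) * b0 = 0 := by linear_combination t0
      rw [(mul_eq_zero.1 h1).resolve_left (sub_ne_zero.2 hne),
        (mul_eq_zero.1 h0).resolve_left (sub_ne_zero.2 hne)]
      ring
    rcases hτ with ⟨h1, h2⟩ | ⟨h1, h2⟩
    · exact Or.inl ⟨by rw [hgτ, h1], h2⟩
    · exact Or.inr ⟨by rw [hgτ, h1]; field_simp, by rw [h2]; field_simp⟩
  · exfalso
    apply hb
    rw [p1, ← hb0, ← hb1] at t1
    rw [p0, ← hb0, ← hb1, hab'] at t0
    apply mul_left_cancel₀ hg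
    rw [eq_div_iff hq2] at t1
    linear_combination b0 * t0 - α * β * (1 + q) * b1 * t1

/-- The possible values of `δ'` and of the Heun coefficients in the anticommutator case. The four
choices for `s` are related by the symmetries `(α, β, δ) ↦ (β, α, 1 / δ)` and
`(α, β, δ) ↦ (β δ, α / δ, δ)` of the `q`-Racah operator, which rescale it by `1 / δ` and `1`. -/
theorem RacahHeunEqs.of_isAnticommCase {σ l : ℂ} {ν : ℕ → ℂ} {h : Fin 10 → ℂ}
    (H : RacahHeunEqs N q α β δ α' β' δ' σ ν h)
    (K : IsAnticommCase q (α * β) σ s l h) (hN : 4 ≤ N) (hq0 : q ≠ 0)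
    (hq : ∀ k : ℕ, 0 < k → q ^ k ≠ 1) (hG : IsGeneric N q α β δ) (hab : α' * β' = α * β)
    (hν : ∀ i, 1 ≤ i → i ≤ N → ν i ≠ 0) :
    ∃ g, h 1 = 0 ∧ h 3 = g / (1 + q) ∧ h 4 = g / (1 + q) ∧
      ((g = 1 ∧ δ' = δ / q) ∨ (g = q / δ ∧ δ' = q / δ) ∨ (g = 1 / δ ∧ δ' = 1 / (q * δ)) ∨
        (g = q ∧ δ' = q * δ)) := by
  obtain ⟨hq1, hq2, -⟩ := one_sub_ne_zero_of_pow hq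
  have hR := hG.regular
  have hα := hG.a_ne
  have hβ := hG.b_ne
  have hδ := hG.d_ne
  have hc10 : ∀ i ≤ 10, α * β * q ^ i ≠ 1 := fun i hi => hR.ab i (by omega)
  have hc0 : α * β ≠ 0 := mul_ne_zero hα hβ
  have hs := K.s_ne
  have hl := K.l_ne
  have hcs := K.generic
  obtain ⟨⟨h1, d1, d2, d3⟩, -⟩ := H.diag_coefficients hN hq0 hq hc10
  obtain ⟨g, hgl⟩ : ∃ g, g = l / (α * β) := ⟨_, rfl⟩
  have hg : g ≠ 0 := by rw [hgl]; exact div_ne_zero hl hc0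
  have e34 : h 3 + q * h 4 = g := by rw [hgl, ← K.h34]; field_simp
  have e43 : q * h 3 + h 4 = g := by rw [hgl, K.h43]
  have e3 : h 3 = g / (1 + q) := by
    rw [eq_div_iff hq2]
    apply mul_left_cancel₀ hq1
    linear_combination e34 - q * e43
  have e4 : h 4 = g / (1 + q) := by
    rw [eq_div_iff hq2]
    apply mul_left_cancel₀ hq1
    linear_combination e43 - q * e34
  refine ⟨g, h1, e3, e4, ?_⟩
  have hw : h 3 + h 4 = 2 * g / (1 + q) := by rw [e3, e4]; ring
  have hT := K.h2
  rw [hw] at d1 d2 hT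
  rw [hw, hT] at d3
  rw [hT] at d2
  have hlg : l = g * (α * β) := by rw [hgl]; field_simp
  -- the product of opposite off-diagonal entries
  obtain ⟨c0, c1, c2, c3⟩ := cubic_interpolation
    (y := fun i => (q ^ (i + 1))⁻¹ + α * β * q ^ (i + 1))
    (c0 := -((α' + β') * (α' + β' * δ' ^ 2)) * (1 + α * β * s ^ 2) +
      (g / q) ^ 2 * ((α + β) * (α + β * δ ^ 2)) * (1 + α * β * q ^ 2 * s ^ 2))
    (c1 := (α' + β') * (α' + β' * δ' ^ 2) * s +
      (δ' * (α' + β') + (α' + β' * δ' ^ 2)) * (1 + α * β * s ^ 2) -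
      (g / q) ^ 2 * ((α + β) * (α + β * δ ^ 2) * (q * s) +
        (δ * (α + β) + (α + β * δ ^ 2)) * (1 + α * β * q ^ 2 * s ^ 2)))
    (c2 := -(δ' * (α' + β') + (α' + β' * δ' ^ 2)) * s - δ' * (1 + α * β * s ^ 2) +
      (g / q) ^ 2 * ((δ * (α + β) + (α + β * δ ^ 2)) * (q * s) +
        δ * (1 + α * β * q ^ 2 * s ^ 2)))
    (c3 := δ' * s - (g / q) ^ 2 * (δ * (q * s)))
    (fun i hi j hj hij => inv_pow_add_ne hq0 hq hij (hc10 _ (by omega)))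
    (fun i hi => by
      obtain ⟨k, hk, e, e'⟩ := exists_offdiag_factor (δ' := δ') hq0 hab i
        (mul_ne_zero (H.vd i (by omega)) (H.vu i (by omega)))
      obtain ⟨g1, g2⟩ := H.offdiag_of_isAnticommCase K hq0 hq hc0 (i := i) (by omega)
      have hνi := hν (i + 1) (by omega) (by omega)
      have hx : q ^ (i + 1) ≠ 0 := pow_ne_zero _ hq0
      have ew : racahC q α' β' (gam q N) δ' (i + 1) * racahA q α' β' (gam q N) δ' i =
          (racahC q α' β' (gam q N) δ' (i + 1) * ν (i + 1)) *
            (racahA q α' β' (gam q N) δ' i * (1 / ν (i + 1))) := by field_simp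
      have el : l / (α * β * q) = g / q := by rw [hlg]; field_simp
      rw [el] at g1 g2
      have hprod : racahC q α' β' (gam q N) δ' (i + 1) * racahA q α' β' (gam q N) δ' i *
          ((1 - α * β * s * q ^ (i + 1)) * (s - q ^ (i + 1))) =
          (g / q) ^ 2 * (racahC q α β (gam q N) δ (i + 1) * racahA q α β (gam q N) δ i) *
          ((1 - α * β * q * s * q ^ (i + 1)) * (q * s - q ^ (i + 1))) := by
        rw [ew]
        linear_combination (racahA q α' β' (gam q N) δ' i * (1 / ν (i + 1))) *
          (s - q ^ (i + 1)) * g1 + g / q * (1 - α * β * q * s * q ^ (i + 1)) *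
            racahC q α β (gam q N) δ (i + 1) * g2
      rw [e, e'] at hprod
      have y1 : (1 - α * β * s * q ^ (i + 1)) * (s - q ^ (i + 1)) = q ^ (i + 1) *
          (s * ((q ^ (i + 1))⁻¹ + α * β * q ^ (i + 1)) - (1 + α * β * s ^ 2)) := by
        field_simp; ring
      have y2 : (1 - α * β * q * s * q ^ (i + 1)) * (q * s - q ^ (i + 1)) = q ^ (i + 1) *
          (q * s * ((q ^ (i + 1))⁻¹ + α * β * q ^ (i + 1)) - (1 + α * β * q ^ 2 * s ^ 2)) := by
        field_simp; ring
      rw [y1, y2] at hprod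
      simp only [offdiagPoly] at hprod
      apply mul_left_cancel₀ (mul_ne_zero hk hx)
      generalize (q ^ (i + 1))⁻¹ + α * β * q ^ (i + 1) = Y at *
      linear_combination hprod)
  have hid : ∀ Y, offdiagPoly α' β' δ' Y * (s * Y - (1 + α * β * s ^ 2)) =
      (g / q) ^ 2 * offdiagPoly α β δ Y * (q * s * Y - (1 + α * β * q ^ 2 * s ^ 2)) := by
    intro Y
    simp only [offdiagPoly]
    linear_combination c0 + Y * c1 + Y ^ 2 * c2 + Y ^ 3 * c3
  -- evaluation at the zero of the first factor determines `s`
  have hroot : (1 - α * s) * (1 - β * s) * ((1 - β * δ * s) * (δ - α * s)) = 0 := by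
    have e := hid (1 / s + α * β * s)
    have z1 : s * (1 / s + α * β * s) - (1 + α * β * s ^ 2) = 0 := by field_simp; ring
    have z2 : q * s * (1 / s + α * β * s) - (1 + α * β * q ^ 2 * s ^ 2) =
        -((1 - q) * (1 - α * β * q * s ^ 2)) := by field_simp; ring
    have z3 : offdiagPoly α β δ (1 / s + α * β * s) =
        (1 - α * s) * (1 - β * s) * ((1 - β * δ * s) * (δ - α * s)) / s ^ 2 := by
      simp only [offdiagPoly]; field_simp; ring
    rw [z1, z2, z3, mul_zero] at e
    have n1 : (g / q) ^ 2 ≠ 0 := pow_ne_zero 2 (div_ne_zero hg hq0)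
    have n2 : -((1 - q) * (1 - α * β * q * s ^ 2)) ≠ 0 :=
      neg_ne_zero.2 (mul_ne_zero hq1 (sub_ne_zero.2 hcs.symm))
    have := (mul_eq_zero.1 ((mul_eq_zero.1 e.symm).resolve_right n2)).resolve_left n1
    exact (div_eq_zero_iff.1 this).resolve_right (pow_ne_zero 2 hs)
  have nab1 : α * β ≠ 1 := by simpa using hR.ab 0 (by omega)
  have ngam := mul_ne_gam_sq hq0 hR
  have E1 : σ * racahB0 q α' β' (gam q N) δ' +
      α * β * (1 + q) ^ 2 * psi q α' β' (gam q N) δ' =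
      -l * (q * s + 1 / (α * β * q * s)) * racahB0 q α β (gam q N) δ +
        α * β * (1 + q) ^ 2 * (2 * g / (1 + q)) * psi q α β (gam q N) δ := by
    linear_combination d3 + α * β * (1 + q) ^ 2 * d1
  have E2 : racahB0 q α' β' (gam q N) δ' + σ * psi q α' β' (gam q N) δ' =
      -l * (q * s + 1 / (α * β * q * s)) * psi q α β (gam q N) δ +
        2 * g / (1 + q) * racahB0 q α β (gam q N) δ := d2
  -- reduction to `s = 1 / α` by the symmetries of the parameters
  have star : ∀ {a b d τ : ℂ}, a ≠ 0 → b ≠ 0 → d ≠ 0 → τ ≠ 0 → a * b = α * β → s * a = 1 →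
      a ≠ b → a ≠ q ^ 2 * b → b * d ^ 2 ≠ a →
      (∀ Y, offdiagPoly a b d Y = τ ^ 2 * offdiagPoly α β δ Y) →
      racahB0 q a b (gam q N) d = τ * racahB0 q α β (gam q N) δ →
      psi q a b (gam q N) d = τ * psi q α β (gam q N) δ →
      (g / τ = 1 ∧ δ' = d / q) ∨ (g / τ = q / d ∧ δ' = q / d) := by
    intro a b d τ ha hb hd hτ hab0 hsa n1 n2 n3 hF hB0 hB1
    have hsa' : s = 1 / a := by field_simp; exact hsa
    have hσ : σ = -(a + q * b) := by
      rw [K.sigma_eq, ← hab0, hsa']; field_simp; ring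
    have hT' : -l * (q * s + 1 / (α * β * q * s)) = -g * (q * b + a / q) := by
      rw [hlg, ← hab0, hsa']; field_simp
    rw [hσ, hT', ← hab0] at E1
    rw [hσ, hT'] at E2
    refine anticomm_parameters (γ := gam q N) (g := g / τ) hq0 hq2 ha hb hd (div_ne_zero hg hτ)
      n1 n2 n3 (by rwa [hab0]) (by rwa [hab0]) (by rw [hab, hab0]) hsa ?_ ?_ ?_
    · intro Y
      rw [hF, hab0, hid]
      field_simp
    · rw [E1, hB0, hB1]
      field_simp
    · rw [hB0, hB1]
      have : ∀ x y : ℂ, -(g / τ) * (q * b + a / q) * (τ * x) + 2 * (g / τ) / (1 + q) * (τ * y) =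
          -g * (q * b + a / q) * x + 2 * g / (1 + q) * y := by
        intro x y; field_simp
      rw [this]
      linear_combination E2
  rcases mul_eq_zero.1 hroot with h12 | h34
  · rcases mul_eq_zero.1 h12 with hz | hz
    · rcases star (a := α) (b := β) (d := δ) (τ := 1) hα hβ hδ one_ne_zero rfl
        (by linear_combination -hz) hG.ab hG.a_qb hG.bdd_a (fun Y => by ring) (by ring) (by ring)
        with ⟨h1, h2⟩ | ⟨h1, h2⟩
      · exact Or.inl ⟨by simpa using h1, h2⟩
      · exact Or.inr (Or.inl ⟨by simpa using h1, h2⟩)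
    · rcases star (a := β) (b := α) (d := 1 / δ) (τ := 1 / δ) hβ hα (one_div_ne_zero hδ)
        (one_div_ne_zero hδ) (mul_comm _ _) (by linear_combination -hz) hG.ab.symm hG.b_qa
        (fun h => hG.bdd_a (by field_simp at h; linear_combination -h))
        (fun Y => by simp only [offdiagPoly]; field_simp; ring)
        (by simp only [racahB0]; field_simp; ring) (by simp only [psi]; field_simp; ring)
        with ⟨h1, h2⟩ | ⟨h1, h2⟩
      · refine Or.inr (Or.inr (Or.inl ⟨?_, by rw [h2]; field_simp⟩))
        field_simp at h1 ⊢; exact h1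
      · refine Or.inr (Or.inr (Or.inr ⟨?_, by rw [h2]; field_simp⟩))
        field_simp at h1; exact h1
  · rcases mul_eq_zero.1 h34 with hz | hz
    · rcases star (a := β * δ) (b := α / δ) (d := δ) (τ := 1) (mul_ne_zero hβ hδ)
        (div_ne_zero hα hδ) hδ one_ne_zero (by field_simp) (by linear_combination -hz)
        (fun h => hG.bdd_a (by field_simp at h; linear_combination h))
        (fun h => hG.bdd_qa (by field_simp at h; linear_combination h))
        (fun h => hG.ab (by field_simp at h; exact h))
        (fun Y => by simp only [offdiagPoly]; field_simp; ring)
        (by simp only [racahB0]; field_simp; ring) (by simp only [psi]; field_simp; ring)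
        with ⟨h1, h2⟩ | ⟨h1, h2⟩
      · exact Or.inl ⟨by simpa using h1, h2⟩
      · exact Or.inr (Or.inl ⟨by simpa using h1, h2⟩)
    · rcases star (a := α / δ) (b := β * δ) (d := 1 / δ) (τ := 1 / δ) (div_ne_zero hα hδ)
        (mul_ne_zero hβ hδ) (one_div_ne_zero hδ) (one_div_ne_zero hδ) (by field_simp)
        (by field_simp; linear_combination -hz)
        (fun h => hG.bdd_a (by field_simp at h; linear_combination -h))
        (fun h => hG.qbdd_a (by field_simp at h; linear_combination -h))
        (fun h => hG.ab (by field_simp at h; exact h.symm))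
        (fun Y => by simp only [offdiagPoly]; field_simp)
        (by simp only [racahB0]; field_simp; ring) (by simp only [psi]; field_simp; ring)
        with ⟨h1, h2⟩ | ⟨h1, h2⟩
      · refine Or.inr (Or.inr (Or.inl ⟨?_, by rw [h2]; field_simp⟩))
        field_simp at h1 ⊢; exact h1
      · refine Or.inr (Or.inr (Or.inr ⟨?_, by rw [h2]; field_simp⟩))
        field_simp at h1; exact h1

end

/-! ### Exclusion of degenerate solutions -/

/-- If `W = τ V`, then all `τ λ_n` are eigenvalues of `W`, against the first condition. -/
theorem not_cond1_of_smul {N : ℕ} (hN : 0 < N) {V W Z : Module.End ℂ E}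
    {v w : Module.Basis (Fin (N + 1)) ℂ E} (hB : IsLTBases V W Z v w) {τ : ℂ} (hW : W = τ • V) :
    ¬ Cond1 W Z v w := by
  intro hC
  let n : Fin N := ⟨0, hN⟩
  have hv : W (v n.succ) = (τ * mat v V n.succ n.succ) • v n.succ := by
    rw [hW, LinearMap.smul_apply, apply_basis_of_isDiag hB.diag_V.1, smul_smul]
  obtain ⟨x, hx⟩ := exists_diag_eq_of_eigenvector hB.diag_W.1 (v.ne_zero _) hv
  apply hC n x
  rw [hx, hW, smul_mul_assoc, mat_smul, mat_mul_of_isDiag_left hB.diag_V.1]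
  ring

/-- If `W Z = τ Z V`, then `Z` maps eigenvectors of `V` for `λ` to eigenvectors of `W` for `τ λ`,
against the first condition. -/
theorem not_cond1_of_mul_eq {N : ℕ} (hN : 0 < N) {V W Z : Module.End ℂ E}
    {v w : Module.Basis (Fin (N + 1)) ℂ E} (hB : IsLTBases V W Z v w) {τ : ℂ}
    (hW : W * Z = τ • (Z * V)) : ¬ Cond1 W Z v w := by
  intro hC
  let n : Fin N := ⟨0, hN⟩
  have hmat : mat v (W * Z) n.succ n.castSucc =
      τ * mat v V n.castSucc n.castSucc * mat v Z n.succ n.castSucc := by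
    rw [hW, mat_smul, mat_mul_of_isDiag_right hB.diag_V.1]; ring
  have hne : Z (v n.castSucc) ≠ 0 := by
    intro h0
    apply hC n 0
    have : mat v Z n.succ n.castSucc = 0 := by rw [mat_apply_eq_repr, h0]; simp
    rw [hmat, this]; ring
  have hv : W (Z (v n.castSucc)) =
      (τ * mat v V n.castSucc n.castSucc) • Z (v n.castSucc) := by
    have := congrArg (fun f => f (v n.castSucc)) hW
    simp only [Module.End.mul_apply, LinearMap.smul_apply] at this
    rw [this, apply_basis_of_isDiag hB.diag_V.1, map_smul, smul_smul]
  obtain ⟨x, hx⟩ := exists_diag_eq_of_eigenvector hB.diag_W.1 hne hv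
  apply hC n x
  rw [hx, hmat]
  ring

section

variable {N : ℕ} {q α β δ α' β' δ' σ : ℂ} {ν : ℕ → ℂ} {h : Fin 10 → ℂ}

theorem grid_add_grid_succ (hq0 : q ≠ 0) (c : ℂ) (m : ℕ) :
    grid q c m + grid q c (m + 1) = (1 + q) * ((q ^ (m + 1))⁻¹ + c * q ^ (m + 1)) := by
  have hx : q ^ m ≠ 0 := pow_ne_zero _ hq0
  simp only [grid, pow_succ]
  field_simp
  ring

/-- In the anticommutator case an eigenvalue of `W` is a multiple of the sum of two neighbouring
eigenvalues of `V`, which contradicts the non-degeneracy. -/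
theorem not_cond1_of_anticomm (z : Module.Basis (Fin (N + 1)) ℂ E) (hN : 0 < N) (hq0 : q ≠ 0)
    (hq : ∀ k : ℕ, 0 < k → q ^ k ≠ 1) (hR : IsRegular N q α β δ) (hδ : δ ≠ 0)
    (hab : α' * β' = α * β) (hν : ∀ i, 1 ≤ i → i ≤ N → ν i ≠ 0)
    {v w : Module.Basis (Fin (N + 1)) ℂ E}
    (hB : IsLTBases (opRacah z q α β δ 1) (opRacah z q α' β' δ' ν) (opZ z q α β σ) v w)
    (hH : HeunRelations (opRacah z q α β δ 1) (opRacah z q α' β' δ' ν) (opZ z q α β σ) h)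
    {g : ℂ} (h1 : h 1 = 0) (h3 : h 3 = g / (1 + q)) (h4 : h 4 = g / (1 + q))
    (hg : (g = 1 ∧ δ' = δ / q) ∨ (g = q / δ ∧ δ' = q / δ) ∨ (g = 1 / δ ∧ δ' = 1 / (q * δ)) ∨
        (g = q ∧ δ' = q * δ)) :
    ¬ Cond1 (opRacah z q α' β' δ' ν) (opZ z q α β σ) v w := by
  intro hC
  obtain ⟨-, hq2, -⟩ := one_sub_ne_zero_of_pow hq
  have hV := hB.diag_V.1
  have hWtri := hB.diag_W.1
  have hev : ∀ i, ∃ k : Fin (N + 1), mat v (opRacah z q α β δ 1) i i =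
      grid q (gam q N * δ) k := fun i =>
    (hasEigenvalue_opRacah_iff z hq0 hq δ hR.ab (fun _ _ _ => one_ne_zero) _).1
      (Module.End.hasEigenvalue_of_hasEigenvector
        (Module.End.hasEigenvector_iff.2 ⟨Module.End.mem_eigenspace_iff.2
          (apply_basis_of_isDiag hV i), v.ne_zero i⟩))
  let n : Fin N := ⟨0, hN⟩
  have hne : n.succ ≠ n.castSucc := by
    intro he; simpa [n] using congrArg Fin.val he
  obtain ⟨k0, hk0⟩ := hev n.castSucc
  obtain ⟨k1, hk1⟩ := hev n.succ
  have hX : mat v (opRacah z q α' β' δ' ν * opZ z q α β σ) n.succ n.castSucc =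
      g / (1 + q) * (grid q (gam q N * δ) k0 + grid q (gam q N * δ) k1) *
        mat v (opZ z q α β σ) n.succ n.castSucc := by
    rw [mat_heun_of_ne hH.1 hV hne, h1, h3, h4, hk0, hk1]
    ring
  have hk : k0 ≠ k1 := by
    rintro rfl
    exact hne (hB.diag_V.2 (hk1.trans hk0.symm))
  have hZ : mat v (opZ z q α β σ) n.succ n.castSucc ≠ 0 := by
    intro h0
    apply hC n 0
    rw [hX, h0]; ring
  have hadj : ∃ m, m < N ∧ grid q (gam q N * δ) k0 + grid q (gam q N * δ) k1 =
      grid q (gam q N * δ) m + grid q (gam q N * δ) (m + 1) := by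
    by_contra hcon
    push Not at hcon
    refine hZ (hR.mat_opZ_eq_zero hq0 hq z σ hV hne hk1 hk0 (by omega) (by omega)
      (fun h => hk (Fin.ext h.symm)) (fun he => ?_) (fun he => ?_))
    · refine hcon k1 (by omega) ?_
      rw [he, add_comm]
    · refine hcon k0 (by omega) ?_
      rw [he]
  obtain ⟨m, hm, hsum⟩ := hadj
  rw [hsum, grid_add_grid_succ hq0] at hX
  -- the eigenvalue of `W` in question
  obtain ⟨x, hx, hxe⟩ : ∃ x, x ≤ N ∧ grid q (gam q N * δ') x =
      g * ((q ^ (m + 1))⁻¹ + gam q N * δ * q ^ (m + 1)) := by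
    have hqm : q ^ m ≠ 0 := pow_ne_zero _ hq0
    rcases hg with ⟨rfl, rfl⟩ | ⟨rfl, rfl⟩ | ⟨rfl, rfl⟩ | ⟨rfl, rfl⟩
    · refine ⟨m + 1, by omega, ?_⟩
      simp only [grid, pow_succ]; field_simp
    · obtain ⟨d, rfl⟩ : ∃ d, N = m + 1 + d := ⟨N - (m + 1), by omega⟩
      have hqd : q ^ d ≠ 0 := pow_ne_zero _ hq0
      refine ⟨d, by omega, ?_⟩
      simp only [grid, gam, pow_succ, pow_add]; field_simp; ring
    · obtain ⟨d, rfl⟩ : ∃ d, N = m + 1 + d := ⟨N - (m + 1), by omega⟩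
      have hqd : q ^ d ≠ 0 := pow_ne_zero _ hq0
      refine ⟨d + 1, by omega, ?_⟩
      simp only [grid, gam, pow_succ, pow_add]; field_simp; ring
    · refine ⟨m, by omega, ?_⟩
      simp only [grid, pow_succ]; field_simp
  obtain ⟨u, hu⟩ := ((hasEigenvalue_opRacah_iff z hq0 hq δ' (by rw [hab]; exact hR.ab) hν _).2
    ⟨⟨x, by omega⟩, rfl⟩).exists_hasEigenvector
  obtain ⟨y, hy⟩ := exists_diag_eq_of_eigenvector hB.diag_W.1 hu.2 hu.apply_eq_smul
  apply hC n y
  rw [hy, hX]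
  simp only [hxe]
  field_simp
  ring

/-- In the first two cases of `HeunEqs.exists_cases` the constant term of the first relation
vanishes and the numerator of the diagonal is rescaled. -/
theorem HeunEqs.coef_zero {c : ℂ} {Vd Vu Wd Wu : ℕ → ℂ} {b0 b1 b0' b1' : ℂ}
    (H : HeunEqs N q c σ Vd Vu Wd Wu b0 b1 b0' b1' h) (hN : 4 ≤ N)
    (hq0 : q ≠ 0) (hq : ∀ k : ℕ, 0 < k → q ^ k ≠ 1) (hc : ∀ i ≤ 10, c * q ^ i ≠ 1)
    (h2 : h 2 = 0) (hκ : σ ^ 2 ≠ c * (1 + q) ^ 2) :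
    h 0 = 0 ∧ h 1 = 0 ∧ b0' = (h 3 + h 4) * b0 ∧ b1' = (h 3 + h 4) * b1 := by
  obtain ⟨⟨h1, d1, d2, d3⟩, -⟩ := H.diag_coefficients hN hq0 hq hc
  rw [h2] at d2 d3
  have h0 : h 0 = 0 := by
    have : (σ ^ 2 - c * (1 + q) ^ 2) * h 0 = 0 := by
      linear_combination σ * d2 - d3 - σ ^ 2 * d1
    exact (mul_eq_zero.1 this).resolve_left (sub_ne_zero.2 hκ)
  exact ⟨h0, h1, by linear_combination d2 - σ * d1 - σ * h0, by linear_combination d1 + h0⟩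

/-- In the first case of `HeunEqs.exists_cases` the off-diagonal entries are rescaled. An entry of
`Z` may vanish, but not two neighbouring ones, so that one of the two relations applies. -/
theorem HeunEqs.proportional {c : ℂ} {Vd Vu Wd Wu : ℕ → ℂ} {b0 b1 b0' b1' : ℂ}
    (H : HeunEqs N q c σ Vd Vu Wd Wu b0 b1 b0' b1' h)
    (hq0 : q ≠ 0) (hq : ∀ k : ℕ, 0 < k → q ^ k ≠ 1) (hc : ∀ i ≤ 2 * N + 2, c * q ^ i ≠ 1)
    (h2 : h 2 = 0) (h4 : h 4 = 0) (h7 : h 7 = 0) (h8 : h 8 = 0) (h39 : h 3 * h 9 = 1)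
    {i : ℕ} (hi : i < N) : Wd i = h 3 * Vd i ∧ Wu i = h 3 * Vu i := by
  have key : ∀ {x y : ℂ}, (grid q c i + σ) * (x - y) = 0 →
      (grid q c (i + 1) + σ) * (x - y) = 0 → x = y := by
    intro x y e1 e2
    apply sub_eq_zero.1
    apply mul_left_cancel₀ (sub_ne_zero.2
      (grid_ne_grid hq0 hq (c := c) (m := i) (n := i + 1) (by omega) (hc _ (by omega))))
    linear_combination e1 - e2
  have hd := H.down i hi
  have hd' := H.down' i hi
  have hu := H.up i hi
  have hu' := H.up' i hi
  rw [h2, h4] at hd hu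
  rw [h7, h8] at hd' hu'
  constructor
  · refine key (by linear_combination hd) ?_
    linear_combination -h 3 * hd' - (grid q c (i + 1) + σ) * Wd i * h39
  · refine key ?_ (by linear_combination hu)
    linear_combination -h 3 * hu' - (grid q c i + σ) * Wu i * h39

end

/-! ### Uniqueness of the family -/

section

variable {N : ℕ} {q α β δ α' β' δ' σ s l : ℂ} {ν : ℕ → ℂ} {h : Fin 10 → ℂ}

/-- In the commutator case, if the two coefficients of the numerators of the diagonals are
exchanged, the Heun coefficients are those of the family, up to rescaling of `W`. -/
theorem IsCommCase.eq_scaleHeun {η p b : ℂ} (K : IsCommCase q (α * β) σ s l h)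
    (hq1 : 1 - q ≠ 0) (hq2 : 1 + q ≠ 0) (hα : α ≠ 0) (hβ : β ≠ 0) (hδ : δ ≠ 0) (hη : η ≠ 0)
    (hl : l = α * β * η / s) (h1 : h 1 = 0) (h6 : h 6 = 0)
    (hp : p = psi q α β (gam q N) δ) (hb : b = racahB0 q α β (gam q N) δ)
    (h0 : -η * b / (1 + q) = h 0 + (h 3 + h 4) * p)
    (h5 : p = h 5 + (h 8 + h 9) * (-η * b / (1 + q))) :
    h = scaleHeun (η * (β * δ)) (wilsonHeun N q α β δ s) := by
  have hs := K.s_ne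
  have hσ := K.sigma_eq
  have a34 := K.h34
  have a43 := K.h43
  have a2 := K.h2
  have a98 := K.h98
  have a89 := K.h89
  have a7 := K.h7
  rw [hl] at a34 a43 a2 a98 a89 a7
  have e : (1 : ℂ) - q ^ 2 = (1 - q) * (1 + q) := by ring
  have b3 : h 3 = (η / s - q * (α * β * η * q * s)) / ((1 - q) * (1 + q)) := by
    rw [eq_div_iff (mul_ne_zero hq1 hq2)]
    field_simp at a34 a43 ⊢
    linear_combination a34 - q * s * a43
  have b4 : h 4 = (α * β * η * q * s - q * (η / s)) / ((1 - q) * (1 + q)) := by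
    rw [eq_div_iff (mul_ne_zero hq1 hq2)]
    field_simp at a34 a43 ⊢
    linear_combination s * a43 - q * a34
  have b8 : h 8 = (q * s / η - q * (1 / (α * β * η * s))) / ((1 - q) * (1 + q)) := by
    rw [eq_div_iff (mul_ne_zero hq1 hq2)]
    field_simp at a98 a89 ⊢
    linear_combination α * β * s * a89 - q * a98
  have b9 : h 9 = (1 / (α * β * η * s) - q * (q * s / η)) / ((1 - q) * (1 + q)) := by
    rw [eq_div_iff (mul_ne_zero hq1 hq2)]
    field_simp at a98 a89 ⊢
    linear_combination a98 - α * β * s * q * a89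
  have b34 : h 3 + h 4 = (η / s + α * β * η * q * s) / (1 + q) := by
    rw [b3, b4]; field_simp; ring
  have b89 : h 8 + h 9 = (q * s / η + 1 / (α * β * η * s)) / (1 + q) := by
    rw [b8, b9]; field_simp; ring
  have b2 : h 2 = -(α * β * η / s) * s * (1 + q) - (h 3 + h 4) * σ := by linear_combination a2
  have b7 : h 7 = -(α * β) * (1 + q) / (α * β * η / s * s) - (h 8 + h 9) * σ := by
    linear_combination a7
  have b0 : h 0 = -η * b / (1 + q) - (h 3 + h 4) * p := by linear_combination -h0
  have b5 : h 5 = p + (h 8 + h 9) * (η * b / (1 + q)) := by linear_combination -h5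
  rw [b34] at b2 b0
  rw [b89] at b7 b5
  rw [hσ] at b2 b7
  obtain ⟨r, hr⟩ : ∃ r, r = 1 - q := ⟨_, rfl⟩
  obtain ⟨t, ht⟩ : ∃ t, t = 1 + q := ⟨_, rfl⟩
  rw [← hr, ← ht] at b3 b4 b8 b9
  rw [← ht] at b0 b2 b5 b7 hq2
  rw [← hr] at hq1
  funext i
  fin_cases i
  all_goals
    simp only [scaleHeun, wilsonHeun, wilsonH0, wilsonH2, wilsonH5, wilsonH7, Matrix.cons_val,
      Fin.reduceFinMk, Fin.mk_one, Fin.zero_eta, e, psi_dual (ht ▸ hq2) hβ hδ, ← hp, ← hb, ← hr,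
      ← ht]
  · rw [b0]; field_simp
  · rw [h1, mul_zero]
  · rw [b2]; field_simp; rw [ht]; ring
  · rw [b3]; field_simp
  · rw [b4]; field_simp
  · rw [b5]; field_simp; ring
  · exact h6
  · rw [b7]; field_simp; rw [ht]; ring
  · rw [b8]; field_simp
  · rw [b9]; field_simp

theorem IsHeunParam.scale {μ₂ μ₇ h₃₄ c : ℂ} (hP : IsHeunParam q α β σ h μ₂ μ₇ h₃₄ s) :
    IsHeunParam q α β σ (scaleHeun c h) μ₂ μ₇ (c * h₃₄) s := by
  refine ⟨hP.s_ne, hP.μ₂_ne, hP.μ₇_ne, hP.sigma_eq, ?_, ?_, ?_, ?_, ?_⟩ <;>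
    simp only [scaleHeun, Matrix.cons_val]
  · rw [hP.h₃₄_eq]; ring
  · rw [hP.h1_eq, mul_zero]
  · exact hP.h6_eq
  · rw [hP.h2_eq]; ring
  · rw [hP.h7_eq]; ring

/-- A non-degenerate Leonard trio with Heun relations belongs to the family, up to rescaling of `W`.
Only the first of the two non-degeneracy conditions enters, to exclude the degenerate relations and
the anticommutator case. -/
theorem eq_family_of_isNondegLeonardTrio (z : Module.Basis (Fin (N + 1)) ℂ E) (hq0 : q ≠ 0)
    (hq : ∀ k : ℕ, 0 < k → q ^ k ≠ 1) (hN : 4 ≤ N) (hG : IsGeneric N q α β δ)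
    (hα' : α' ≠ 0) (hν : ∀ i : ℕ, 1 ≤ i → i ≤ N → ν i ≠ 0)
    (hLP : IsLeonardPair N (opRacah z q α' (α * β / α') δ' ν) (opZ z q α β σ))
    (hH : HeunRelations (opRacah z q α β δ 1) (opRacah z q α' (α * β / α') δ' ν)
      (opZ z q α β σ) h)
    (hND : IsNondegLeonardTrio N (opRacah z q α β δ 1) (opRacah z q α' (α * β / α') δ' ν)
      (opZ z q α β σ)) :
    ∃ s c : ℂ, IsAdmissible N q α β s ∧ σ = sig q α β s ∧
      ((c = 1 ∧ δ' = α / (β * δ) ∧ (α' = α ∨ α' = α / δ)) ∨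
        (c = β * δ / α ∧ δ' = β * δ / α ∧ (α' = β ∨ α' = β * δ))) ∧
      opRacah z q α' (α * β / α') δ' ν = c • opWilson z q α β δ s ∧
      h = scaleHeun c (wilsonHeun N q α β δ s) ∧
      IsHeunParam q α β σ h s (1 / (α * β * s)) (c / (β * δ * s)) s ∧
      (α' = α → δ' = α / (β * δ) → ∀ i : ℕ, 1 ≤ i → i ≤ N → ν i = wilsonNu q α β δ s i) := by
  obtain ⟨hq1, hq2, -⟩ := one_sub_ne_zero_of_pow hq
  have hα := hG.a_ne
  have hβ := hG.b_ne
  have hδ := hG.d_ne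
  have hR := hG.regular
  have hab : α' * (α * β / α') = α * β := by field_simp
  have hc0 : α * β ≠ 0 := mul_ne_zero hα hβ
  have hc10 : ∀ i ≤ 10, α * β * q ^ i ≠ 1 := fun i hi => hR.ab i (by omega)
  have H : RacahHeunEqs N q α β δ α' (α * β / α') δ' σ ν h :=
    heunEqs_of_heunRelations z hq0 hq hR hab hLP hH
  obtain ⟨v, w, hB, hC, -⟩ := hND
  -- the two degenerate forms of the relations
  have excl1 : ∀ τ : ℂ, (∀ i < N, racahC q α' (α * β / α') (gam q N) δ' (i + 1) * ν (i + 1) =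
        τ * racahC q α β (gam q N) δ (i + 1)) →
      (∀ i < N, racahA q α' (α * β / α') (gam q N) δ' i * (1 / ν (i + 1)) =
        τ * racahA q α β (gam q N) δ i) →
      racahB0 q α' (α * β / α') (gam q N) δ' = τ * racahB0 q α β (gam q N) δ →
      psi q α' (α * β / α') (gam q N) δ' = τ * psi q α β (gam q N) δ → False := by
    intro τ g1 g2 g3 g4
    refine not_cond1_of_smul (by omega) hB (τ := τ) ?_ hC
    exact opRacah_eq_smul z hq0 hR.ab hab (fun i hi => by rw [g1 i hi]; simp)
      (fun i hi => by rw [g2 i hi]; simp) g3 g4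
  have excl2 : h 0 = 0 → h 1 = 0 → h 2 = 0 → h 3 = 0 → False := by
    intro g0 g1 g2 g3
    refine not_cond1_of_mul_eq (by omega) hB (τ := h 4) ?_ hC
    rw [hH.1, g0, g1, g2, g3]
    simp
  rcases HeunEqs.exists_cases H hN hq0 hq hc0 hc10 with ⟨h2, h4, h7, h8, h39, hκ⟩ | ⟨h2, h3, hκ⟩ |
    ⟨s, l, K⟩ | ⟨s, l, K⟩
  · exfalso
    obtain ⟨-, -, g0, g1⟩ := HeunEqs.coef_zero H hN hq0 hq hc10 h2 hκ
    rw [h4, add_zero] at g0 g1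
    have hp := fun i hi => HeunEqs.proportional H hq0 hq hR.ab h2 h4 h7 h8 h39 (i := i) hi
    exact excl1 (h 3) (fun i hi => (hp i hi).1) (fun i hi => (hp i hi).2) g0 g1
  · exfalso
    obtain ⟨h0, h1, -, -⟩ := HeunEqs.coef_zero H hN hq0 hq hc10 h2 hκ
    exact excl2 h0 h1 h2 h3
  · rcases H.of_isCommCase K hN hq0 hq hG hab hν with ⟨-, -, -, -, g1, g2, g3, g4⟩ |
      ⟨h0, h1, h2, h3⟩ | ⟨η, hη, hcase, t1, t0, hl⟩
    · exact (excl1 _ g1 g2 g3 g4).elim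
    · exact (excl2 h0 h1 h2 h3).elim
    have hs := K.s_ne
    have hoff := fun i hi => HeunEqs.offdiag_of_isCommCase H K hq0 hq hc0 hR.ab (i := i) hi
    obtain ⟨⟨h1, d1, -, -⟩, h6, d5⟩ := H.diag_coefficients hN hq0 hq hc10
    rw [t1] at d1 d5
    have hadm : IsAdmissible N q α β s := by
      refine ⟨hs, fun i h1 hi => ?_⟩
      obtain ⟨j, rfl⟩ : ∃ j, i = j + 1 := ⟨i - 1, by omega⟩
      exact ⟨(hoff j (by omega)).1, (hoff j (by omega)).2.1⟩
    have hσ : σ = sig q α β s := by rw [K.sigma_eq, sig]; ring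
    have hh := K.eq_scaleHeun (N := N) (δ := δ) hq1 hq2 hα hβ hδ hη hl h1 h6 rfl rfl d1 d5
    have hW : opRacah z q α' (α * β / α') δ' ν = (η * (β * δ)) • opWilson z q α β δ s := by
      refine opRacah_eq_smul z hq0 hR.ab hab (fun i hi => ?_) (fun i hi => ?_) ?_ ?_
      · obtain ⟨-, g2, g3, -⟩ := hoff i hi
        rw [racahC_mul_wilsonNu hβ hδ (hR.bd _ (by omega)) g2]
        have g2 := sub_ne_zero.2 g2.symm
        rw [hl] at g3
        generalize 1 - α * β * s * q ^ (i + 1) = D at *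
        apply mul_right_cancel₀ g2
        rw [g3]
        field_simp
      · obtain ⟨g1, -, -, g4⟩ := hoff i hi
        rw [racahA_mul_wilsonNu hβ hδ (hR.da _ (by omega)) g1]
        have g1 := sub_ne_zero.2 g1
        rw [hl] at g4
        generalize s - q ^ (i + 1) = D at *
        apply mul_left_cancel₀ (mul_ne_zero hc0 g1)
        have : α * β * D * (racahA q α' (α * β / α') (gam q N) δ' i * (1 / ν (i + 1))) =
          α * β * (racahA q α' (α * β / α') (gam q N) δ' i * (1 / ν (i + 1))) * D := by ring
        rw [this, g4]
        field_simp
      · rw [t0, racahB0_dual hβ hδ]; field_simp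
      · rw [t1, psi_dual hq2 hβ hδ]; field_simp
    have hc : (η * (β * δ) = 1 ∧ δ' = α / (β * δ) ∧ (α' = α ∨ α' = α / δ)) ∨
        (η * (β * δ) = β * δ / α ∧ δ' = β * δ / α ∧ (α' = β ∨ α' = β * δ)) := by
      rcases hcase with ⟨rfl, h1, h2⟩ | ⟨rfl, h1, h2⟩
      · exact Or.inl ⟨by field_simp, h1, h2⟩
      · exact Or.inr ⟨by field_simp, h1, h2⟩
    refine ⟨s, η * (β * δ), hadm, hσ, hc, hW, hh, ?_, ?_⟩
    · rw [hh, hσ]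
      have := (isHeunParam_wilson N hq1 hq2 hα hβ hδ hs).scale (c := η * (β * δ))
      rwa [mul_one_div] at this
    · rintro rfl rfl i h1 hi
      have hcs : η * (β * δ) = 1 := by
        rcases hc with h | ⟨-, -, h | h⟩
        · exact h.1
        · exact (hG.ab h).elim
        · exact (hG.bd_a h).elim
      rw [hcs, one_smul] at hW
      obtain ⟨j, rfl⟩ : ∃ j, i = j + 1 := ⟨i - 1, by omega⟩
      have hmat := congrArg (fun X => mat z X ⟨j + 1, by omega⟩ ⟨j, by omega⟩) hW
      rw [opWilson, mat_opRacah, mat_opRacah, if_pos rfl, if_pos rfl,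
        show α' * β / α' = β by field_simp] at hmat
      exact mul_left_cancel₀ (hG.regular'.racahC_ne_zero hq0 hq h1 hi) hmat
  · exfalso
    obtain ⟨g, h1, h3, h4, hg⟩ := H.of_isAnticommCase K hN hq0 hq hG hab hν
    exact not_cond1_of_anticomm z (by omega) hq0 hq hR hδ hab hν hB hH h1 h3 h4 hg hC

end

/-! ### Generic parameters -/

/-- The property `p` of three parameters holds outside the zero set of some nonzero polynomial. -/
def HoldsGenerically (p : ℂ → ℂ → ℂ → Prop) : Prop :=
  ∃ P : MvPolynomial (Fin 3) ℂ, P ≠ 0 ∧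
    ∀ α β δ : ℂ, MvPolynomial.eval ![α, β, δ] P ≠ 0 → p α β δ

theorem HoldsGenerically.and {p r : ℂ → ℂ → ℂ → Prop} (hp : HoldsGenerically p)
    (hr : HoldsGenerically r) : HoldsGenerically fun α β δ => p α β δ ∧ r α β δ := by
  obtain ⟨P, hP, hp⟩ := hp
  obtain ⟨R, hR, hr⟩ := hr
  refine ⟨P * R, mul_ne_zero hP hR, fun α β δ h => ?_⟩
  rw [map_mul] at h
  exact ⟨hp α β δ (left_ne_zero_of_mul h), hr α β δ (right_ne_zero_of_mul h)⟩

theorem HoldsGenerically.forall_le {p : ℕ → ℂ → ℂ → ℂ → Prop} (n : ℕ)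
    (hp : ∀ i, HoldsGenerically (p i)) :
    HoldsGenerically fun α β δ => ∀ i ≤ n, p i α β δ := by
  choose P hP hp using hp
  refine ⟨∏ i ∈ Finset.range (n + 1), P i, Finset.prod_ne_zero_iff.2 fun i _ => hP i,
    fun α β δ h i hi => hp i α β δ ?_⟩
  rw [map_prod] at h
  exact Finset.prod_ne_zero_iff.1 h i (Finset.mem_range.2 (by omega))

/-- Two polynomials that differ at one point differ generically. -/
theorem HoldsGenerically.ne_of_eval (F G : MvPolynomial (Fin 3) ℂ) {x : Fin 3 → ℂ}
    (h : MvPolynomial.eval x F ≠ MvPolynomial.eval x G) :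
    HoldsGenerically fun α β δ =>
      MvPolynomial.eval ![α, β, δ] F ≠ MvPolynomial.eval ![α, β, δ] G := by
  refine ⟨F - G, fun h0 => h ?_, fun α β δ h0 he => h0 ?_⟩
  · rw [sub_eq_zero.1 h0]
  · rw [map_sub, he, sub_self]

open MvPolynomial in
theorem holdsGenerically_isGeneric (N : ℕ) {q : ℂ} (hq0 : q ≠ 0) :
    HoldsGenerically (IsGeneric N q) := by
  let ne := HoldsGenerically.ne_of_eval
  have hα := ne (X 0) 0 (x := ![1, 0, 0]) (by simp)
  have hβ := ne (X 1) 0 (x := ![0, 1, 0]) (by simp)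
  have hδ := ne (X 2) 0 (x := ![0, 0, 1]) (by simp)
  have hab := HoldsGenerically.forall_le (2 * N + 2) fun i =>
    ne (X 0 * X 1 * C (q ^ i)) 1 (x := 0) (by simp)
  have ha := HoldsGenerically.forall_le N fun i => ne (X 0 * C (q ^ i)) 1 (x := 0) (by simp)
  have hb := HoldsGenerically.forall_le N fun i => ne (X 1 * C (q ^ i)) 1 (x := 0) (by simp)
  have hbd := HoldsGenerically.forall_le N fun i =>
    ne (X 1 * X 2 * C (q ^ i)) 1 (x := 0) (by simp)
  have hda := HoldsGenerically.forall_le N fun i =>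
    ne (X 2) (X 0 * C (q ^ i)) (x := ![0, 0, 1]) (by simp)
  have hd := HoldsGenerically.forall_le (2 * N + 2) fun i =>
    ne (C (q ^ (N + 1))) (X 2 * C (q ^ i)) (x := 0) (by simp [hq0])
  have hd' := HoldsGenerically.forall_le (2 * N + 2) fun i =>
    ne (X 0 * C (q ^ i)) (X 1 * X 2 * C (q ^ (N + 1))) (x := ![1, 0, 0]) (by simp [hq0])
  have h1 := ne (X 0) (X 1) (x := ![1, 0, 0]) (by simp)
  have h2 := ne (X 0) (C (q ^ 2) * X 1) (x := ![1, 0, 0]) (by simp)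
  have h3 := ne (X 1) (C (q ^ 2) * X 0) (x := ![0, 1, 0]) (by simp)
  have h4 := ne (X 1 * X 2 ^ 2) (X 0) (x := ![1, 0, 0]) (by simp)
  have h5 := ne (C (q ^ 2) * X 0) (X 1 * X 2 ^ 2) (x := ![1, 0, 0]) (by simp [hq0])
  have h6 := ne (C (q ^ 2) * X 1 * X 2 ^ 2) (X 0) (x := ![1, 0, 0]) (by simp)
  have h7 := ne (X 0) (X 1 * X 2) (x := ![1, 0, 0]) (by simp)
  obtain ⟨P, hP, h⟩ := (((hα.and hβ).and hδ).and (((hab.and ha).and (hb.and hbd)).and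
    ((hda.and hd).and hd'))).and (((h1.and h2).and (h3.and h4)).and ((h5.and h6).and h7))
  refine ⟨P, hP, fun α β δ hne => ?_⟩
  have h := h α β δ hne
  simp only [map_mul, map_pow, map_zero, map_one, eval_X, eval_C, Matrix.cons_val] at h
  obtain ⟨⟨⟨⟨hα, hβ⟩, hδ⟩, ⟨⟨hab, ha⟩, hb, hbd⟩, ⟨hda, hd⟩, hd'⟩, ⟨⟨h1, h2⟩, h3, h4⟩, ⟨h5, h6⟩,
    h7⟩ := h
  have hβδ : β * δ ≠ 0 := mul_ne_zero hβ hδ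
  refine ⟨hα, hβ, hδ, ⟨hab, ha, hb, hbd, hda, fun i hi => (hd i hi).symm⟩,
    ⟨hab, ha, hb, ?_, ?_, ?_⟩, h1, h2, h3, h4,
    h5.symm, h6, h7⟩
  · intro i hi he
    refine hda i hi ?_
    field_simp at he
    exact he.symm
  · intro i hi he
    refine hbd i hi ?_
    rw [div_eq_iff hβδ] at he
    apply mul_left_cancel₀ hα
    linear_combination -he
  · intro i hi he
    refine hd' i hi ?_
    rw [div_mul_eq_mul_div, div_eq_iff hβδ] at he
    linear_combination he

end

end LeonardTrio

theorem mainTheorem4 {E : Type*} [AddCommGroup E] [Module ℂ E] (N : ℕ)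
    (z : Module.Basis (Fin (N + 1)) ℂ E) (q : ℂ) (hq0 : q ≠ 0)
    (hq : ∀ k : ℕ, 0 < k → q ^ k ≠ 1) :
    ∃ P : MvPolynomial (Fin 3) ℂ, P ≠ 0 ∧
      ∀ α β δ : ℂ, MvPolynomial.eval ![α, β, δ] P ≠ 0 →
        -- the family: it consists of irreducible Leonard trios, with explicit Heun relations
        (∀ s : ℂ, IsAdmissible N q α β s →
          IsLeonardPair N (opRacah z q α β δ 1) (opZ z q α β (sig q α β s)) ∧
          IsLeonardPair N (opWilson z q α β δ s) (opZ z q α β (sig q α β s)) ∧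
          IsIrredLeonardTrio N (opRacah z q α β δ 1) (opWilson z q α β δ s)
            (opZ z q α β (sig q α β s)) ∧
          WilsonHeunRelations N q α β δ s (opRacah z q α β δ 1) (opWilson z q α β δ s)
            (opZ z q α β (sig q α β s)) ∧
          HeunRelations (opRacah z q α β δ 1) (opWilson z q α β δ s)
            (opZ z q α β (sig q α β s)) (wilsonHeun N q α β δ s) ∧
          IsHeunParam q α β (sig q α β s) (wilsonHeun N q α β δ s)
            s (1 / (α * β * s)) (1 / (β * δ * s)) s) ∧
        -- all but finitely many of its members satisfy the non-degeneracy conditions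
        (∃ F : Set ℂ, F.Finite ∧ ∀ s : ℂ, s ∉ F →
          IsAdmissible N q α β s ∧
          IsNondegLeonardTrio N (opRacah z q α β δ 1) (opWilson z q α β δ s)
            (opZ z q α β (sig q α β s))) ∧
        -- uniqueness
        (4 ≤ N → ∀ (α' δ' σ : ℂ) (ν : ℕ → ℂ) (h : Fin 10 → ℂ),
          α' ≠ 0 → (∀ i : ℕ, 1 ≤ i → i ≤ N → ν i ≠ 0) →
          IsLeonardPair N (opRacah z q α' (α * β / α') δ' ν) (opZ z q α β σ) →
          HeunRelations (opRacah z q α β δ 1) (opRacah z q α' (α * β / α') δ' ν)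
            (opZ z q α β σ) h →
          IsNondegLeonardTrio N (opRacah z q α β δ 1) (opRacah z q α' (α * β / α') δ' ν)
            (opZ z q α β σ) →
          ∃ s c : ℂ, IsAdmissible N q α β s ∧ σ = sig q α β s ∧
            ((c = 1 ∧ δ' = α / (β * δ) ∧ (α' = α ∨ α' = α / δ)) ∨
              (c = β * δ / α ∧ δ' = β * δ / α ∧ (α' = β ∨ α' = β * δ))) ∧
            opRacah z q α' (α * β / α') δ' ν = c • opWilson z q α β δ s ∧
            h = scaleHeun c (wilsonHeun N q α β δ s) ∧
            IsHeunParam q α β σ h s (1 / (α * β * s)) (c / (β * δ * s)) s ∧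
            (α' = α → δ' = α / (β * δ) → ∀ i : ℕ, 1 ≤ i → i ≤ N →
              ν i = wilsonNu q α β δ s i)) := by
  obtain ⟨P, hP, h⟩ := holdsGenerically_isGeneric N hq0
  refine ⟨P, hP, fun α β δ hne => ?_⟩
  have hG := h α β δ hne
  obtain ⟨hq1, hq2, -⟩ := one_sub_ne_zero_of_pow hq
  refine ⟨fun s hs => ?_, exists_finite_nondeg z hq0 hq hG.a_ne hG.b_ne hG.d_ne hG.regular
    hG.regular', fun hN α' δ' σ ν h hα' hν hLP hH hND =>
      eq_family_of_isNondegLeonardTrio z hq0 hq hN hG hα' hν hLP hH hND⟩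
  have hH := heunRelations_wilson z hq0 hq hG.a_ne hG.b_ne hG.d_ne hG.regular hs
  exact ⟨hG.regular.isLeonardPair hq0 hq z (fun _ _ _ => one_ne_zero) _,
    hG.regular'.isLeonardPair hq0 hq z (wilsonNu_ne_zero hG.b_ne hG.regular hs) _,
    isIrredLeonardTrio_wilson z hq0 hq hG.a_ne hG.b_ne hG.d_ne hG.regular hG.regular' hs,
    wilsonHeunRelations_of_heunRelations hH, hH,
    isHeunParam_wilson N hq1 hq2 hG.a_ne hG.b_ne hG.d_ne hs.1⟩
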